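/- **Theorem.** Let $\mathfrak{C}\colon \mathbf{sSet}\to\mathbf{sSet}\text{-}\mathbf{Cat}$ be the homotopy coherent realisation functor, i.e. the left adjoint of the homotopy coherent nerve: it is the left Kan extension along the Yoneda embedding of $[n]\mapsto\mathfrak{C}\Delta^n$, where $\mathfrak{C}\Delta^n$ has objects $0,\dots,n$, its simplicial set of arrows from $i$ to $j$ is the nerve of the poset of subsets of $[i,j]$ containing both endpoints, and composition is union. For simplicial sets $X,Y$ let $X\star Y$ be their join, whose $n$-simplices are the triples consisting of a map $p\colon\Delta^n\to\Delta^1$, a map $p^{-1}(0)\to X$ and a map $p^{-1}(1)\to Y$. Let $\mathbb{2}=\{0\to1\}$ be the arrow category, regarded as a discretely enriched simplicial category, and let $P_{X,Y}\colon\mathfrak{C}[X\star Y]\to\mathbb{2}$ be the simplicial functor sending the vertices of $X$ to $0$ and the vertices of $Y$ to $1$. The functors $\mathfrak{C}[X\star !]\colon\mathfrak{C}[X\star Y]\to\mathfrak{C}[X\star\Delta^0]$ and $\mathfrak{C}[!\star Y]\colon\mathfrak{C}[X\star Y]\to\mathfrak{C}[\Delta^0\star Y]$ induced by the unique maps to $\Delta^0$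 commute with the projections to $\mathbb{2}$, and so induce a simplicial functor $$\Phi_{X,Y}\colon \mathfrak{C}[X\star Y]\longrightarrow \mathfrak{C}[X\star\Delta^0]\times_{\mathbb{2}}\mathfrak{C}[\Delta^0\star Y]$$ into the fibre product of simplicial categories. A simplicial category is a *simplicial computad* if, for every $n$, each $n$-arrow is uniquely a (possibly empty) composite of atomic $n$-arrows (non-identity $n$-arrows without non-trivial factorisation), and degenerate images of atomic arrows are atomic; a simplicial functor between simplicial computads is a *morphism of simplicial computads* if it sends each atomic arrow to an atomic arrow or to an identity. Then, for all simplicial sets $X$ and $Y$, the source and the target of $\Phi_{X,Y}$ are simplicial computads, $\Phi_{X,Y}$ is a morphism of simplicial computads, and $\Phi_{X,Y}$ is an isomorphism of simplicial computads. -/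

import Mathlib

open CategoryTheory MonoidalCategory Opposite

universe u

/-! ### Simplicial categories, described through their `n`-arrows -/

namespace SimpCat

section Arrows

variable {A : Type u} [EnrichedCategory SSet.{u} A]

/-- The identity `n`-arrow on an object of a simplicial category. -/
def nId (a : A) (n : SimplexCategoryᵒᵖ) : (a ⟶[SSet.{u}] a).obj n :=
  (eId SSet.{u} a).app n PUnit.unit

/-- Composition of `n`-arrows in a simplicial category (in diagrammatic order). -/
def nComp {a b c : A} {n : SimplexCategoryᵒᵖ} (f : (a ⟶[SSet.{u}] b).obj n)
    (g : (b ⟶[SSet.{u}] c).obj n) : (a ⟶[SSet.{u}] c).obj n :=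
  (eComp SSet.{u} a b c).app n (f, g)

theorem nId_nComp {a b : A} {n : SimplexCategoryᵒᵖ} (f : (a ⟶[SSet.{u}] b).obj n) :
    nComp (nId a n) f = f :=
  congr($(congr($(e_id_comp SSet.{u} a b).app n)) f)

theorem nComp_nId {a b : A} {n : SimplexCategoryᵒᵖ} (f : (a ⟶[SSet.{u}] b).obj n) :
    nComp f (nId b n) = f :=
  congr($(congr($(e_comp_id SSet.{u} a b).app n)) f)

theorem nComp_assoc {a b c d : A} {n : SimplexCategoryᵒᵖ} (f : (a ⟶[SSet.{u}] b).obj n)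
    (g : (b ⟶[SSet.{u}] c).obj n) (h : (c ⟶[SSet.{u}] d).obj n) :
    nComp (nComp f g) h = nComp f (nComp g h) :=
  congr($(congr($(e_assoc SSet.{u} a b c d).app n)) (f, g, h))

theorem map_nId (a : A) {n m : SimplexCategoryᵒᵖ} (θ : n ⟶ m) :
    (a ⟶[SSet.{u}] a).map θ (nId a n) = nId a m :=
  (congr($((eId SSet.{u} a).naturality θ) PUnit.unit)).symm

theorem map_nComp {a b c : A} {n m : SimplexCategoryᵒᵖ} (θ : n ⟶ m)
    (f : (a ⟶[SSet.{u}] b).obj n) (g : (b ⟶[SSet.{u}] c).obj n) :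
    (a ⟶[SSet.{u}] c).map θ (nComp f g) =
      nComp ((a ⟶[SSet.{u}] b).map θ f) ((b ⟶[SSet.{u}] c).map θ g) :=
  (congr($((eComp SSet.{u} a b c).naturality θ) (f, g))).symm

end Arrows

/-- The data of a simplicial category in terms of its `n`-arrows: a family of simplicial sets
with simplicial, strictly associative and unital composition. -/
structure Core (A : Type u) where
  Hom : A → A → SSet.{u}
  id (a : A) (n : SimplexCategoryᵒᵖ) : (Hom a a).obj n
  comp {a b c : A} {n : SimplexCategoryᵒᵖ} (f : (Hom a b).obj n) (g : (Hom b c).obj n) :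
    (Hom a c).obj n
  map_id (a : A) {n m : SimplexCategoryᵒᵖ} (θ : n ⟶ m) : (Hom a a).map θ (id a n) = id a m
  map_comp {a b c : A} {n m : SimplexCategoryᵒᵖ} (θ : n ⟶ m) (f : (Hom a b).obj n)
    (g : (Hom b c).obj n) :
    (Hom a c).map θ (comp f g) = comp ((Hom a b).map θ f) ((Hom b c).map θ g)
  id_comp {a b : A} {n : SimplexCategoryᵒᵖ} (f : (Hom a b).obj n) : comp (id a n) f = f
  comp_id {a b : A} {n : SimplexCategoryᵒᵖ} (f : (Hom a b).obj n) : comp f (id b n) = f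
  assoc {a b c d : A} {n : SimplexCategoryᵒᵖ} (f : (Hom a b).obj n) (g : (Hom b c).obj n)
    (h : (Hom c d).obj n) : comp (comp f g) h = comp f (comp g h)

/-- A category enriched in simplicial sets from its `n`-arrows. -/
@[reducible]
def Core.enriched {A : Type u} (K : SimpCat.Core A) : EnrichedCategory SSet.{u} A where
  Hom := K.Hom
  id a := { app := fun n => ↾fun _ => K.id a n
            naturality := fun _ _ θ => by ext x; exact (K.map_id a θ).symm }
  comp a b c := { app := fun n => ↾fun x => K.comp x.1 x.2
                  naturality := fun _ _ θ => by ext x; exact (K.map_comp θ x.1 x.2).symm }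
  id_comp a b := by ext n x; exact K.id_comp x
  comp_id a b := by ext n x; exact K.comp_id x
  assoc a b c d := by ext n x; exact K.assoc x.1 x.2.1 x.2.2

section Functors

variable {A B : Type u} [EnrichedCategory SSet.{u} A] [EnrichedCategory SSet.{u} B]

/-- The action of a simplicial functor on `n`-arrows. -/
def nMap (F : EnrichedFunctor SSet.{u} A B) {a b : A} {n : SimplexCategoryᵒᵖ}
    (f : (a ⟶[SSet.{u}] b).obj n) : (F.obj a ⟶[SSet.{u}] F.obj b).obj n :=
  (F.map a b).app n f

theorem nMap_nId (F : EnrichedFunctor SSet.{u} A B) (a : A) (n : SimplexCategoryᵒᵖ) :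
    nMap F (nId a n) = nId (F.obj a) n :=
  congr($(congr($(F.map_id a).app n)) PUnit.unit)

theorem nMap_nComp (F : EnrichedFunctor SSet.{u} A B) {a b c : A} {n : SimplexCategoryᵒᵖ}
    (f : (a ⟶[SSet.{u}] b).obj n) (g : (b ⟶[SSet.{u}] c).obj n) :
    nMap F (nComp f g) = nComp (nMap F f) (nMap F g) :=
  congr($(congr($(F.map_comp a b c).app n)) (f, g))

theorem nMap_map (F : EnrichedFunctor SSet.{u} A B) {a b : A} {n m : SimplexCategoryᵒᵖ}
    (θ : n ⟶ m) (f : (a ⟶[SSet.{u}] b).obj n) :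
    nMap F ((a ⟶[SSet.{u}] b).map θ f) = (F.obj a ⟶[SSet.{u}] F.obj b).map θ (nMap F f) :=
  congr($((F.map a b).naturality θ) f)

/-- A simplicial functor from its action on objects and `n`-arrows. -/
def mkFunctor (obj : A → B)
    (map : ∀ {a b : A} {n : SimplexCategoryᵒᵖ}, (a ⟶[SSet.{u}] b).obj n →
      (obj a ⟶[SSet.{u}] obj b).obj n)
    (map_map : ∀ {a b : A} {n m : SimplexCategoryᵒᵖ} (θ : n ⟶ m) (f : (a ⟶[SSet.{u}] b).obj n),
      map ((a ⟶[SSet.{u}] b).map θ f) = (obj a ⟶[SSet.{u}] obj b).map θ (map f))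
    (map_id : ∀ (a : A) (n : SimplexCategoryᵒᵖ), map (nId a n) = nId (obj a) n)
    (map_comp : ∀ {a b c : A} {n : SimplexCategoryᵒᵖ} (f : (a ⟶[SSet.{u}] b).obj n)
      (g : (b ⟶[SSet.{u}] c).obj n), map (nComp f g) = nComp (map f) (map g)) :
    EnrichedFunctor SSet.{u} A B where
  obj := obj
  map a b := { app := fun n => ↾fun f => map f
               naturality := fun _ _ θ => by ext f; exact map_map θ f }
  map_id a := by ext n x; exact map_id a n
  map_comp a b c := by ext n x; exact map_comp x.1 x.2

theorem functor_hext {F G : EnrichedFunctor SSet.{u} A B} (h : ∀ a, F.obj a = G.obj a)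
    (h' : ∀ (a b : A) (n : SimplexCategoryᵒᵖ) (f : (a ⟶[SSet.{u}] b).obj n),
      HEq (nMap F f) (nMap G f)) : F = G := by
  obtain ⟨Fo, Fm, _, _⟩ := F
  obtain ⟨Go, Gm, _, _⟩ := G
  obtain rfl : Fo = Go := funext h
  congr
  funext a b
  ext n f
  exact eq_of_heq (h' a b n f)

end Functors

/-- The category of `n`-arrows of a simplicial category `A`: it has the objects of `A`. -/
structure Level (A : Type u) (n : SimplexCategoryᵒᵖ) where
  of : A

instance (A : Type u) [EnrichedCategory SSet.{u} A] (n : SimplexCategoryᵒᵖ) :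
    Category.{u} (Level A n) where
  Hom a b := (a.of ⟶[SSet.{u}] b.of).obj n
  id a := nId a.of n
  comp f g := nComp f g
  id_comp f := nId_nComp f
  comp_id f := nComp_nId f
  assoc f g h := nComp_assoc f g h

end SimpCat

/-- The category of (small) simplicial categories. -/
structure SCat where
  carrier : Type u
  [enriched : EnrichedCategory SSet.{u} carrier]

namespace SCat

instance : CoeSort SCat.{u} (Type u) := ⟨SCat.carrier⟩

instance (A : SCat.{u}) : EnrichedCategory SSet.{u} A := A.enriched

instance : Category.{u} SCat.{u} where
  Hom A B := EnrichedFunctor SSet.{u} A B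
  id A := EnrichedFunctor.id SSet.{u} A
  comp F G := EnrichedFunctor.comp SSet.{u} F G

end SCat

/-! ### Simplicial computads -/

namespace SimpCat

section Computads

universe v w

variable {C : Type w} [Category.{v} C]

/-- An arrow is an identity. -/
def IsIdentity {a b : C} (f : a ⟶ b) : Prop := ∃ h : a = b, f = eqToHom h

/-- An arrow is atomic if it is not an identity and admits no non-trivial factorisation. -/
def IsAtomic {a b : C} (f : a ⟶ b) : Prop :=
  ¬ IsIdentity f ∧ ∀ ⦃c : C⦄ (g : a ⟶ c) (h : c ⟶ b), g ≫ h = f → IsIdentity g ∨ IsIdentity h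

/-- The quiver of atomic arrows of a category. -/
structure Atoms (C : Type w) where
  of : C

instance : Quiver (Atoms C) where
  Hom a b := { f : a.of ⟶ b.of // IsAtomic f }

/-- The composite of a path of atomic arrows; the empty path composes to the identity. -/
def composite {a : Atoms C} : ∀ {b : Atoms C}, Quiver.Path a b → (a.of ⟶ b.of)
  | _, .nil => 𝟙 a.of
  | _, .cons p f => composite p ≫ f.1

/-- A computad is a category in which every arrow is, in a unique way, the composite of a
(possibly empty) path of atomic arrows: it is freely generated by its atomic arrows. -/
def IsComputad (C : Type w) [Category.{v} C] : Prop :=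
  ∀ (a b : Atoms C) (f : a.of ⟶ b.of), ∃! p : Quiver.Path a b, composite p = f

end Computads

section SimplicialComputads

/-- The `n`-arrow `f` of a simplicial category is an identity. -/
abbrev IsIdArrow {A : Type u} [EnrichedCategory SSet.{u} A] {a b : A} {n : SimplexCategoryᵒᵖ}
    (f : (a ⟶[SSet.{u}] b).obj n) : Prop :=
  IsIdentity (C := Level A n) (a := ⟨a⟩) (b := ⟨b⟩) f

/-- The `n`-arrow `f` of a simplicial category is atomic in the category of `n`-arrows. -/
abbrev IsAtomicArrow {A : Type u} [EnrichedCategory SSet.{u} A] {a b : A} {n : SimplexCategoryᵒᵖ}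
    (f : (a ⟶[SSet.{u}] b).obj n) : Prop :=
  IsAtomic (C := Level A n) (a := ⟨a⟩) (b := ⟨b⟩) f

/-- A simplicial category is a simplicial computad if each of its categories of `n`-arrows is
a computad and degenerate images of atomic arrows are atomic. -/
structure IsSimplicialComputad (A : Type u) [EnrichedCategory SSet.{u} A] : Prop where
  isComputad (n : SimplexCategoryᵒᵖ) : IsComputad (Level A n)
  degenerate_atomic {n m : SimplexCategory} (σ : m ⟶ n) [Epi σ] {a b : A}
    (f : (a ⟶[SSet.{u}] b).obj (op n)) :
    IsAtomicArrow f → IsAtomicArrow ((a ⟶[SSet.{u}] b).map σ.op f)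

variable {A B D : Type u} [EnrichedCategory SSet.{u} A] [EnrichedCategory SSet.{u} B]
  [EnrichedCategory SSet.{u} D]

/-- A simplicial functor is a computad morphism if it sends each atomic arrow to an atomic arrow
or to an identity. -/
def IsComputadMorphism (F : EnrichedFunctor SSet.{u} A B) : Prop :=
  ∀ ⦃a b : A⦄ ⦃n : SimplexCategoryᵒᵖ⦄ (f : (a ⟶[SSet.{u}] b).obj n),
    IsAtomicArrow f → IsAtomicArrow (nMap F f) ∨ IsIdArrow (nMap F f)

theorem isIdArrow_nId (a : A) (n : SimplexCategoryᵒᵖ) : IsIdArrow (nId a n) := ⟨rfl, rfl⟩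

theorem isIdArrow_nMap (F : EnrichedFunctor SSet.{u} A B) {a b : A} {n : SimplexCategoryᵒᵖ}
    (f : (a ⟶[SSet.{u}] b).obj n) (hf : IsIdArrow f) : IsIdArrow (nMap F f) := by
  obtain ⟨h, h'⟩ := hf
  obtain rfl : a = b := congrArg Level.of h
  obtain rfl : f = nId a n := h'
  rw [nMap_nId]
  exact isIdArrow_nId _ _

theorem isComputadMorphism_id : IsComputadMorphism (EnrichedFunctor.id SSet.{u} A) :=
  fun _ _ _ _ hf => Or.inl hf

theorem IsComputadMorphism.comp {F : EnrichedFunctor SSet.{u} A B}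
    {G : EnrichedFunctor SSet.{u} B D} (hF : IsComputadMorphism F) (hG : IsComputadMorphism G) :
    IsComputadMorphism (F.comp SSet.{u} G) := fun _ _ _ f hf =>
  (hF f hf).elim (fun h => hG _ h) (fun h => Or.inr (isIdArrow_nMap G _ h))

end SimplicialComputads

end SimpCat

/-- The category of simplicial computads and computad morphisms. -/
structure SCptd where
  toSCat : SCat.{u}
  isSimplicialComputad : SimpCat.IsSimplicialComputad toSCat

namespace SCptd

/-- Morphisms of simplicial computads. -/
@[ext]
structure Hom (A B : SCptd.{u}) where
  functor : A.toSCat ⟶ B.toSCat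
  isComputadMorphism : SimpCat.IsComputadMorphism functor

instance : Category.{u} SCptd.{u} where
  Hom A B := Hom A B
  id A := ⟨𝟙 A.toSCat, SimpCat.isComputadMorphism_id⟩
  comp F G := ⟨F.functor ≫ G.functor, F.isComputadMorphism.comp G.isComputadMorphism⟩

/-- The morphism of simplicial computads given by a simplicial functor which preserves atomic
arrows, or sends them to identities. -/
def homMk {A B : SCat.{u}} (F : A ⟶ B) (hA : SimpCat.IsSimplicialComputad A)
    (hB : SimpCat.IsSimplicialComputad B) (hF : SimpCat.IsComputadMorphism F) :
    SCptd.mk A hA ⟶ SCptd.mk B hB :=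
  ⟨F, hF⟩

end SCptd

/-! ### Homotopy coherent realisation -/

namespace SimpCat

/-- The homotopy coherent `k`-simplex: its objects are `0, …, k`, and its simplicial set of
arrows from `i` to `j` is the nerve of the poset of subsets of `[i, j]` containing both
endpoints, composition being given by union. -/
abbrev CohSimplex (k : SimplexCategory) : Type u := SimplicialThickening (ULift.{u} (Fin (k.len + 1)))

/-- The simplicial functor between homotopy coherent simplices induced by a simplicial operator:
it takes direct images of subsets. -/
def cohMap {k l : SimplexCategory} (α : k ⟶ l) :
    EnrichedFunctor SSet.{u} (CohSimplex.{u} k) (CohSimplex.{u} l) :=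
  SimplicialThickening.functor (OrderHom.uliftMap α.toOrderHom)

/-- The object `i` of the homotopy coherent `k`-simplex. -/
def cohObj {k : SimplexCategory} (i : Fin (k.len + 1)) : CohSimplex.{u} k := ⟨⟨i⟩⟩

/-- The vertices of a simplicial set. -/
abbrev Vert (X : SSet.{u}) : Type u := X.obj (op (SimplexCategory.mk 0))

/-- The `i`-th vertex of a simplex. -/
def vertex {X : SSet.{u}} {k : SimplexCategory} (x : X.obj (op k)) (i : CohSimplex.{u} k) :
    Vert X :=
  X.map (SimplexCategory.const (SimplexCategory.mk 0) k i.as.down).op x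

theorem vertex_map {X : SSet.{u}} {k l : SimplexCategory} (α : k ⟶ l) (x : X.obj (op l))
    (i : CohSimplex.{u} k) : vertex (X.map α.op x) i = vertex x ((cohMap α).obj i) := by
  simp only [vertex, ← Functor.map_comp_apply, ← op_comp]
  rfl

theorem vertex_app {X Y : SSet.{u}} (φ : X ⟶ Y) {k : SimplexCategory} (x : X.obj (op k))
    (i : CohSimplex.{u} k) : vertex (φ.app _ x) i = φ.app _ (vertex x i) :=
  (NatTrans.naturality_apply φ _ x).symm

/-- The generating `n`-arrows of the homotopy coherent realisation of `X`: an `n`-arrow of the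
homotopy coherent `k`-simplex attached to each `k`-simplex of `X`. -/
structure Gen (X : SSet.{u}) (n : SimplexCategoryᵒᵖ) (x y : Vert X) where
  dim : SimplexCategory
  simplex : X.obj (op dim)
  i : CohSimplex.{u} dim
  j : CohSimplex.{u} dim
  arrow : (i ⟶[SSet.{u}] j).obj n
  src : vertex simplex i = x
  tgt : vertex simplex j = y

/-- The quiver of generating `n`-arrows has the vertices of `X` as its objects. -/
structure GenQuiver (X : SSet.{u}) (n : SimplexCategoryᵒᵖ) where
  of : Vert X

instance (X : SSet.{u}) (n : SimplexCategoryᵒᵖ) : Quiver (GenQuiver X n) where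
  Hom x y := Gen X n x.of y.of

/-- Paths of generating `n`-arrows. -/
abbrev Word (X : SSet.{u}) (n : SimplexCategoryᵒᵖ) (x y : Vert X) : Type u :=
  Quiver.Path (V := GenQuiver X n) ⟨x⟩ ⟨y⟩

/-- The word of length one on the arrow `f : i ⟶ j` of the homotopy coherent simplex attached to
the simplex `s`. -/
def genWord {X : SSet.{u}} {n : SimplexCategoryᵒᵖ} {x y : Vert X} {k : SimplexCategory}
    (s : X.obj (op k)) {i j : CohSimplex.{u} k} (f : (i ⟶[SSet.{u}] j).obj n)
    (hi : vertex s i = x) (hj : vertex s j = y) : Word X n x y :=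
  Quiver.Hom.toPath (V := GenQuiver X n) (a := ⟨x⟩) (b := ⟨y⟩) (Gen.mk k s i j f hi hj)

/-- The relations between words: for each simplex of `X` the arrows of the attached homotopy
coherent simplex compose as they do there, and the homotopy coherent simplices attached to
`s` and to `α^* s` are glued along `α`. -/
inductive Rel (X : SSet.{u}) (n : SimplexCategoryᵒᵖ) :
    ∀ {x y : Vert X}, Word X n x y → Word X n x y → Prop
  | id {x : Vert X} {k : SimplexCategory} (s : X.obj (op k)) (i : CohSimplex.{u} k)
      (hi : vertex s i = x) :
      Rel X n (genWord s (nId i n) hi hi) Quiver.Path.nil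
  | comp {x y z : Vert X} {k : SimplexCategory} (s : X.obj (op k)) {i j l : CohSimplex.{u} k}
      (f : (i ⟶[SSet.{u}] j).obj n) (g : (j ⟶[SSet.{u}] l).obj n)
      (hi : vertex s i = x) (hj : vertex s j = y) (hl : vertex s l = z) :
      Rel X n ((genWord s f hi hj).comp (genWord s g hj hl)) (genWord s (nComp f g) hi hl)
  | glue {x y : Vert X} {k l : SimplexCategory} (α : k ⟶ l) (s : X.obj (op l))
      {i j : CohSimplex.{u} k} (f : (i ⟶[SSet.{u}] j).obj n)
      (hi : vertex (X.map α.op s) i = x) (hj : vertex (X.map α.op s) j = y) :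
      Rel X n (genWord (X.map α.op s) f hi hj)
        (genWord s (nMap (cohMap α) f) ((vertex_map α s i).symm.trans hi)
          ((vertex_map α s j).symm.trans hj))
  | whisker {w x y z : Vert X} (a : Word X n w x) {p q : Word X n x y} (b : Word X n y z) :
      Rel X n p q → Rel X n (a.comp (p.comp b)) (a.comp (q.comp b))

/-- The `n`-arrows of the homotopy coherent realisation of `X`: words in the generating
`n`-arrows, modulo the congruence generated by the relations. -/
def RealHom (X : SSet.{u}) (n : SimplexCategoryᵒᵖ) (x y : Vert X) : Type u :=
  Quot (Rel X n (x := x) (y := y))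

namespace RealHom

variable {X : SSet.{u}} {n m : SimplexCategoryᵒᵖ}

def mk {x y : Vert X} (p : Word X n x y) : RealHom X n x y := Quot.mk _ p

def id (x : Vert X) : RealHom X n x x := mk Quiver.Path.nil

theorem rel_comp_left {x y z : Vert X} (a : Word X n x y) {p q : Word X n y z} (h : Rel X n p q) :
    Rel X n (a.comp p) (a.comp q) := by
  simpa using Rel.whisker a Quiver.Path.nil h

theorem rel_comp_right {x y z : Vert X} {p q : Word X n x y} (b : Word X n y z) (h : Rel X n p q) :
    Rel X n (p.comp b) (q.comp b) := by
  simpa using Rel.whisker Quiver.Path.nil b h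

/-- Composition is concatenation of words. -/
def comp {x y z : Vert X} (f : RealHom X n x y) (g : RealHom X n y z) : RealHom X n x z :=
  Quot.map₂ (fun p q => p.comp q) (fun a _ _ h => rel_comp_left a h)
    (fun _ _ b h => rel_comp_right b h) f g

theorem id_comp {x y : Vert X} (f : RealHom X n x y) : (id x).comp f = f := by
  obtain ⟨p⟩ := f
  exact congrArg mk (Quiver.Path.nil_comp p)

theorem comp_id {x y : Vert X} (f : RealHom X n x y) : f.comp (id y) = f := by
  obtain ⟨p⟩ := f
  rfl

theorem assoc {w x y z : Vert X} (f : RealHom X n w x) (g : RealHom X n x y)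
    (h : RealHom X n y z) : (f.comp g).comp h = f.comp (g.comp h) := by
  obtain ⟨p⟩ := f
  obtain ⟨q⟩ := g
  obtain ⟨r⟩ := h
  exact congrArg mk (Quiver.Path.comp_assoc p q r)

/-- The arrow of the realisation given by an arrow of the homotopy coherent simplex attached to
a simplex of `X`. -/
def gen {x y : Vert X} {k : SimplexCategory}
    (s : X.obj (op k)) {i j : CohSimplex.{u} k} (f : (i ⟶[SSet.{u}] j).obj n)
    (hi : vertex s i = x) (hj : vertex s j = y) : RealHom X n x y :=
  mk (genWord s f hi hj)

theorem gen_id {x : Vert X} {k : SimplexCategory} (s : X.obj (op k)) (i : CohSimplex.{u} k)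
    (hi : vertex s i = x) : gen s (nId i n) hi hi = id x :=
  Quot.sound (Rel.id s i hi)

theorem gen_comp {x y z : Vert X} {k : SimplexCategory} (s : X.obj (op k))
    {i j l : CohSimplex.{u} k} (f : (i ⟶[SSet.{u}] j).obj n) (g : (j ⟶[SSet.{u}] l).obj n)
    (hi : vertex s i = x) (hj : vertex s j = y) (hl : vertex s l = z) :
    (gen s f hi hj).comp (gen s g hj hl) = gen s (nComp f g) hi hl :=
  Quot.sound (Rel.comp s f g hi hj hl)

theorem gen_glue {x y : Vert X} {k l : SimplexCategory} (α : k ⟶ l) (s : X.obj (op l))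
    {i j : CohSimplex.{u} k} (f : (i ⟶[SSet.{u}] j).obj n)
    (hi : vertex (X.map α.op s) i = x) (hj : vertex (X.map α.op s) j = y) :
    gen (X.map α.op s) f hi hj = gen s (nMap (cohMap α) f) ((vertex_map α s i).symm.trans hi)
      ((vertex_map α s j).symm.trans hj) :=
  Quot.sound (Rel.glue α s f hi hj)

/-- Arrows of the realisation are generated under composition by the arrows `gen`. -/
theorem induction {P : ∀ {x y : Vert X}, RealHom X n x y → Prop}
    (id : ∀ x, P (id x))
    (comp : ∀ {x y : Vert X} (f : RealHom X n x y) {k : SimplexCategory} (s : X.obj (op k))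
      {i j : CohSimplex.{u} k} (g : (i ⟶[SSet.{u}] j).obj n) (hi : vertex s i = y), P f →
      P (f.comp (gen s g hi rfl))) {x y : Vert X} (f : RealHom X n x y) : P f := by
  obtain ⟨p⟩ := f
  suffices h : ∀ (y' : GenQuiver X n) (p : Quiver.Path (V := GenQuiver X n) ⟨x⟩ y'),
      P (mk (y := y'.of) p) from h ⟨y⟩ p
  intro y' p
  induction p with
  | nil => exact id x
  | cons q g ih =>
    rename_i y₁ y₂
    obtain ⟨y₂⟩ := y₂
    obtain ⟨k, s, i, j, f, hi, hj⟩ := g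
    dsimp only at hj
    subst hj
    exact comp _ s f hi ih

/-- A function on generators which respects the relations, with values in the arrows of a
category. -/
structure LiftData (X : SSet.{u}) (n : SimplexCategoryᵒᵖ) (D : Type u) [Category.{u} D] where
  obj : Vert X → D
  map {x y : Vert X} {k : SimplexCategory} (s : X.obj (op k)) {i j : CohSimplex.{u} k}
    (f : (i ⟶[SSet.{u}] j).obj n) (hi : vertex s i = x) (hj : vertex s j = y) : obj x ⟶ obj y
  map_id {x : Vert X} {k : SimplexCategory} (s : X.obj (op k)) (i : CohSimplex.{u} k)
    (hi : vertex s i = x) : map s (nId i n) hi hi = 𝟙 _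
  map_comp {x y z : Vert X} {k : SimplexCategory} (s : X.obj (op k)) {i j l : CohSimplex.{u} k}
    (f : (i ⟶[SSet.{u}] j).obj n) (g : (j ⟶[SSet.{u}] l).obj n) (hi : vertex s i = x)
    (hj : vertex s j = y) (hl : vertex s l = z) :
    map s f hi hj ≫ map s g hj hl = map s (nComp f g) hi hl
  map_glue {x y : Vert X} {k l : SimplexCategory} (α : k ⟶ l) (s : X.obj (op l))
    {i j : CohSimplex.{u} k} (f : (i ⟶[SSet.{u}] j).obj n) (hi : vertex (X.map α.op s) i = x)
    (hj : vertex (X.map α.op s) j = y) :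
    map (X.map α.op s) f hi hj = map s (nMap (cohMap α) f)
      ((vertex_map α s i).symm.trans hi) ((vertex_map α s j).symm.trans hj)

namespace LiftData

variable {D : Type u} [Category.{u} D] (L : LiftData X n D)

/-- The value on a word of a function defined on generators. -/
def onWord {x : Vert X} : ∀ {y : GenQuiver X n},
    Quiver.Path (V := GenQuiver X n) ⟨x⟩ y → (L.obj x ⟶ L.obj y.of)
  | _, .nil => 𝟙 _
  | _, .cons p g => onWord p ≫ L.map g.simplex g.arrow g.src g.tgt

theorem onWord_comp {x y z : GenQuiver X n} (p : Quiver.Path x y) (q : Quiver.Path y z) :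
    L.onWord (p.comp q) = L.onWord p ≫ L.onWord q := by
  induction q with
  | nil => exact (Category.comp_id _).symm
  | cons q g ih =>
    exact (congrArg (fun t => t ≫ L.map g.simplex g.arrow g.src g.tgt) ih).trans
      (Category.assoc _ _ _)

theorem onWord_genWord {x y : Vert X} {k : SimplexCategory}
    (s : X.obj (op k)) {i j : CohSimplex.{u} k} (f : (i ⟶[SSet.{u}] j).obj n)
    (hi : vertex s i = x) (hj : vertex s j = y) :
    L.onWord (genWord s f hi hj) = L.map s f hi hj :=
  Category.id_comp _

theorem onWord_rel {x y : Vert X} {p q : Word X n x y} (h : Rel X n p q) :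
    L.onWord p = L.onWord q := by
  induction h with
  | id s i hi => exact (L.onWord_genWord _ _ _ _).trans (L.map_id s i hi)
  | comp s f g hi hj hl =>
    rw [onWord_comp, onWord_genWord, onWord_genWord, onWord_genWord]
    exact L.map_comp s f g hi hj hl
  | glue α s f hi hj =>
    rw [onWord_genWord, onWord_genWord]
    exact L.map_glue α s f hi hj
  | whisker a b _ ih => rw [onWord_comp, onWord_comp, onWord_comp, onWord_comp, ih]

/-- The function induced on the arrows of the realisation. -/
def lift {x y : Vert X} (f : RealHom X n x y) : L.obj x ⟶ L.obj y :=
  Quot.lift (fun p : Word X n x y => L.onWord p) (fun _ _ h => L.onWord_rel h) f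

theorem lift_id (x : Vert X) : L.lift (id x) = 𝟙 (L.obj x) := rfl

theorem lift_comp {x y z : Vert X} (f : RealHom X n x y) (g : RealHom X n y z) :
    L.lift (f.comp g) = L.lift f ≫ L.lift g := by
  obtain ⟨p⟩ := f
  obtain ⟨q⟩ := g
  exact L.onWord_comp p q

theorem lift_gen {x y : Vert X} {k : SimplexCategory}
    (s : X.obj (op k)) {i j : CohSimplex.{u} k} (f : (i ⟶[SSet.{u}] j).obj n)
    (hi : vertex s i = x) (hj : vertex s j = y) :
    L.lift (gen s f hi hj) = L.map s f hi hj :=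
  L.onWord_genWord s f hi hj

end LiftData

/-- The category of `n`-arrows of the realisation. -/
structure Cat (X : SSet.{u}) (n : SimplexCategoryᵒᵖ) where
  of : Vert X

instance (X : SSet.{u}) (n : SimplexCategoryᵒᵖ) : Category.{u} (RealHom.Cat X n) where
  Hom x y := RealHom X n x.of y.of
  id x := id x.of
  comp f g := f.comp g
  id_comp f := f.id_comp
  comp_id f := f.comp_id
  assoc f g h := f.assoc g h

/-- The action of simplicial operators on generators. -/
def operatorData (X : SSet.{u}) {n m : SimplexCategoryᵒᵖ} (θ : n ⟶ m) :
    LiftData X n (RealHom.Cat X m) where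
  obj x := ⟨x⟩
  map s i j f hi hj := gen s ((i ⟶[SSet.{u}] j).map θ f) hi hj
  map_id s i hi := by rw [map_nId]; exact gen_id s i hi
  map_comp s i j l f g hi hj hl := by rw [map_nComp]; exact gen_comp s _ _ hi hj hl
  map_glue α s i j f hi hj := by rw [← nMap_map]; exact gen_glue α s _ hi hj

/-- The action of simplicial operators on the arrows of the realisation. -/
def operator (θ : n ⟶ m) {x y : Vert X} (f : RealHom X n x y) : RealHom X m x y :=
  (operatorData X θ).lift f

theorem operator_id (θ : n ⟶ m) (x : Vert X) : operator θ (id x) = id x := rfl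

theorem operator_comp (θ : n ⟶ m) {x y z : Vert X} (f : RealHom X n x y) (g : RealHom X n y z) :
    operator θ (f.comp g) = (operator θ f).comp (operator θ g) :=
  (operatorData X θ).lift_comp f g

theorem operator_gen (θ : n ⟶ m) {x y : Vert X} {k : SimplexCategory}
    (s : X.obj (op k)) {i j : CohSimplex.{u} k} (f : (i ⟶[SSet.{u}] j).obj n)
    (hi : vertex s i = x) (hj : vertex s j = y) :
    operator θ (gen s f hi hj) = gen s ((i ⟶[SSet.{u}] j).map θ f) hi hj :=
  (operatorData X θ).lift_gen s f hi hj

/-- The simplicial set of arrows of the realisation between two vertices. -/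
def sset (X : SSet.{u}) (x y : Vert X) : SSet.{u} where
  obj n := RealHom X n x y
  map θ := ↾(operator θ)
  map_id n := by
    ext f
    change operator (𝟙 n) f = f
    induction f using RealHom.induction with
    | id x => rfl
    | comp f s g hi ih => rw [operator_comp, ih, operator_gen, Functor.map_id_apply]
  map_comp {n m p} θ θ' := by
    ext f
    change operator (θ ≫ θ') f = operator θ' (operator θ f)
    induction f using RealHom.induction with
    | id x => rfl
    | comp f s g hi ih =>
      simp only [operator_comp, ih, operator_gen, Functor.map_comp_apply]

end RealHom

/-- The homotopy coherent realisation of a simplicial set: the simplicial category whose objects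
are the vertices of `X` and whose `n`-arrows are generated by those of the homotopy coherent
simplices attached to the simplices of `X`. It is the colimit of these homotopy coherent simplices,
and left adjoint to the homotopy coherent nerve (see `realAdjunction`). -/
def realCore (X : SSet.{u}) : SimpCat.Core (Vert X) where
  Hom := RealHom.sset X
  id x _ := RealHom.id x
  comp f g := RealHom.comp f g
  map_id x _ _ θ := RealHom.operator_id θ x
  map_comp θ f g := RealHom.operator_comp θ f g
  id_comp f := RealHom.id_comp f
  comp_id f := RealHom.comp_id f
  assoc f g h := RealHom.assoc f g h

/-- The object part of homotopy coherent realisation. -/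
def realObj (X : SSet.{u}) : SCat.{u} where
  carrier := Vert X
  enriched := (realCore X).enriched

/-- The action of a simplicial map on generators. -/
def realMapData {X Y : SSet.{u}} (φ : X ⟶ Y) (n : SimplexCategoryᵒᵖ) :
    RealHom.LiftData X n (RealHom.Cat Y n) where
  obj x := ⟨φ.app _ x⟩
  map s i j f hi hj := RealHom.gen (φ.app _ s) f
    ((vertex_app φ s i).trans (congrArg _ hi)) ((vertex_app φ s j).trans (congrArg _ hj))
  map_id s i hi := RealHom.gen_id _ i _
  map_comp s i j l f g hi hj hl := RealHom.gen_comp _ f g _ _ _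
  map_glue α s i j f hi hj := by
    rename_i k l
    have h : φ.app (op k) (X.map α.op s) = Y.map α.op (φ.app (op l) s) :=
      NatTrans.naturality_apply φ α.op s
    refine Eq.trans ?_ (RealHom.gen_glue α (φ.app _ s) f ?_ ?_)
    · congr 1
    · rw [← h, vertex_app, hi]
    · rw [← h, vertex_app, hj]

/-- The action of homotopy coherent realisation on simplicial maps. -/
def realMap {X Y : SSet.{u}} (φ : X ⟶ Y) : realObj X ⟶ realObj Y :=
  mkFunctor (A := realObj X) (B := realObj Y) (fun x => φ.app _ x)
    (fun {_ _ n} f => (realMapData φ n).lift f)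
    (fun {a b n m} θ f => by
      change (realMapData φ m).lift (RealHom.operator θ f) =
        RealHom.operator θ ((realMapData φ n).lift f)
      induction f using RealHom.induction with
      | id x => rfl
      | comp f s g hi ih =>
        rw [RealHom.operator_comp, RealHom.LiftData.lift_comp, ih, RealHom.LiftData.lift_comp]
        refine Eq.trans ?_ (RealHom.operator_comp θ _ _).symm
        rw [RealHom.operator_gen, RealHom.LiftData.lift_gen, RealHom.LiftData.lift_gen]
        exact congrArg _ (RealHom.operator_gen θ _ _ _ _).symm)
    (fun _ _ => rfl) (fun f g => (realMapData φ _).lift_comp f g)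

theorem nMap_realMap_gen {X Y : SSet.{u}} (φ : X ⟶ Y) {n : SimplexCategoryᵒᵖ} {x y : Vert X}
    {k : SimplexCategory} (s : X.obj (op k)) {i j : CohSimplex.{u} k}
    (f : (i ⟶[SSet.{u}] j).obj n) (hi : vertex s i = x) (hj : vertex s j = y) :
    nMap (realMap φ) (a := x) (b := y) (RealHom.gen s f hi hj) =
      RealHom.gen (φ.app _ s) f ((vertex_app φ s i).trans (congrArg _ hi))
        ((vertex_app φ s j).trans (congrArg _ hj)) :=
  (realMapData φ n).lift_gen s f hi hj

/-- Simplicial functors out of a realisation are equal if they agree on generators. -/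
theorem real_hext {X : SSet.{u}} {C : SCat.{u}} {F G : realObj X ⟶ C}
    (h : ∀ x : Vert X, F.obj x = G.obj x)
    (h' : ∀ {n : SimplexCategoryᵒᵖ} {k : SimplexCategory} (s : X.obj (op k))
      {i j : CohSimplex.{u} k} (f : (i ⟶[SSet.{u}] j).obj n),
      HEq (nMap F (a := vertex s i) (b := vertex s j) (RealHom.gen s f rfl rfl))
        (nMap G (a := vertex s i) (b := vertex s j) (RealHom.gen s f rfl rfl))) : F = G := by
  obtain ⟨Fo, Fm, hF, hF'⟩ := F
  obtain ⟨Go, Gm, hG, hG'⟩ := G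
  obtain rfl : Fo = Go := funext h
  refine functor_hext (fun _ => rfl) fun a b n f => heq_of_eq ?_
  change RealHom X n a b at f
  induction f using RealHom.induction with
  | id x => 
    exact (nMap_nId (A := realObj X) ⟨Fo, Fm, hF, hF'⟩ x n).trans
      (nMap_nId (A := realObj X) ⟨Fo, Gm, hG, hG'⟩ x n).symm
  | comp f s g hi ih =>
    subst hi
    refine (nMap_nComp (A := realObj X) ⟨Fo, Fm, hF, hF'⟩ f _).trans
      (Eq.trans ?_ (nMap_nComp (A := realObj X) ⟨Fo, Gm, hG, hG'⟩ f _).symm)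
    rw [ih]
    exact congrArg _ (eq_of_heq (h' s g))

/-- Homotopy coherent realisation, as a functor. -/
def realisation : SSet.{u} ⥤ SCat.{u} where
  obj := realObj
  map := realMap
  map_id X := real_hext (fun _ => rfl) fun s i j f => heq_of_eq (nMap_realMap_gen _ s f _ _)
  map_comp φ ψ := real_hext (fun _ => rfl) fun s i j f => heq_of_eq <| by
    refine (nMap_realMap_gen _ s f _ _).trans ?_
    refine Eq.trans ?_ (congrArg (nMap (realMap ψ)) (nMap_realMap_gen φ s f rfl rfl)).symm
    exact (nMap_realMap_gen ψ _ f _ _).symm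

end SimpCat

/-! ### Realisation is left adjoint to the homotopy coherent nerve -/

namespace SimpCat

theorem cohMap_id (k : SimplexCategory) :
    cohMap.{u} (𝟙 k) = EnrichedFunctor.id SSet.{u} (CohSimplex.{u} k) :=
  SimplicialThickening.functor_id _

theorem cohMap_comp {k l m : SimplexCategory} (α : k ⟶ l) (β : l ⟶ m) :
    cohMap.{u} (α ≫ β) = (cohMap α).comp SSet.{u} (cohMap β) :=
  SimplicialThickening.functor_comp (OrderHom.uliftMap α.toOrderHom)
    (OrderHom.uliftMap β.toOrderHom)

/-- The homotopy coherent nerve: a `k`-simplex is a simplicial functor out of the homotopy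
coherent `k`-simplex. -/
def nerveObj (C : SCat.{u}) : SSet.{u} where
  obj k := EnrichedFunctor SSet.{u} (CohSimplex.{u} k.unop) C
  map α := ↾fun F => (cohMap α.unop).comp SSet.{u} F
  map_id k := by
    ext F
    change (cohMap (𝟙 k.unop)).comp SSet.{u} F = F
    rw [cohMap_id]
    rfl
  map_comp α β := by
    ext F
    change (cohMap (β.unop ≫ α.unop)).comp SSet.{u} F = _
    rw [cohMap_comp]
    rfl

/-- The homotopy coherent nerve, as a functor. -/
def cohNerve : SCat.{u} ⥤ SSet.{u} where
  obj := nerveObj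
  map G := { app := fun _ => ↾fun F => F.comp SSet.{u} G }

theorem gen_heq {X : SSet.{u}} {n : SimplexCategoryᵒᵖ} {x x' y y' : Vert X} (hx : x = x')
    (hy : y = y') {k : SimplexCategory} (s : X.obj (op k)) {i j : CohSimplex.{u} k}
    (f : (i ⟶[SSet.{u}] j).obj n) (hi : vertex s i = x) (hj : vertex s j = y) :
    HEq (RealHom.gen s f hi hj) (RealHom.gen s f (hi.trans hx) (hj.trans hy)) := by
  subst hx hy
  rfl

/-- The simplicial functor from the homotopy coherent simplex attached to a simplex of `X`. -/
def simplexFunctor {X : SSet.{u}} {k : SimplexCategory} (s : X.obj (op k)) :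
    EnrichedFunctor SSet.{u} (CohSimplex.{u} k) (realObj X) :=
  mkFunctor (B := realObj X) (fun i => vertex s i) (fun f => RealHom.gen s f rfl rfl)
    (fun θ f => (RealHom.operator_gen θ s f rfl rfl).symm)
    (fun i _ => RealHom.gen_id s i rfl)
    (fun f g => (RealHom.gen_comp s f g rfl rfl rfl).symm)

/-- The unit of the adjunction between realisation and nerve. -/
def realUnit (X : SSet.{u}) : X ⟶ cohNerve.obj (realObj X) where
  app k := ↾fun s => simplexFunctor s
  naturality k l α := by
    ext s
    refine functor_hext (fun i => vertex_map α.unop s i) fun i j n f => ?_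
    change HEq (RealHom.gen (X.map α s) f rfl rfl)
      (RealHom.gen s (nMap (cohMap α.unop) f) rfl rfl)
    refine (gen_heq (vertex_map α.unop s i) (vertex_map α.unop s j) _ f rfl rfl).trans ?_
    exact heq_of_eq (RealHom.gen_glue α.unop s f _ _)

section Transpose

/-- The functor between categories of arrows induced by a simplicial operator. -/
def levelOperator (A : SCat.{u}) {n m : SimplexCategoryᵒᵖ} (θ : n ⟶ m) : Level A n ⥤ Level A m where
  obj a := ⟨a.of⟩
  map {a b} f := (a.of ⟶[SSet.{u}] b.of).map θ f
  map_id a := map_nId a.of θ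
  map_comp f g := map_nComp θ f g

/-- A simplicial functor induces functors between categories of `n`-arrows. -/
def levelMap {A B : Type u} [EnrichedCategory SSet.{u} A] [EnrichedCategory SSet.{u} B]
    (F : EnrichedFunctor SSet.{u} A B) (n : SimplexCategoryᵒᵖ) : Level A n ⥤ Level B n where
  obj a := ⟨F.obj a.of⟩
  map f := nMap F f
  map_id a := nMap_nId F a.of n
  map_comp f g := nMap_nComp F f g

variable {X : SSet.{u}} {C : SCat.{u}} (F : X ⟶ cohNerve.obj C)

/-- The simplicial functor classified by the image of a simplex. -/
def simp {k : SimplexCategory} (s : X.obj (op k)) : EnrichedFunctor SSet.{u} (CohSimplex.{u} k) C :=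
  F.app (op k) s

theorem simp_map {k l : SimplexCategory} (α : k ⟶ l) (s : X.obj (op l)) :
    simp F (X.map α.op s) = (cohMap α).comp SSet.{u} (simp F s) :=
  NatTrans.naturality_apply F α.op s

/-- The object classified by the image of a vertex. -/
def objOf (x : Vert X) : C := (simp F x).obj (cohObj 0)

theorem simp_obj {k : SimplexCategory} (s : X.obj (op k)) (i : CohSimplex.{u} k) :
    (simp F s).obj i = objOf F (vertex s i) := by
  unfold objOf vertex
  rw [simp_map]
  rfl

theorem simp_obj' {x : Vert X} {k : SimplexCategory} (s : X.obj (op k)) (i : CohSimplex.{u} k)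
    (hi : vertex s i = x) : (simp F s).obj i = objOf F x := by
  rw [simp_obj, hi]

theorem eqToHom_congr {D : Type u} [Category.{u} D] {a b a' b' : D} {f : a ⟶ b} {g : a' ⟶ b'}
    (ha : a = a') (hb : b = b') (h : HEq f g) {c d : D} (hc : c = a) (hd : b = d) :
    eqToHom hc ≫ f ≫ eqToHom hd =
      eqToHom (hc.trans ha) ≫ g ≫ eqToHom (hb.symm.trans hd) := by
  subst ha hb h
  rfl

theorem eqToHom_heq {D : Type u} [Category.{u} D] {a b c d : D} (f : a ⟶ b)
    (hc : c = a) (hd : b = d) : HEq (eqToHom hc ≫ f ≫ eqToHom hd) f := by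
  subst hc hd
  simp

theorem nMap_heq {A B : Type u} [EnrichedCategory SSet.{u} A] [EnrichedCategory SSet.{u} B]
    {F G : EnrichedFunctor SSet.{u} A B} (h : F = G) {a b : A} {n : SimplexCategoryᵒᵖ}
    (f : (a ⟶[SSet.{u}] b).obj n) : HEq (nMap F f) (nMap G f) := by
  subst h
  rfl

theorem conj_id {D E : Type u} [Category.{u} D] [Category.{u} E] (G : D ⥤ E) (a : D) {c : E}
    (h : c = G.obj a) (h' : G.obj a = c) : eqToHom h ≫ G.map (𝟙 a) ≫ eqToHom h' = 𝟙 c := by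
  subst h
  simp

theorem conj_comp {D E : Type u} [Category.{u} D] [Category.{u} E] (G : D ⥤ E) {a b c : D}
    (f : a ⟶ b) (g : b ⟶ c) {a' b' c' : E} (ha : a' = G.obj a) (hb : G.obj b = b')
    (hb' : b' = G.obj b) (hc : G.obj c = c') :
    (eqToHom ha ≫ G.map f ≫ eqToHom hb) ≫ (eqToHom hb' ≫ G.map g ≫ eqToHom hc) =
      eqToHom ha ≫ G.map (f ≫ g) ≫ eqToHom hc := by
  subst ha hb hc
  simp

theorem map_conj {D E : Type u} [Category.{u} D] [Category.{u} E] (G : D ⥤ E) {a b a' b' : D}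
    (f : a ⟶ b) (ha : a' = a) (hb : b = b') :
    G.map (eqToHom ha ≫ f ≫ eqToHom hb) =
      eqToHom (congrArg G.obj ha) ≫ G.map f ≫ eqToHom (congrArg G.obj hb) := by
  subst ha hb
  simp

/-- The transpose of a map into the nerve, on generators. -/
def transposeData (n : SimplexCategoryᵒᵖ) : RealHom.LiftData X n (Level C n) where
  obj x := ⟨objOf F x⟩
  map s i j f hi hj := eqToHom (congrArg Level.mk (simp_obj' F s i hi).symm) ≫
    (levelMap (simp F s) n).map (X := ⟨i⟩) (Y := ⟨j⟩) f ≫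
    eqToHom (congrArg Level.mk (simp_obj' F s j hj))
  map_id s i hi := conj_id (levelMap (simp F s) n) ⟨i⟩ _ _
  map_comp s i j l f g hi hj hl :=
    conj_comp (levelMap (simp F s) n) (a := ⟨i⟩) (b := ⟨j⟩) (c := ⟨l⟩) f g _ _ _ _
  map_glue α s i j f hi hj := by
    refine (eqToHom_congr (D := Level C n) ?_ ?_ (nMap_heq (simp_map F α s) f) _ _)
    · exact congrArg (fun G : EnrichedFunctor SSet.{u} _ C => (⟨G.obj i⟩ : Level C n))
        (simp_map F α s)
    · exact congrArg (fun G : EnrichedFunctor SSet.{u} _ C => (⟨G.obj j⟩ : Level C n))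
        (simp_map F α s)

/-- The transpose of a map into the nerve. -/
def transpose : realObj X ⟶ C :=
  mkFunctor (A := realObj X) (B := C) (objOf F) (fun {_ _ n} f => (transposeData F n).lift f)
    (fun {a b n m} θ f => by
      change (transposeData F m).lift (RealHom.operator θ f) =
        (levelOperator C θ).map ((transposeData F n).lift f)
      induction f using RealHom.induction with
      | id x => exact ((levelOperator C θ).map_id _).symm
      | comp f s g hi ih =>
        rw [RealHom.operator_comp, RealHom.LiftData.lift_comp, ih, RealHom.LiftData.lift_comp,
          Functor.map_comp, RealHom.operator_gen, RealHom.LiftData.lift_gen,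
          RealHom.LiftData.lift_gen]
        refine congrArg _ (Eq.symm ?_)
        refine (map_conj (levelOperator C θ) _ _ _).trans ?_
        exact eqToHom_congr (D := Level C m) rfl rfl
          (heq_of_eq (nMap_map (simp F s) θ g).symm) _ _)
    (fun _ _ => rfl) (fun f g => (transposeData F _).lift_comp f g)

theorem nMap_transpose_gen {n : SimplexCategoryᵒᵖ} {k : SimplexCategory} (s : X.obj (op k))
    {i j : CohSimplex.{u} k} (f : (i ⟶[SSet.{u}] j).obj n) :
    HEq (nMap (transpose F) (a := vertex s i) (b := vertex s j) (RealHom.gen s f rfl rfl))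
      (nMap (simp F s) f) := by
  refine (heq_of_eq ((transposeData F n).lift_gen s f rfl rfl)).trans ?_
  exact eqToHom_heq _ _ _

end Transpose

/-- Simplicial functors out of the realisation of `X` are the same as simplicial maps from `X` to
the nerve. -/
def realHomEquiv (X : SSet.{u}) (C : SCat.{u}) : (realObj X ⟶ C) ≃ (X ⟶ cohNerve.obj C) where
  toFun G := realUnit X ≫ cohNerve.map G
  invFun F := transpose F
  left_inv G := by
    refine real_hext (fun x => ?_) fun s i j f => ?_
    · change G.obj (vertex x (cohObj 0)) = G.obj x
      refine congrArg G.obj ?_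
      have : SimplexCategory.const (SimplexCategory.mk 0) (SimplexCategory.mk 0) 0 = 𝟙 _ := by
        ext; simp
      exact (congrArg (fun α => X.map (Quiver.Hom.op α) x) this).trans (X.map_id_apply _ x)
    · exact nMap_transpose_gen _ s f
  right_inv F := by
    ext k s
    exact functor_hext (fun i => (simp_obj F s i).symm) fun i j n f => nMap_transpose_gen F s f

theorem realUnit_naturality {X Y : SSet.{u}} (φ : X ⟶ Y) :
    φ ≫ realUnit Y = realUnit X ≫ cohNerve.map (realMap φ) := by
  ext k s
  refine functor_hext (fun i => vertex_app φ s i) fun i j n f => ?_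
  refine HEq.trans ?_ (heq_of_eq (nMap_realMap_gen φ s f rfl rfl).symm)
  exact gen_heq (vertex_app φ s i) (vertex_app φ s j) _ f rfl rfl

/-- Homotopy coherent realisation is left adjoint to the homotopy coherent nerve. -/
def realAdjunction : realisation.{u} ⊣ cohNerve.{u} :=
  Adjunction.mkOfHomEquiv
    { homEquiv := realHomEquiv
      homEquiv_naturality_left_symm := fun {X' X C} φ G => by
        refine (Equiv.symm_apply_eq (realHomEquiv X' C)).2 ?_
        have h : realUnit X ≫ cohNerve.map ((realHomEquiv X C).symm G) = G :=
          (realHomEquiv X C).apply_symm_apply G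
        have h' := congrArg (fun t => t ≫ cohNerve.map ((realHomEquiv X C).symm G))
          (realUnit_naturality φ)
        exact (congrArg (fun t => φ ≫ t) h).symm.trans h'
      homEquiv_naturality_right := fun _ _ => rfl }

end SimpCat

/-! ### Joins of simplicial sets -/

namespace SimpCat

/-- The simplicial operator `α : m ⟶ n` lands in the fibre over `e` of `p : n ⟶ [1]`. -/
def InFibre {n : SimplexCategory} (p : n ⟶ SimplexCategory.mk 1) (e : Fin 2) {m : SimplexCategory}
    (α : m ⟶ n) : Prop :=
  ∀ i, (α ≫ p).toOrderHom i = e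

/-- An `n`-simplex of the join `X ⋆ Y`: a map `p` from the `n`-simplex to the `1`-simplex, together
with a simplicial map to `X` from the (possibly empty) fibre of `p` over `0` and a simplicial map
to `Y` from the (possibly empty) fibre of `p` over `1`. -/
structure JoinSimplex (X Y : SSet.{u}) (n : SimplexCategory) where
  cut : n ⟶ SimplexCategory.mk 1
  left {m : SimplexCategory} (α : m ⟶ n) (h : InFibre cut 0 α) : X.obj (op m)
  right {m : SimplexCategory} (α : m ⟶ n) (h : InFibre cut 1 α) : Y.obj (op m)
  left_map {m l : SimplexCategory} (β : l ⟶ m) (α : m ⟶ n) (h : InFibre cut 0 α) :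
    X.map β.op (left α h) = left (β ≫ α) (fun i => h (β.toOrderHom i))
  right_map {m l : SimplexCategory} (β : l ⟶ m) (α : m ⟶ n) (h : InFibre cut 1 α) :
    Y.map β.op (right α h) = right (β ≫ α) (fun i => h (β.toOrderHom i))

/-- The action of simplicial operators on the simplices of the join, by restriction. -/
def JoinSimplex.restrict {X Y : SSet.{u}} {n m : SimplexCategory} (s : JoinSimplex X Y n)
    (θ : m ⟶ n) : JoinSimplex X Y m where
  cut := θ ≫ s.cut
  left α h := s.left (α ≫ θ) h
  right α h := s.right (α ≫ θ) h
  left_map β α h := s.left_map β (α ≫ θ) h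
  right_map β α h := s.right_map β (α ≫ θ) h

theorem JoinSimplex.ext {X Y : SSet.{u}} {n : SimplexCategory} {s t : JoinSimplex X Y n}
    (hc : s.cut = t.cut)
    (hl : ∀ {m : SimplexCategory} (α : m ⟶ n) (h : InFibre s.cut 0 α) (h' : InFibre t.cut 0 α),
      s.left α h = t.left α h')
    (hr : ∀ {m : SimplexCategory} (α : m ⟶ n) (h : InFibre s.cut 1 α) (h' : InFibre t.cut 1 α),
      s.right α h = t.right α h') : s = t := by
  obtain ⟨c, l, r, _, _⟩ := s
  obtain ⟨c', l', r', _, _⟩ := t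
  obtain rfl : c = c' := hc
  obtain rfl : @l = @l' := by
    funext m α h
    exact hl α h h
  obtain rfl : @r = @r' := by
    funext m α h
    exact hr α h h
  rfl

theorem JoinSimplex.restrict_id {X Y : SSet.{u}} {n : SimplexCategory} (s : JoinSimplex X Y n) :
    s.restrict (𝟙 n) = s := by
  refine JoinSimplex.ext (Category.id_comp _) (fun α h h' => ?_) (fun α h h' => ?_)
  · change s.left (α ≫ 𝟙 n) h = s.left α h'
    congr 1
    exact Category.comp_id α
  · change s.right (α ≫ 𝟙 n) h = s.right α h'
    congr 1
    exact Category.comp_id α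

theorem JoinSimplex.restrict_comp {X Y : SSet.{u}} {n m l : SimplexCategory}
    (s : JoinSimplex X Y n) (θ : m ⟶ n) (θ' : l ⟶ m) :
    s.restrict (θ' ≫ θ) = (s.restrict θ).restrict θ' := by
  refine JoinSimplex.ext (Category.assoc _ _ _) (fun α h h' => ?_) (fun α h h' => ?_)
  · change s.left (α ≫ θ' ≫ θ) h = s.left ((α ≫ θ') ≫ θ) h'
    congr 1
  · change s.right (α ≫ θ' ≫ θ) h = s.right ((α ≫ θ') ≫ θ) h'
    congr 1

/-- The join of two simplicial sets. -/
def join (X Y : SSet.{u}) : SSet.{u} where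
  obj n := JoinSimplex X Y n.unop
  map θ := ↾fun s => s.restrict θ.unop
  map_id n := by ext s; exact s.restrict_id
  map_comp θ θ' := by ext s; exact s.restrict_comp θ.unop θ'.unop

/-- The map from the `n`-simplex to the `1`-simplex underlying a simplex of the join. -/
def cut {X Y : SSet.{u}} {n : SimplexCategory} (s : (join X Y).obj (op n)) :
    n ⟶ SimplexCategory.mk 1 :=
  JoinSimplex.cut (X := X) (Y := Y) s

/-- The functoriality of the join. -/
def joinMap {X X' Y Y' : SSet.{u}} (f : X ⟶ X') (g : Y ⟶ Y') : join X Y ⟶ join X' Y' where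
  app n := ↾fun (s : JoinSimplex X Y n.unop) => show JoinSimplex X' Y' n.unop from
    { cut := s.cut
      left := fun α h => f.app _ (s.left α h)
      right := fun α h => g.app _ (s.right α h)
      left_map := fun β α h =>
        (NatTrans.naturality_apply f β.op _).symm.trans (congrArg _ (s.left_map β α h))
      right_map := fun β α h =>
        (NatTrans.naturality_apply g β.op _).symm.trans (congrArg _ (s.right_map β α h)) }

/-- The terminal simplicial set `Δ⁰`. -/
abbrev pt : SSet.{u} := SSet.stdSimplex.{u}.obj (SimplexCategory.mk 0)

/-- The unique map to `Δ⁰`. -/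
def toPt (X : SSet.{u}) : X ⟶ pt.{u} := SSet.stdSimplex.isTerminalObj₀.{u}.from X

/-! ### The projection to the arrow category -/

/-- An ordinary category as a simplicial category with discrete simplicial sets of arrows. -/
def discreteCore (C : Type u) [Category.{u} C] : SimpCat.Core C where
  Hom a b := (SimplicialObject.const (Type u)).obj (a ⟶ b)
  id a _ := 𝟙 a
  comp f g := f ≫ g
  map_id _ _ _ _ := rfl
  map_comp _ _ _ := rfl
  id_comp f := Category.id_comp f
  comp_id f := Category.comp_id f
  assoc f g h := Category.assoc f g h

/-- The arrow category `𝟚 = {0 ⟶ 1}`, as a simplicial category. -/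
def arrowCat : SCat.{u} where
  carrier := ULift.{u} (Fin 2)
  enriched := (discreteCore (ULift.{u} (Fin 2))).enriched

instance (a b : arrowCat.{u}) (n : SimplexCategoryᵒᵖ) :
    Subsingleton ((a ⟶[SSet.{u}] b).obj n) :=
  inferInstanceAs (Subsingleton ((show ULift.{u} (Fin 2) from a) ⟶ (show ULift.{u} (Fin 2) from b)))

theorem arrowCat_heq {a b a' b' : arrowCat.{u}} (ha : a = a') (hb : b = b')
    {n : SimplexCategoryᵒᵖ} (f : (a ⟶[SSet.{u}] b).obj n) (g : (a' ⟶[SSet.{u}] b').obj n) :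
    HEq f g := by
  subst ha hb
  exact heq_of_eq (Subsingleton.elim f g)

/-- The object of the arrow category under a vertex of the join. -/
def side {X Y : SSet.{u}} (x : Vert (join X Y)) : arrowCat.{u} :=
  ⟨(cut x).toOrderHom 0⟩

theorem side_vertex {X Y : SSet.{u}} {k : SimplexCategory} (s : (join X Y).obj (op k))
    (i : CohSimplex.{u} k) :
    side (vertex s i) = ⟨(cut s).toOrderHom i.as.down⟩ := rfl

theorem side_le {X Y : SSet.{u}} {n : SimplexCategoryᵒᵖ} {x y : Vert (join X Y)}
    {k : SimplexCategory} (s : (join X Y).obj (op k)) {i j : CohSimplex.{u} k}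
    (f : (i ⟶[SSet.{u}] j).obj n) (hi : vertex s i = x) (hj : vertex s j = y) :
    (show ULift.{u} (Fin 2) from side x) ≤ side y := by
  subst hi hj
  have h : i.as ≤ j.as := SimplicialThickening.Path.le
    (Functor.obj (show ComposableArrows (i ⟶ j) n.unop.len from f) 0)
  exact (cut s).toOrderHom.monotone h

/-- The projection of the realisation of a join, on generators. -/
def projData (X Y : SSet.{u}) (n : SimplexCategoryᵒᵖ) :
    RealHom.LiftData (join X Y) n (Level arrowCat.{u} n) where
  obj x := ⟨side x⟩
  map s _ _ f hi hj := homOfLE (side_le s f hi hj)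
  map_id _ _ _ := rfl
  map_comp _ _ _ _ _ _ _ _ _ := rfl
  map_glue _ _ _ _ _ _ _ := rfl

/-- The canonical simplicial functor from the realisation of `X ⋆ Y` to the arrow category, sending
the vertices of `X` to `0` and the vertices of `Y` to `1`. -/
def proj (X Y : SSet.{u}) : realObj (join X Y) ⟶ arrowCat.{u} :=
  mkFunctor (A := realObj (join X Y)) (B := arrowCat.{u}) side
    (fun {_ _ n} f => (projData X Y n).lift f)
    (fun _ _ => Subsingleton.elim _ _) (fun _ _ => Subsingleton.elim _ _)
    (fun _ _ => Subsingleton.elim _ _)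

theorem realMap_joinMap_proj {X X' Y Y' : SSet.{u}} (f : X ⟶ X') (g : Y ⟶ Y') :
    realMap (joinMap f g) ≫ proj X' Y' = proj X Y :=
  functor_hext (B := arrowCat.{u}) (fun _ => rfl) fun _ _ _ _ => arrowCat_heq rfl rfl _ _

end SimpCat

/-! ### Fibre products of simplicial categories -/

namespace SimpCat

section Heq

variable {A : Type u} [EnrichedCategory SSet.{u} A] {a b c a' b' c' : A} {n m : SimplexCategoryᵒᵖ}

theorem nId_heq (h : a = a') : HEq (nId a n) (nId a' n) := by
  subst h
  rfl

theorem nComp_heq {f : (a ⟶[SSet.{u}] b).obj n} {g : (b ⟶[SSet.{u}] c).obj n}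
    {f' : (a' ⟶[SSet.{u}] b').obj n} {g' : (b' ⟶[SSet.{u}] c').obj n} (ha : a = a') (hb : b = b')
    (hc : c = c') (hf : HEq f f') (hg : HEq g g') : HEq (nComp f g) (nComp f' g') := by
  subst ha hb hc hf hg
  rfl

theorem map_heq (θ : n ⟶ m) {f : (a ⟶[SSet.{u}] b).obj n} {f' : (a' ⟶[SSet.{u}] b').obj n}
    (ha : a = a') (hb : b = b') (hf : HEq f f') :
    HEq ((a ⟶[SSet.{u}] b).map θ f) ((a' ⟶[SSet.{u}] b').map θ f') := by
  subst ha hb hf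
  rfl

end Heq

variable {A B C : SCat.{u}} (F : A ⟶ C) (G : B ⟶ C)

/-- Objects of the fibre product: pairs of objects with the same image. -/
abbrev FibObj : Type u := { p : A × B // F.obj p.1 = G.obj p.2 }

/-- Arrows of the fibre product: pairs of `n`-arrows with the same image. -/
def fibHom (p q : FibObj F G) : SSet.{u} where
  obj n := { f : (p.1.1 ⟶[SSet.{u}] q.1.1).obj n × (p.1.2 ⟶[SSet.{u}] q.1.2).obj n //
    HEq (nMap F f.1) (nMap G f.2) }
  map θ := ↾fun f => ⟨((p.1.1 ⟶[SSet.{u}] q.1.1).map θ f.1.1, (p.1.2 ⟶[SSet.{u}] q.1.2).map θ f.1.2),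
    by
      dsimp only
      rw [nMap_map, nMap_map]
      exact map_heq θ p.2 q.2 f.2⟩
  map_id n := by
    ext f
    · exact Functor.map_id_apply (p.1.1 ⟶[SSet.{u}] q.1.1) n f.1.1
    · exact Functor.map_id_apply (p.1.2 ⟶[SSet.{u}] q.1.2) n f.1.2
  map_comp θ θ' := by
    ext f
    · exact Functor.map_comp_apply (p.1.1 ⟶[SSet.{u}] q.1.1) θ θ' f.1.1
    · exact Functor.map_comp_apply (p.1.2 ⟶[SSet.{u}] q.1.2) θ θ' f.1.2

/-- The fibre product of simplicial categories, with componentwise composition. -/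
def fibCore : SimpCat.Core (FibObj F G) where
  Hom := fibHom F G
  id p n := ⟨(nId p.1.1 n, nId p.1.2 n), by
    dsimp only
    rw [nMap_nId, nMap_nId]
    exact nId_heq p.2⟩
  comp {p q r n} f g := ⟨(nComp f.1.1 g.1.1, nComp f.1.2 g.1.2), by
    dsimp only
    rw [nMap_nComp, nMap_nComp]
    exact nComp_heq p.2 q.2 r.2 f.2 g.2⟩
  map_id p _ _ θ := Subtype.ext (Prod.ext (map_nId _ θ) (map_nId _ θ))
  map_comp θ f g := Subtype.ext (Prod.ext (map_nComp θ _ _) (map_nComp θ _ _))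
  id_comp f := Subtype.ext (Prod.ext (nId_nComp _) (nId_nComp _))
  comp_id f := Subtype.ext (Prod.ext (nComp_nId _) (nComp_nId _))
  assoc f g h := Subtype.ext (Prod.ext (nComp_assoc _ _ _) (nComp_assoc _ _ _))

/-- The fibre product of simplicial categories. -/
def fibProd : SCat.{u} where
  carrier := FibObj F G
  enriched := (fibCore F G).enriched

/-- The first projection. -/
def fibFst : fibProd F G ⟶ A :=
  mkFunctor (A := fibProd F G) (B := A) (fun p => p.1.1) (fun f => f.1.1) (fun _ _ => rfl)
    (fun _ _ => rfl) (fun _ _ => rfl)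

/-- The second projection. -/
def fibSnd : fibProd F G ⟶ B :=
  mkFunctor (A := fibProd F G) (B := B) (fun p => p.1.2) (fun f => f.1.2) (fun _ _ => rfl)
    (fun _ _ => rfl) (fun _ _ => rfl)

theorem fib_condition : fibFst F G ≫ F = fibSnd F G ≫ G :=
  functor_hext (fun p => p.2) fun _ _ _ f => f.2

variable {F G}

/-- The functor into the fibre product with given components. -/
def fibLift {D : SCat.{u}} (H : D ⟶ A) (K : D ⟶ B) (h : H ≫ F = K ≫ G) : D ⟶ fibProd F G :=
  mkFunctor (A := D) (B := fibProd F G)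
    (fun d => ⟨(H.obj d, K.obj d), congrArg (fun T : EnrichedFunctor SSet.{u} D C => T.obj d) h⟩)
    (fun f => ⟨(nMap H f, nMap K f), nMap_heq (A := D) (B := C) h f⟩)
    (fun θ f => Subtype.ext (Prod.ext (nMap_map H θ f) (nMap_map K θ f)))
    (fun a n => Subtype.ext (Prod.ext (nMap_nId H a n) (nMap_nId K a n)))
    (fun f g => Subtype.ext (Prod.ext (nMap_nComp H f g) (nMap_nComp K f g)))

theorem fibLift_fst {D : SCat.{u}} (H : D ⟶ A) (K : D ⟶ B) (h : H ≫ F = K ≫ G) :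
    fibLift H K h ≫ fibFst F G = H := rfl

theorem fibLift_snd {D : SCat.{u}} (H : D ⟶ A) (K : D ⟶ B) (h : H ≫ F = K ≫ G) :
    fibLift H K h ≫ fibSnd F G = K := rfl

theorem fibLift_unique {D : SCat.{u}} (H : D ⟶ A) (K : D ⟶ B) (h : H ≫ F = K ≫ G)
    (T : D ⟶ fibProd F G) (h₁ : T ≫ fibFst F G = H) (h₂ : T ≫ fibSnd F G = K) :
    T = fibLift H K h := by
  subst h₁ h₂
  rfl

/-- The fibre product is the pullback in the category of simplicial categories. -/
theorem fibProd_isPullback : IsPullback (fibFst F G) (fibSnd F G) F G where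
  w := fib_condition F G
  isLimit' := ⟨Limits.PullbackCone.IsLimit.mk (fib_condition F G)
    (fun s => fibLift s.fst s.snd s.condition) (fun _ => rfl) (fun _ => rfl)
    (fun s T h₁ h₂ => fibLift_unique s.fst s.snd s.condition T h₁ h₂)⟩

end SimpCat

/-! ### The comparison map -/

namespace SimpCat

/-- The comparison map from the realisation of `X ⋆ Y` to the fibre product over the arrow category
of the realisations of `X ⋆ Δ⁰` and `Δ⁰ ⋆ Y`, with components induced by `X ⋆ !` and `! ⋆ Y`. -/
def comparison (X Y : SSet.{u}) :
    realisation.obj (join X Y) ⟶ fibProd (proj X pt) (proj pt Y) :=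
  fibLift (realisation.map (joinMap (𝟙 X) (toPt Y))) (realisation.map (joinMap (toPt X) (𝟙 Y)))
    ((realMap_joinMap_proj _ _).trans (realMap_joinMap_proj _ _).symm)

end SimpCat

/-! ### Categories freely generated by a class of arrows -/

namespace SimpCat

section FreelyGenerated

universe v w v' w'

variable {C : Type w} [Category.{v} C]

/-! An `n`-arrow of a homotopy coherent simplex is an increasing chain of sets of vertices, and
composition is union. Such a chain splits exactly at the interior points of its bottom set, so it is
atomic when the bottom set consists of two distinct endpoints. Simplicial operators act by direct
image, hence send atomic arrows to atomic arrows or to identities. The colimit defining the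
realisation can therefore be formed on atomic arrows alone: call a bead a gluing class of arrows
whose bottom set is the set of endpoints; then every `n`-arrow of a realisation is uniquely a path
of nontrivial beads (`beadArrows_isFreeOn`).

Over the arrow category, `X ⋆ Δ⁰` has a single vertex above `1`, which no non-identity arrow leaves,
and `Δ⁰ ⋆ Y` has a single vertex above `0`, which no non-identity arrow enters. In an arrow `(f, g)`
of the fibre product, `g` is an identity if both ends lie above `0`, and `f` is an identity if both
lie above `1`. If the arrow crosses from `0` to `1`, the last bead of `f` and the first bead of `g`
cross, and they pair up to form the middle factor. So the fibre product is free on the non-identity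
pairs of beads (`fibBeadArrows_isFreeOn`).

It remains to match generators. A simplex of `X ⋆ Δ⁰` does not change when its right-hand vertices
are moved among themselves, so a bead there remembers only its left half, and dually for `Δ⁰ ⋆ Y`.
The left half of one bead and the right half of the other assemble into a bead of `X ⋆ Y`
(`Bead.combine`), which inverts the two collapses. A functor between free categories that is
bijective on objects and generators is bijective on arrows (`IsFreeOn.map_bijective`), and atomic
arrows correspond.

Freeness is phrased through last factors: an arrow ending in a generator is not an identity, its
last generator is unique, and removing last generators terminates. -/

theorem isIdentity_id (a : C) : IsIdentity (𝟙 a) := ⟨rfl, rfl⟩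

theorem IsIdentity.comp {a b c : C} {f : a ⟶ b} {g : b ⟶ c} (hf : IsIdentity f)
    (hg : IsIdentity g) : IsIdentity (f ≫ g) := by
  obtain ⟨rfl, rfl⟩ := hf
  obtain ⟨rfl, rfl⟩ := hg
  simpa using isIdentity_id a

/-- The class of arrows `G` freely generates the category `C`. -/
structure IsFreeOn (G : MorphismProperty C) : Prop where
  not_isIdentity {a b c : C} (g : a ⟶ c) (f : c ⟶ b) : G f → ¬ IsIdentity (g ≫ f)
  cancel {a b c c' : C} {g : a ⟶ c} {f : c ⟶ b} {g' : a ⟶ c'} {f' : c' ⟶ b} :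
    G f → G f' → g ≫ f = g' ≫ f' → c = c' ∧ HEq g g' ∧ HEq f f'
  exists_length : ∃ len : ∀ {a b : C}, (a ⟶ b) → ℕ, ∀ {a b : C} (f : a ⟶ b),
    IsIdentity f ∨ ∃ (c : C) (g : a ⟶ c) (h : c ⟶ b), G h ∧ g ≫ h = f ∧ len g < len f

namespace IsFreeOn

variable {G : MorphismProperty C} (hG : IsFreeOn G)
include hG

theorem not_isIdentity_of_mem {a b : C} {f : a ⟶ b} (hf : G f) : ¬ IsIdentity f := by
  simpa using hG.not_isIdentity (𝟙 a) f hf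

theorem isIdentity_or {a b : C} (f : a ⟶ b) :
    IsIdentity f ∨ ∃ (c : C) (g : a ⟶ c) (h : c ⟶ b), G h ∧ g ≫ h = f := by
  obtain ⟨len, hlen⟩ := hG.exists_length
  exact (hlen f).imp id fun ⟨c, g, h, h₁, h₂, _⟩ => ⟨c, g, h, h₁, h₂⟩

theorem induction {P : ∀ {a b : C}, (a ⟶ b) → Prop} (id : ∀ a, P (𝟙 a))
    (comp : ∀ {a b c : C} (g : a ⟶ b) (h : b ⟶ c), G h → P g → P (g ≫ h))
    {a b : C} (f : a ⟶ b) : P f := by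
  obtain ⟨len, hlen⟩ := hG.exists_length
  suffices H : ∀ (n : ℕ) (a b : C) (f : a ⟶ b), len f < n → P f from H _ a b f (Nat.lt_succ_self _)
  intro n
  induction n with
  | zero => exact fun _ _ _ h => absurd h (Nat.not_lt_zero _)
  | succ n ih =>
    intro a b f hf
    rcases hlen f with ⟨rfl, rfl⟩ | ⟨c, g, h, hh, rfl, hl⟩
    · exact id a
    · exact comp g h hh (ih _ _ g (by omega))

/-- If `h` were not an identity it would end in a generator, and then so would the composite. -/
theorem isIdentity_of_comp {a b c : C} (g : a ⟶ c) (h : c ⟶ b) (H : IsIdentity (g ≫ h)) :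
    IsIdentity g ∧ IsIdentity h := by
  have hh : IsIdentity h := by
    rcases hG.isIdentity_or h with hh | ⟨d, p, q, hq, rfl⟩
    · exact hh
    · rw [← Category.assoc] at H
      exact absurd H (hG.not_isIdentity _ _ hq)
  refine ⟨?_, hh⟩
  obtain ⟨rfl, rfl⟩ := hh
  simpa using H

/-- The generators need not be carried along as extra data: freeness forces them to be the atoms,
which links `IsFreeOn` to the definition of a computad. -/
theorem isAtomic_iff {a b : C} (f : a ⟶ b) : IsAtomic f ↔ G f := by
  constructor
  · rintro ⟨h₁, h₂⟩
    rcases hG.isIdentity_or f with hf | ⟨c, g, h, hh, rfl⟩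
    · exact absurd hf h₁
    · obtain ⟨rfl, rfl⟩ := (h₂ g h rfl).resolve_right (hG.not_isIdentity_of_mem hh)
      simpa using hh
  · intro hf
    refine ⟨hG.not_isIdentity_of_mem hf, fun c g h e => ?_⟩
    rcases hG.isIdentity_or h with hh | ⟨d, p, q, hq, rfl⟩
    · exact Or.inr hh
    -- Uniqueness of the last generator, applied to `f` itself viewed as `𝟙 a ≫ f`, makes everything
    -- before `q` an identity.
    · obtain ⟨rfl, h', -⟩ := hG.cancel (g := g ≫ p) (g' := 𝟙 a) hq hf (by simpa using e)
      left
      refine (hG.isIdentity_of_comp g p ?_).1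
      rw [eq_of_heq h']
      exact isIdentity_id _

/-- After this substitution, paths in `Atoms C` are literally paths of generators. -/
theorem eq_isAtomic : G = fun _ _ f => IsAtomic f := by
  funext a b f
  exact propext (hG.isAtomic_iff f).symm

omit hG in
theorem composite_comp {a b c : Atoms C} (p : Quiver.Path a b) (q : Quiver.Path b c) :
    composite (p.comp q) = composite p ≫ composite q := by
  induction q with
  | nil => exact (Category.comp_id _).symm
  | cons q f ih => exact (congrArg (· ≫ f.1) ih).trans (Category.assoc _ _ _)

/-- Existence of a path comes from removing last generators until nothing is left; uniqueness comes
from comparing two paths from the end backwards with `cancel`. -/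
theorem isComputad : IsComputad C := by
  obtain rfl := hG.eq_isAtomic
  intro a b f
  refine existsUnique_of_exists_of_unique ?_ ?_
  · suffices H : ∀ {a b : C} (f : a ⟶ b), ∃ p : Quiver.Path (Atoms.mk a) (Atoms.mk b),
        composite p = f from H f
    intro a b f
    induction f using hG.induction with
    | id a => exact ⟨.nil, rfl⟩
    | comp g h hh ih =>
      obtain ⟨p, rfl⟩ := ih
      exact ⟨p.cons (V := Atoms C) ⟨h, hh⟩, rfl⟩
  · intro p q hp hq
    rw [← hq] at hp
    clear hq f
    induction p with
    | nil =>
      cases q with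
      | nil => rfl
      | cons q f => exact absurd ⟨rfl, hp.symm⟩ (hG.not_isIdentity _ f.1 f.2)
    | @cons c b p f ih =>
      cases q with
      | nil => exact absurd ⟨rfl, hp⟩ (hG.not_isIdentity _ f.1 f.2)
      | @cons c' _ q f' =>
        obtain ⟨c⟩ := c
        obtain ⟨c'⟩ := c'
        obtain ⟨f, hf⟩ := f
        obtain ⟨f', hf'⟩ := f'
        obtain ⟨rfl, h₁, h₂⟩ := hG.cancel hf hf' hp
        dsimp only at h₁ h₂
        obtain rfl := eq_of_heq h₂
        rw [ih q (eq_of_heq h₁)]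

/-! ### Extending a function on atoms to a functor. -/

section Extend

omit hG

variable {D : Type w'} [Category.{v'} D] (o : C → D)
  (F : ∀ {a b : C} (f : a ⟶ b), IsAtomic f → (o a ⟶ o b))

/-- The composite in `D` of the images of a path of atomic arrows. -/
def onPath {a : Atoms C} : ∀ {b : Atoms C}, Quiver.Path a b → (o a.of ⟶ o b.of)
  | _, .nil => 𝟙 _
  | _, .cons p f => onPath p ≫ F f.1 f.2

theorem onPath_comp {a b c : Atoms C} (p : Quiver.Path a b) (q : Quiver.Path b c) :
    onPath o F (p.comp q) = onPath o F p ≫ onPath o F q := by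
  induction q with
  | nil => exact (Category.comp_id _).symm
  | cons q f ih => exact (congrArg (· ≫ F f.1 f.2) ih).trans (Category.assoc _ _ _)

variable (hC : IsComputad C)

/-- The extension to all arrows of a function defined on the atomic arrows of a computad. -/
noncomputable def extend {a b : C} (f : a ⟶ b) : o a ⟶ o b :=
  onPath o F (hC ⟨a⟩ ⟨b⟩ f).choose

/-- The path chosen in `extend` is the given one, by uniqueness of decompositions. -/
theorem extend_composite {a b : Atoms C} (p : Quiver.Path a b) :
    extend o F hC (composite p) = onPath o F p :=
  congrArg _ ((hC a b (composite p)).choose_spec.2 p rfl).symm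

theorem extend_id (a : C) : extend o F hC (𝟙 a) = 𝟙 (o a) :=
  extend_composite o F hC (a := ⟨a⟩) (b := ⟨a⟩) Quiver.Path.nil

theorem extend_comp {a b c : C} (f : a ⟶ b) (g : b ⟶ c) :
    extend o F hC (f ≫ g) = extend o F hC f ≫ extend o F hC g := by
  obtain ⟨p, rfl, -⟩ := hC ⟨a⟩ ⟨b⟩ f
  obtain ⟨q, rfl, -⟩ := hC ⟨b⟩ ⟨c⟩ g
  rw [← composite_comp, extend_composite, extend_composite, extend_composite, onPath_comp]

theorem extend_atomic {a b : C} (f : a ⟶ b) (hf : IsAtomic f) : extend o F hC f = F f hf := by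
  have h : composite (a := ⟨a⟩) (b := ⟨b⟩) (Quiver.Path.cons (V := Atoms C) .nil ⟨f, hf⟩) = f :=
    Category.id_comp f
  refine (congrArg (extend o F hC) h.symm).trans ((extend_composite o F hC _).trans ?_)
  exact Category.id_comp _

end Extend

/-- A generator of the fibre product may be an identity in one component, so cancellation is needed
for last factors that are generators or identities. It fails if only one of them is an identity,
whence the hypothesis `h`. -/
theorem cancel_of_iff {a b c c' : C} {g : a ⟶ c} {f : c ⟶ b} {g' : a ⟶ c'} {f' : c' ⟶ b}
    (hf : IsIdentity f ∨ G f) (hf' : IsIdentity f' ∨ G f') (h : IsIdentity f ↔ IsIdentity f')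
    (e : g ≫ f = g' ≫ f') : c = c' ∧ HEq g g' ∧ HEq f f' := by
  by_cases hi : IsIdentity f
  · obtain ⟨rfl, rfl⟩ := h.1 hi
    obtain ⟨rfl, rfl⟩ := hi
    refine ⟨rfl, ?_, HEq.rfl⟩
    simpa using e
  · exact hG.cancel (hf.resolve_left hi) (hf'.resolve_left (fun t => hi (h.2 t))) e

end IsFreeOn

/-- A functor between freely generated categories which is bijective on objects and on generators
is bijective on arrows. -/
theorem IsFreeOn.map_bijective {D : Type w'} [Category.{v'} D] {G : MorphismProperty C}
    {G' : MorphismProperty D} (hG : IsFreeOn G) (hG' : IsFreeOn G') (F : C ⥤ D)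
    (hobj : Function.Bijective F.obj) (hmap : ∀ ⦃a b : C⦄ (f : a ⟶ b), G f → G' (F.map f))
    (hinj : ∀ ⦃a b : C⦄ (f g : a ⟶ b), G f → G g → F.map f = F.map g → f = g)
    (hsurj : ∀ ⦃a b : C⦄ (f : F.obj a ⟶ F.obj b), G' f → ∃ g, G g ∧ F.map g = f) (a b : C) :
    Function.Bijective (F.map : (a ⟶ b) → _) := by
  -- `F` reflects identities: a non-identity ends in a generator, and so does its image.
  have id_of : ∀ {a b : C} (f : a ⟶ b), IsIdentity (F.map f) → IsIdentity f := by
    intro a b f hf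
    rcases hG.isIdentity_or f with h | ⟨c, g, h, hh, rfl⟩
    · exact h
    · rw [F.map_comp] at hf
      exact absurd hf (hG'.not_isIdentity _ _ (hmap h hh))
  constructor
  · intro f
    induction f using hG.induction with
    | id a =>
      intro f hf
      obtain ⟨_, rfl⟩ := id_of f (by rw [← hf, F.map_id]; exact isIdentity_id _)
      rfl
    | @comp a c b g h hh ih =>
      intro f hf
      rcases hG.isIdentity_or f with hi | ⟨c', g', h', hh', rfl⟩
      · obtain ⟨rfl, rfl⟩ := hi
        have := hG'.not_isIdentity (F.map g) (F.map h) (hmap h hh)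
        rw [← F.map_comp, hf, eqToHom_refl, F.map_id] at this
        exact absurd (isIdentity_id _) this
      · rw [F.map_comp, F.map_comp] at hf
        obtain ⟨e, h₁, h₂⟩ := hG'.cancel (hmap h hh) (hmap h' hh') hf
        obtain rfl := hobj.1 e
        rw [ih (eq_of_heq h₁), hinj h h' hh hh' (eq_of_heq h₂)]
  -- In the induction the intermediate objects are arbitrary objects of `D`, so the endpoints are
  -- allowed to be images only up to a propositional equality.
  · suffices H : ∀ {x y : D} (f : x ⟶ y) (a b : C) (ha : F.obj a = x) (hb : F.obj b = y),
        ∃ g : a ⟶ b, F.map g = eqToHom ha ≫ f ≫ eqToHom hb.symm by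
      intro f
      simpa using H f a b rfl rfl
    intro x y f
    induction f using hG'.induction with
    | id x =>
      intro a b ha hb
      obtain rfl := hobj.1 (ha.trans hb.symm)
      exact ⟨𝟙 a, by simp⟩
    | @comp x z y g h hh ih =>
      intro a b ha hb
      obtain ⟨c, rfl⟩ := hobj.2 z
      subst ha hb
      obtain ⟨g', hg'⟩ := ih a c rfl rfl
      obtain ⟨h', -, rfl⟩ := hsurj h hh
      exact ⟨g' ≫ h', by simp [hg']⟩

end FreelyGenerated

end SimpCat

/-! ### The arrows of the homotopy coherent simplices -/

namespace SimpCat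

section PathSet

variable {k l : SimplexCategory} {n m : SimplexCategoryᵒᵖ}

/-- The `r`-th subset in the chain of subsets underlying an `n`-arrow of the homotopy coherent
`k`-simplex. -/
def pathSet {i j : CohSimplex.{u} k} (f : (i ⟶[SSet.{u}] j).obj n) (r : Fin (n.unop.len + 1)) :
    Set (Fin (k.len + 1)) :=
  {v | ULift.up v ∈
    (Functor.obj (show ComposableArrows (i ⟶ j) n.unop.len from f) r).I}

theorem left_mem_pathSet {i j : CohSimplex.{u} k} (f : (i ⟶[SSet.{u}] j).obj n)
    (r : Fin (n.unop.len + 1)) : i.as.down ∈ pathSet f r :=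
  (Functor.obj (show ComposableArrows (i ⟶ j) n.unop.len from f) r).left

theorem right_mem_pathSet {i j : CohSimplex.{u} k} (f : (i ⟶[SSet.{u}] j).obj n)
    (r : Fin (n.unop.len + 1)) : j.as.down ∈ pathSet f r :=
  (Functor.obj (show ComposableArrows (i ⟶ j) n.unop.len from f) r).right

theorem le_of_mem_pathSet {i j : CohSimplex.{u} k} {f : (i ⟶[SSet.{u}] j).obj n}
    {r : Fin (n.unop.len + 1)} {v : Fin (k.len + 1)} (h : v ∈ pathSet f r) : i.as.down ≤ v :=
  (Functor.obj (show ComposableArrows (i ⟶ j) n.unop.len from f) r).left_le _ h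

theorem mem_pathSet_le {i j : CohSimplex.{u} k} {f : (i ⟶[SSet.{u}] j).obj n}
    {r : Fin (n.unop.len + 1)} {v : Fin (k.len + 1)} (h : v ∈ pathSet f r) : v ≤ j.as.down :=
  (Functor.obj (show ComposableArrows (i ⟶ j) n.unop.len from f) r).le_right _ h

theorem src_le_tgt {i j : CohSimplex.{u} k} (f : (i ⟶[SSet.{u}] j).obj n) :
    i.as.down ≤ j.as.down :=
  le_of_mem_pathSet (right_mem_pathSet f 0)

theorem pathSet_mono {i j : CohSimplex.{u} k} (f : (i ⟶[SSet.{u}] j).obj n) :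
    Monotone (pathSet f) := fun r r' h _ hv =>
  (CategoryTheory.Functor.map (show ComposableArrows (i ⟶ j) n.unop.len from f)
    (homOfLE h : r ⟶ r')).hom.down.down hv

theorem pathSet_ext {i j : CohSimplex.{u} k} {f g : (i ⟶[SSet.{u}] j).obj n}
    (h : ∀ r, pathSet f r = pathSet g r) : f = g := by
  refine CategoryTheory.Functor.ext (F := (show ComposableArrows (i ⟶ j) n.unop.len from f))
    (G := (show ComposableArrows (i ⟶ j) n.unop.len from g)) (fun r => ?_)
    (fun _ _ _ => InducedCategory.hom_ext (Subsingleton.elim _ _))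
  refine SimplicialThickening.hom_ext _ _ _ _ fun t => ?_
  exact Set.ext_iff.1 (h r) t.down

/-- The `n`-arrow of a homotopy coherent simplex with a given underlying chain of subsets. -/
def ofPathSet (i j : CohSimplex.{u} k) (T : Fin (n.unop.len + 1) → Set (Fin (k.len + 1)))
    (hT : Monotone T) (hi : ∀ r, i.as.down ∈ T r) (hj : ∀ r, j.as.down ∈ T r)
    (hT' : ∀ r, ∀ v ∈ T r, i.as.down ≤ v ∧ v ≤ j.as.down) : (i ⟶[SSet.{u}] j).obj n :=
  show ComposableArrows (i ⟶ j) n.unop.len from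
    { obj := fun r =>
        { I := {v | v.down ∈ T r}
          left := hi r
          right := hj r
          left_le := fun v h => (hT' r v.down h).1
          le_right := fun v h => (hT' r v.down h).2 }
      map := fun {r r'} h => ⟨⟨⟨fun _ hv => hT (leOfHom h) hv⟩⟩⟩ }

theorem pathSet_nId (i : CohSimplex.{u} k) (r : Fin (n.unop.len + 1)) :
    pathSet (nId i n) r = {i.as.down} := by
  ext v
  change ULift.up v = i.as ↔ v = i.as.down
  exact ⟨congrArg ULift.down, congrArg ULift.up⟩

theorem pathSet_nComp {i j j' : CohSimplex.{u} k} (f : (i ⟶[SSet.{u}] j).obj n)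
    (g : (j ⟶[SSet.{u}] j').obj n) (r : Fin (n.unop.len + 1)) :
    pathSet (nComp f g) r = pathSet f r ∪ pathSet g r := rfl

theorem pathSet_map {i j : CohSimplex.{u} k} (θ : n ⟶ m) (f : (i ⟶[SSet.{u}] j).obj n)
    (r : Fin (m.unop.len + 1)) :
    pathSet ((i ⟶[SSet.{u}] j).map θ f) r = pathSet f (θ.unop.toOrderHom r) := rfl

theorem pathSet_cohMap {i j : CohSimplex.{u} k} (α : k ⟶ l) (f : (i ⟶[SSet.{u}] j).obj n)
    (r : Fin (n.unop.len + 1)) :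
    pathSet (nMap (cohMap α) f) r = α.toOrderHom '' pathSet f r := by
  ext v
  constructor
  · rintro ⟨w, hw, hv⟩
    exact ⟨w.down, hw, congrArg ULift.down hv⟩
  · rintro ⟨w, hw, rfl⟩
    exact ⟨⟨w⟩, hw, rfl⟩

theorem cohMap_obj_down (α : k ⟶ l) (i : CohSimplex.{u} k) :
    ((cohMap α).obj i).as.down = α.toOrderHom i.as.down := rfl

/-- The generating arrows of a homotopy coherent simplex. -/
def cohGenerators (k : SimplexCategory) (n : SimplexCategoryᵒᵖ) :
    MorphismProperty (Level (CohSimplex.{u} k) n) := fun i j f =>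
  i ≠ j ∧ pathSet (i := i.of) (j := j.of) f 0 = {i.of.as.down, j.of.as.down}

theorem cohSimplex_ext {i j : CohSimplex.{u} k} (h : i.as.down = j.as.down) : i = j := by
  obtain ⟨⟨i⟩⟩ := i
  obtain ⟨⟨j⟩⟩ := j
  exact congrArg (fun t => SimplicialThickening.mk (ULift.up t)) h

theorem eq_nId_of_pathSet {i : CohSimplex.{u} k} (f : (i ⟶[SSet.{u}] i).obj n) :
    f = nId i n := by
  refine pathSet_ext fun r => ?_
  rw [pathSet_nId]
  ext v
  constructor
  · exact fun h => le_antisymm (mem_pathSet_le h) (le_of_mem_pathSet h)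
  · rintro rfl
    exact left_mem_pathSet f r

/-- The factors of a composite meet only in the middle object, so cutting the union there recovers
them: factors are determined by the composite and the middle object. -/
theorem pathSet_eq_inter_Iic {i j j' : CohSimplex.{u} k} (f : (i ⟶[SSet.{u}] j).obj n)
    (g : (j ⟶[SSet.{u}] j').obj n) (r : Fin (n.unop.len + 1)) :
    pathSet f r = pathSet (nComp f g) r ∩ Set.Iic j.as.down := by
  ext v
  rw [pathSet_nComp]
  constructor
  · exact fun h => ⟨Or.inl h, mem_pathSet_le h⟩
  · rintro ⟨h | h, h'⟩
    · exact h
    · obtain rfl : v = j.as.down := le_antisymm h' (le_of_mem_pathSet h)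
      exact right_mem_pathSet f r

theorem pathSet_eq_inter_Ici {i j j' : CohSimplex.{u} k} (f : (i ⟶[SSet.{u}] j).obj n)
    (g : (j ⟶[SSet.{u}] j').obj n) (r : Fin (n.unop.len + 1)) :
    pathSet g r = pathSet (nComp f g) r ∩ Set.Ici j.as.down := by
  ext v
  rw [pathSet_nComp]
  constructor
  · exact fun h => ⟨Or.inr h, le_of_mem_pathSet h⟩
  · rintro ⟨h | h, h'⟩
    · obtain rfl : v = j.as.down := le_antisymm (mem_pathSet_le h) h'
      exact left_mem_pathSet g r
    · exact h

/-- If the last factor is atomic, its source is the largest point other than `j` in the bottom set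
of the composite. Used in both directions, this pins down the middle object. -/
theorem le_of_nComp_eq {i j c c' : CohSimplex.{u} k} {g : (i ⟶[SSet.{u}] c).obj n}
    {f : (c ⟶[SSet.{u}] j).obj n} {g' : (i ⟶[SSet.{u}] c').obj n} {f' : (c' ⟶[SSet.{u}] j).obj n}
    (hc : c ≠ j) (hf' : pathSet f' 0 = {c'.as.down, j.as.down}) (h : nComp g f = nComp g' f') :
    c.as.down ≤ c'.as.down := by
  have hm : c.as.down ∈ pathSet (nComp g' f') 0 := h ▸ Or.inl (right_mem_pathSet g 0)
  rw [pathSet_nComp, hf'] at hm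
  rcases hm with hm | hm | hm
  · exact mem_pathSet_le hm
  · exact hm.le
  · exact absurd (cohSimplex_ext hm) hc

theorem exists_last_factor {i j : CohSimplex.{u} k} (f : (i ⟶[SSet.{u}] j).obj n) (hij : i ≠ j) :
    ∃ (c : CohSimplex.{u} k) (g : (i ⟶[SSet.{u}] c).obj n) (h : (c ⟶[SSet.{u}] j).obj n),
      c ≠ j ∧ pathSet h 0 = {c.as.down, j.as.down} ∧ nComp g h = f := by
  -- `c` is the largest point of the bottom set other than `j`. The chain increases, so `c` lies in
  -- all of its sets and the whole chain can be cut at `c`.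
  obtain ⟨c, ⟨hc, hcj⟩, hmax⟩ := Set.exists_max_image (pathSet f 0 \ {j.as.down}) id
    (Set.toFinite _) ⟨i.as.down, left_mem_pathSet f 0, fun h => hij (cohSimplex_ext h)⟩
  have hcr : ∀ r, c ∈ pathSet f r := fun r => pathSet_mono f (Fin.zero_le r) hc
  refine ⟨⟨⟨c⟩⟩,
    ofPathSet _ _ (fun r => pathSet f r ∩ Set.Iic c)
      (fun r r' h => Set.inter_subset_inter_left _ (pathSet_mono f h))
      (fun r => ⟨left_mem_pathSet f r, le_of_mem_pathSet hc⟩) (fun r => ⟨hcr r, le_refl c⟩)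
      (fun r v h => ⟨le_of_mem_pathSet h.1, h.2⟩),
    ofPathSet _ _ (fun r => pathSet f r ∩ Set.Ici c)
      (fun r r' h => Set.inter_subset_inter_left _ (pathSet_mono f h))
      (fun r => ⟨hcr r, le_refl c⟩) (fun r => ⟨right_mem_pathSet f r, mem_pathSet_le hc⟩)
      (fun r v h => ⟨h.2, mem_pathSet_le h.1⟩), ?_, ?_, ?_⟩
  · rintro rfl
    exact hcj rfl
  · ext v
    constructor
    · rintro ⟨hv, hcv⟩
      by_cases hvj : v = j.as.down
      · exact Or.inr hvj
      · exact Or.inl (le_antisymm (hmax v ⟨hv, hvj⟩) hcv)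
    · rintro (rfl | rfl)
      · exact ⟨hc, Set.mem_Ici.2 le_rfl⟩
      · exact ⟨right_mem_pathSet f 0, mem_pathSet_le hc⟩
  · refine pathSet_ext fun r => ?_
    change pathSet f r ∩ Set.Iic c ∪ pathSet f r ∩ Set.Ici c = pathSet f r
    rw [← Set.inter_union_distrib_left, Set.Iic_union_Ici, Set.inter_univ]

theorem cohGenerators_isFreeOn (k : SimplexCategory) (n : SimplexCategoryᵒᵖ) :
    IsFreeOn (cohGenerators.{u} k n) where
  not_isIdentity {a b c} g f hf := by
    rintro ⟨rfl, -⟩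
    refine hf.1 ?_
    have h : c.of = a.of := cohSimplex_ext (le_antisymm (src_le_tgt (i := c.of) (j := a.of) f)
      (src_le_tgt (i := a.of) (j := c.of) g))
    exact congrArg Level.mk h
  cancel {a b c c' g f g' f'} hf hf' h := by
    obtain ⟨c⟩ := c
    obtain ⟨c'⟩ := c'
    have hc : c ≠ b.of := fun e => hf.1 (congrArg Level.mk e)
    have hc' : c' ≠ b.of := fun e => hf'.1 (congrArg Level.mk e)
    obtain rfl : c = c' := cohSimplex_ext (le_antisymm (le_of_nComp_eq hc hf'.2 h)
      (le_of_nComp_eq hc' hf.2 h.symm))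
    refine ⟨rfl, heq_of_eq (pathSet_ext fun r => ?_), heq_of_eq (pathSet_ext fun r => ?_)⟩
    · rw [pathSet_eq_inter_Iic g f, pathSet_eq_inter_Iic g' f']
      exact congrArg (fun t => pathSet (i := a.of) (j := b.of) t r ∩ _) h
    · rw [pathSet_eq_inter_Ici g f, pathSet_eq_inter_Ici g' f']
      exact congrArg (fun t => pathSet (i := a.of) (j := b.of) t r ∩ _) h
  exists_length := by
    -- The length of the interval from source to target bounds the number of atomic factors. Sources
    -- lie below targets, so the truncated subtraction is harmless.
    refine ⟨fun {a b} _ => b.of.as.down.val - a.of.as.down.val, fun {a b} f => ?_⟩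
    obtain ⟨a⟩ := a
    obtain ⟨b⟩ := b
    by_cases hab : a = b
    · subst hab
      exact Or.inl ⟨rfl, eq_nId_of_pathSet f⟩
    · obtain ⟨c, g, h, hc, hh, rfl⟩ := exists_last_factor f hab
      refine Or.inr ⟨⟨c⟩, g, h, ⟨fun e => hc (congrArg Level.of e), hh⟩, rfl, ?_⟩
      have h₁ : a.as.down.val ≤ c.as.down.val := src_le_tgt g
      have h₂ : c.as.down.val ≤ b.as.down.val := src_le_tgt h
      have h₃ : c.as.down.val ≠ b.as.down.val := fun e => hc (cohSimplex_ext (Fin.ext e))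
      dsimp only
      omega

end PathSet

end SimpCat

/-! ### The realisation of a simplicial set is freely generated by beads -/

namespace SimpCat

/-- A generator of the realisation of `X` whose underlying arrow of the homotopy coherent simplex is
atomic or an identity. -/
structure PreBead (X : SSet.{u}) (n : SimplexCategoryᵒᵖ) (x y : Vert X) extends Gen X n x y where
  pathSet_zero : pathSet arrow 0 = {i.as.down, j.as.down}

/-- The condition on the bottom set is stable under direct image, even when the two endpoints become
equal. This is why identities are admitted in `PreBead`: atomic arrows alone would not be closed
under gluing. -/
theorem pathSet_zero_cohMap {k l : SimplexCategory} {n : SimplexCategoryᵒᵖ} (α : k ⟶ l)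
    {i j : CohSimplex.{u} k} {f : (i ⟶[SSet.{u}] j).obj n}
    (hf : pathSet f 0 = {i.as.down, j.as.down}) :
    pathSet (nMap (cohMap α) f) 0 =
      {((cohMap α).obj i).as.down, ((cohMap α).obj j).as.down} := by
  rw [pathSet_cohMap, hf, Set.image_pair]
  rfl

/-- The gluing relation between generators. -/
inductive BeadRel (X : SSet.{u}) (n : SimplexCategoryᵒᵖ) (x y : Vert X) :
    PreBead X n x y → PreBead X n x y → Prop
  | glue {k l : SimplexCategory} (α : k ⟶ l) (s : X.obj (op l))
      {i j : CohSimplex.{u} k} (f : (i ⟶[SSet.{u}] j).obj n)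
      (hf : pathSet f 0 = {i.as.down, j.as.down})
      (hi : vertex (X.map α.op s) i = x) (hj : vertex (X.map α.op s) j = y) :
      BeadRel X n x y ⟨⟨k, X.map α.op s, i, j, f, hi, hj⟩, hf⟩
        ⟨⟨l, s, _, _, nMap (cohMap α) f, (vertex_map α s i).symm.trans hi,
          (vertex_map α s j).symm.trans hj⟩, pathSet_zero_cohMap α hf⟩

/-- The atomic arrows and identities of homotopy coherent simplices attached to the simplices of
`X`, up to gluing. -/
def Bead (X : SSet.{u}) (n : SimplexCategoryᵒᵖ) (x y : Vert X) : Type u := Quot (BeadRel X n x y)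

theorem vertex_zero {X : SSet.{u}} (x : Vert X) : vertex x (cohObj 0) = x := by
  have : SimplexCategory.const (SimplexCategory.mk 0) (SimplexCategory.mk 0) 0 = 𝟙 _ := by
    ext; simp
  exact (congrArg (fun α => X.map (Quiver.Hom.op α) x) this).trans (X.map_id_apply _ x)

namespace Bead

variable {X : SSet.{u}} {n : SimplexCategoryᵒᵖ}

/-- The bead of a generator. -/
def mk {x y : Vert X} {k : SimplexCategory} (s : X.obj (op k)) {i j : CohSimplex.{u} k}
    (f : (i ⟶[SSet.{u}] j).obj n) (hf : pathSet f 0 = {i.as.down, j.as.down})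
    (hi : vertex s i = x) (hj : vertex s j = y) : Bead X n x y :=
  Quot.mk _ ⟨⟨k, s, i, j, f, hi, hj⟩, hf⟩

theorem exists_rep {x y : Vert X} (b : Bead X n x y) :
    ∃ (k : SimplexCategory) (s : X.obj (op k)) (i j : CohSimplex.{u} k)
      (f : (i ⟶[SSet.{u}] j).obj n) (hf : pathSet f 0 = {i.as.down, j.as.down})
      (hi : vertex s i = x) (hj : vertex s j = y), b = mk s f hf hi hj := by
  obtain ⟨⟨⟨k, s, i, j, f, hi, hj⟩, hf⟩⟩ := b
  exact ⟨k, s, i, j, f, hf, hi, hj, rfl⟩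

theorem mk_glue {x y : Vert X} {k l : SimplexCategory} (α : k ⟶ l) (s : X.obj (op l))
    {i j : CohSimplex.{u} k} (f : (i ⟶[SSet.{u}] j).obj n)
    (hf : pathSet f 0 = {i.as.down, j.as.down})
    (hi : vertex (X.map α.op s) i = x) (hj : vertex (X.map α.op s) j = y) :
    mk (X.map α.op s) f hf hi hj = mk s (nMap (cohMap α) f) (pathSet_zero_cohMap α hf)
      ((vertex_map α s i).symm.trans hi) ((vertex_map α s j).symm.trans hj) :=
  Quot.sound (BeadRel.glue α s f hf hi hj)

/-- Beads are equal if their generators have the same underlying simplex and the same underlying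
chain of subsets. -/
theorem mk_congr {x y : Vert X} {k : SimplexCategory} {s s' : X.obj (op k)}
    {i j i' j' : CohSimplex.{u} k} {f : (i ⟶[SSet.{u}] j).obj n} {f' : (i' ⟶[SSet.{u}] j').obj n}
    {hf : pathSet f 0 = {i.as.down, j.as.down}} {hf' : pathSet f' 0 = {i'.as.down, j'.as.down}}
    {hi : vertex s i = x} {hj : vertex s j = y} {hi' : vertex s' i' = x} {hj' : vertex s' j' = y}
    (hs : s = s') (h : ∀ r, pathSet f r = pathSet f' r) :
    mk s f hf hi hj = mk s' f' hf' hi' hj' := by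
  obtain rfl : i = i' := cohSimplex_ext (le_antisymm
    (le_of_mem_pathSet (h 0 ▸ left_mem_pathSet f' 0))
    (le_of_mem_pathSet (h 0 ▸ left_mem_pathSet f 0)))
  obtain rfl : j = j' := cohSimplex_ext (le_antisymm
    (mem_pathSet_le (h 0 ▸ right_mem_pathSet f 0))
    (mem_pathSet_le (h 0 ▸ right_mem_pathSet f' 0)))
  obtain rfl := pathSet_ext h
  subst hs
  rfl

/-- Beads are equal if a simplicial operator relates their generators. -/
theorem mk_eq_of_operator {x y : Vert X} {k l : SimplexCategory} (α : k ⟶ l) {s : X.obj (op k)}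
    {s' : X.obj (op l)} {i j : CohSimplex.{u} k} {i' j' : CohSimplex.{u} l}
    {f : (i ⟶[SSet.{u}] j).obj n} {f' : (i' ⟶[SSet.{u}] j').obj n}
    {hf : pathSet f 0 = {i.as.down, j.as.down}} {hf' : pathSet f' 0 = {i'.as.down, j'.as.down}}
    {hi : vertex s i = x} {hj : vertex s j = y} {hi' : vertex s' i' = x} {hj' : vertex s' j' = y}
    (hs : X.map α.op s' = s) (h : ∀ r, α.toOrderHom '' pathSet f r = pathSet f' r) :
    mk s f hf hi hj = mk s' f' hf' hi' hj' := by
  subst hs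
  rw [mk_glue]
  exact mk_congr rfl fun r => (pathSet_cohMap α f r).trans (h r)

/-- The identity bead. -/
def one (x : Vert X) : Bead X n x x :=
  mk x (nId (cohObj 0) n) ((pathSet_nId _ _).trans (Set.pair_eq_singleton _).symm)
    (vertex_zero x) (vertex_zero x)

/-- The constant operator at `i` glues the identity at the `0`-simplex `x` to the identity at `i` in
`s`, so all identities at `x` give one bead. -/
theorem mk_self {x : Vert X} {k : SimplexCategory} (s : X.obj (op k)) {i : CohSimplex.{u} k}
    (f : (i ⟶[SSet.{u}] i).obj n) (hf : pathSet f 0 = {i.as.down, i.as.down})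
    (hi : vertex s i = x) (hi' : vertex s i = x) : mk s f hf hi hi' = one x := by
  refine (mk_eq_of_operator
    (SimplexCategory.const (SimplexCategory.mk 0) k i.as.down) hi fun r => ?_).symm
  rw [eq_nId_of_pathSet f, pathSet_nId, pathSet_nId, Set.image_singleton]
  rfl

/-- A bead is trivial if it is an identity. -/
def IsOne {x y : Vert X} (b : Bead X n x y) : Prop := x = y ∧ HEq b (one (n := n) x)

theorem isOne_one (x : Vert X) : (one x : Bead X n x x).IsOne := ⟨rfl, HEq.rfl⟩

theorem isOne_mk {x y : Vert X} {k : SimplexCategory} (s : X.obj (op k)) {i j : CohSimplex.{u} k}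
    (f : (i ⟶[SSet.{u}] j).obj n) (hf : pathSet f 0 = {i.as.down, j.as.down})
    (hi : vertex s i = x) (hj : vertex s j = y) (hij : i = j) : (mk s f hf hi hj).IsOne := by
  subst hij hi hj
  rw [mk_self]
  exact isOne_one _

/-- The arrow of the realisation given by a bead. -/
def toHom {x y : Vert X} (b : Bead X n x y) : RealHom X n x y :=
  Quot.lift (fun p : PreBead X n x y => RealHom.gen p.simplex p.arrow p.src p.tgt)
    (by rintro _ _ ⟨α, s, f, hf, hi, hj⟩; exact RealHom.gen_glue α s f hi hj) b

theorem toHom_mk {x y : Vert X} {k : SimplexCategory} (s : X.obj (op k)) {i j : CohSimplex.{u} k}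
    (f : (i ⟶[SSet.{u}] j).obj n) (hf : pathSet f 0 = {i.as.down, j.as.down})
    (hi : vertex s i = x) (hj : vertex s j = y) :
    (mk s f hf hi hj).toHom = RealHom.gen s f hi hj := rfl

theorem toHom_one (x : Vert X) : (one x : Bead X n x x).toHom = RealHom.id x :=
  RealHom.gen_id x (cohObj 0) (vertex_zero x)

end Bead

/-- The quiver of non-trivial beads. -/
structure BeadQuiver (X : SSet.{u}) (n : SimplexCategoryᵒᵖ) where
  of : Vert X

instance (X : SSet.{u}) (n : SimplexCategoryᵒᵖ) : Quiver.{u} (BeadQuiver X n) where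
  Hom x y := { b : Bead X n x.of y.of // ¬ b.IsOne }

/-- Necklaces are paths of non-trivial beads. -/
abbrev Necklace (X : SSet.{u}) (n : SimplexCategoryᵒᵖ) : Type u := Paths (BeadQuiver X n)

/-- The vertex `x`, as an object of the category of necklaces. -/
abbrev Necklace.obj {X : SSet.{u}} (n : SimplexCategoryᵒᵖ) (x : Vert X) : Necklace X n :=
  (BeadQuiver.mk x : BeadQuiver X n)

/-! ### Normal forms: arrows of the realisation as paths of nontrivial beads. -/

section Normal

variable {X : SSet.{u}} {n : SimplexCategoryᵒᵖ}

open Classical in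
/-- The necklace with at most one bead. -/
noncomputable def Bead.necklace {x y : Vert X} (b : Bead X n x y) :
    Necklace.obj n x ⟶ Necklace.obj n y :=
  if h : b.IsOne then eqToHom (congrArg (Necklace.obj n) h.1)
  else Quiver.Hom.toPath (V := BeadQuiver X n) (a := ⟨x⟩) (b := ⟨y⟩) ⟨b, h⟩

theorem Bead.necklace_of_not_isOne {x y : Vert X} (b : Bead X n x y) (h : ¬ b.IsOne) :
    b.necklace = Quiver.Path.cons (V := BeadQuiver X n) (a := ⟨x⟩) (c := ⟨y⟩) .nil ⟨b, h⟩ :=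
  dif_neg h

theorem Bead.necklace_one (x : Vert X) :
    (Bead.one x : Bead X n x x).necklace = 𝟙 (Necklace.obj n x) :=
  dif_pos (Bead.isOne_one x)

/-- The normal form of the arrow of the realisation given by a generator. -/
noncomputable def normalForm {x y : Vert X} {k : SimplexCategory} (s : X.obj (op k))
    {i j : CohSimplex.{u} k} (f : (i ⟶[SSet.{u}] j).obj n) (hi : vertex s i = x)
    (hj : vertex s j = y) : Necklace.obj n x ⟶ Necklace.obj n y :=
  eqToHom (congrArg (Necklace.obj n) hi.symm) ≫
    IsFreeOn.extend (C := Level (CohSimplex.{u} k) n)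
      (fun i => Necklace.obj n (vertex s i.of))
      (fun {a b} f hf => (Bead.mk s (i := a.of) (j := b.of) f
        (((cohGenerators_isFreeOn k n).isAtomic_iff f).1 hf).2 rfl rfl).necklace)
      (cohGenerators_isFreeOn k n).isComputad (a := ⟨i⟩) (b := ⟨j⟩) f ≫
    eqToHom (congrArg (Necklace.obj n) hj)

theorem normalForm_rfl {k : SimplexCategory} (s : X.obj (op k)) {i j : CohSimplex.{u} k}
    (f : (i ⟶[SSet.{u}] j).obj n) :
    normalForm s f rfl rfl = IsFreeOn.extend (C := Level (CohSimplex.{u} k) n)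
      (fun i => Necklace.obj n (vertex s i.of))
      (fun {a b} f hf => (Bead.mk s (i := a.of) (j := b.of) f
        (((cohGenerators_isFreeOn k n).isAtomic_iff f).1 hf).2 rfl rfl).necklace)
      (cohGenerators_isFreeOn k n).isComputad (a := ⟨i⟩) (b := ⟨j⟩) f := by
  simp [normalForm]

theorem normalForm_nId {x : Vert X} {k : SimplexCategory} (s : X.obj (op k))
    (i : CohSimplex.{u} k) (hi : vertex s i = x) :
    normalForm s (nId i n) hi hi = 𝟙 _ := by
  subst hi
  exact (normalForm_rfl s _).trans (IsFreeOn.extend_id _ _ _ _)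

theorem normalForm_nComp {x y z : Vert X} {k : SimplexCategory} (s : X.obj (op k))
    {i j l : CohSimplex.{u} k} (f : (i ⟶[SSet.{u}] j).obj n) (g : (j ⟶[SSet.{u}] l).obj n)
    (hi : vertex s i = x) (hj : vertex s j = y) (hl : vertex s l = z) :
    normalForm s f hi hj ≫ normalForm s g hj hl = normalForm s (nComp f g) hi hl := by
  subst hi hj hl
  rw [normalForm_rfl, normalForm_rfl, normalForm_rfl]
  exact (IsFreeOn.extend_comp (C := Level (CohSimplex.{u} k) n) _ _ _
    (a := ⟨i⟩) (b := ⟨j⟩) (c := ⟨l⟩) f g).symm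

/-- If `i = j` both sides are the empty necklace; otherwise `f` is an atom, on which the extension
takes its prescribed value. -/
theorem normalForm_bead {x y : Vert X} {k : SimplexCategory} (s : X.obj (op k))
    {i j : CohSimplex.{u} k} (f : (i ⟶[SSet.{u}] j).obj n)
    (hf : pathSet f 0 = {i.as.down, j.as.down}) (hi : vertex s i = x) (hj : vertex s j = y) :
    normalForm s f hi hj = (Bead.mk s f hf hi hj).necklace := by
  by_cases hij : i = j
  · subst hij hi hj
    obtain rfl := eq_nId_of_pathSet f
    rw [normalForm_nId, Bead.mk_self, Bead.necklace_one]
  · subst hi hj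
    exact (normalForm_rfl s f).trans (IsFreeOn.extend_atomic
      (C := Level (CohSimplex.{u} k) n) _ _ _ (a := ⟨i⟩) (b := ⟨j⟩) f
      (((cohGenerators_isFreeOn k n).isAtomic_iff (a := ⟨i⟩) (b := ⟨j⟩) f).2
        ⟨fun e => hij (congrArg Level.of e), hf⟩))

/-- Arrows of a homotopy coherent simplex are generated by the atomic ones. -/
theorem cohSimplex_induction {k : SimplexCategory}
    {P : ∀ {i j : CohSimplex.{u} k}, (i ⟶[SSet.{u}] j).obj n → Prop}
    (id : ∀ i, P (nId i n))
    (comp : ∀ {i j l : CohSimplex.{u} k} (g : (i ⟶[SSet.{u}] j).obj n)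
      (h : (j ⟶[SSet.{u}] l).obj n), pathSet h 0 = {j.as.down, l.as.down} → P g → P (nComp g h))
    {i j : CohSimplex.{u} k} (f : (i ⟶[SSet.{u}] j).obj n) : P f :=
  (cohGenerators_isFreeOn k n).induction
    (P := fun {a b} (f : a ⟶ b) => P (i := a.of) (j := b.of) f) (fun a => id a.of)
    (fun {a b c} g h hh => comp (i := a.of) (j := b.of) (l := c.of) g h hh.2)
    (a := ⟨i⟩) (b := ⟨j⟩) f

/-- Normal forms of generators respect the relations of the realisation. -/
noncomputable def normalData (X : SSet.{u}) (n : SimplexCategoryᵒᵖ) :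
    RealHom.LiftData X n (Necklace X n) where
  obj x := Necklace.obj n x
  map s _ _ f hi hj := normalForm s f hi hj
  map_id s i hi := normalForm_nId s i hi
  map_comp s _ _ _ f g hi hj hl := normalForm_nComp s f g hi hj hl
  map_glue {x y k l} α s {i j} f hi hj := by
    subst hi hj
    -- Both sides are compatible with composition, so it is enough to compare them on arrows with
    -- bottom set reduced to the endpoints, where the gluing is built into `Bead`.
    induction f using cohSimplex_induction with
    | id i =>
      rw [normalForm_nId]
      generalize_proofs h
      revert h
      rw [nMap_nId]
      exact fun h => (normalForm_nId s _ h).symm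
    | comp g h hh ih =>
      rw [← normalForm_nComp _ g h rfl rfl rfl, ih, normalForm_bead _ h hh, Bead.mk_glue,
        ← normalForm_bead]
      generalize_proofs h₁ h₂ h₃
      refine (normalForm_nComp s _ _ h₁ h₂ h₃).trans ?_
      rw [← nMap_nComp]

/-- The normal form of an arrow of the realisation. -/
noncomputable def RealHom.necklace {x y : Vert X} (f : RealHom X n x y) :
    Necklace.obj n x ⟶ Necklace.obj n y :=
  (normalData X n).lift f

theorem RealHom.necklace_comp {x y z : Vert X} (f : RealHom X n x y) (g : RealHom X n y z) :
    (f.comp g).necklace = f.necklace ≫ g.necklace :=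
  (normalData X n).lift_comp f g

theorem Bead.necklace_toHom {x y : Vert X} (b : Bead X n x y) : b.toHom.necklace = b.necklace := by
  obtain ⟨k, s, i, j, f, hf, hi, hj, rfl⟩ := b.exists_rep
  exact ((normalData X n).lift_gen s f hi hj).trans (normalForm_bead s f hf hi hj)

/-- The length of the path, zero or one, tells trivial beads from nontrivial ones. A trivial bead is
unique, and a nontrivial one is read off from its path. -/
theorem Bead.necklace_injective {x y : Vert X} {b b' : Bead X n x y}
    (h : b.necklace = b'.necklace) : b = b' := by
  by_cases hb : b.IsOne <;> by_cases hb' : b'.IsOne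
  · obtain ⟨rfl, hb⟩ := hb
    exact (eq_of_heq hb).trans (eq_of_heq hb'.2).symm
  · obtain ⟨rfl, hb⟩ := hb
    obtain rfl := eq_of_heq hb
    rw [b'.necklace_of_not_isOne hb', Bead.necklace_one] at h
    cases h
  · obtain ⟨rfl, hb'⟩ := hb'
    obtain rfl := eq_of_heq hb'
    rw [b.necklace_of_not_isOne hb, Bead.necklace_one] at h
    cases h
  · rw [b.necklace_of_not_isOne hb, b'.necklace_of_not_isOne hb'] at h
    injection h with _ _ _ h
    exact congrArg Subtype.val h

/-- The composition relations of the realisation identify no further beads than the gluing relation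
does, because the normal form of `b.toHom` still remembers `b`. -/
theorem Bead.toHom_injective {x y : Vert X} {b b' : Bead X n x y} (h : b.toHom = b'.toHom) :
    b = b' :=
  Bead.necklace_injective (by rw [← b.necklace_toHom, h, b'.necklace_toHom])

/-- The arrow of the realisation given by a necklace. -/
def RealHom.ofNecklace {x : Vert X} : ∀ {y : BeadQuiver X n},
    Quiver.Path (V := BeadQuiver X n) ⟨x⟩ y → RealHom X n x y.of
  | _, .nil => RealHom.id x
  | _, .cons p b => (RealHom.ofNecklace p).comp b.1.toHom

theorem RealHom.ofNecklace_comp {x y z : Vert X} (p : Necklace.obj n x ⟶ Necklace.obj n y)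
    (q : Necklace.obj n y ⟶ Necklace.obj n z) :
    RealHom.ofNecklace (p ≫ q) = (RealHom.ofNecklace p).comp (RealHom.ofNecklace q) := by
  suffices H : ∀ {z : BeadQuiver X n} (q : Quiver.Path (V := BeadQuiver X n) ⟨y⟩ z),
      RealHom.ofNecklace (Quiver.Path.comp (V := BeadQuiver X n) p q) =
        (RealHom.ofNecklace p).comp (RealHom.ofNecklace q) from H q
  intro z q
  induction q with
  | nil => exact (RealHom.comp_id _).symm
  | cons q b ih => exact (congrArg (fun t => t.comp b.1.toHom) ih).trans (RealHom.assoc _ _ _)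

theorem RealHom.ofNecklace_bead {x y : Vert X} (b : Bead X n x y) :
    RealHom.ofNecklace b.necklace = b.toHom := by
  by_cases hb : b.IsOne
  · obtain ⟨rfl, hb⟩ := hb
    obtain rfl := eq_of_heq hb
    rw [Bead.necklace_one]
    exact (Bead.toHom_one x).symm
  · rw [b.necklace_of_not_isOne hb]
    exact RealHom.id_comp _

/-- Decomposing an arrow of one coherent simplex into atoms and recomposing their images gives back
its image, by `gen_comp`. -/
theorem RealHom.ofNecklace_normalForm {x y : Vert X} {k : SimplexCategory} (s : X.obj (op k))
    {i j : CohSimplex.{u} k} (f : (i ⟶[SSet.{u}] j).obj n)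
    (hi : vertex s i = x) (hj : vertex s j = y) :
    RealHom.ofNecklace (normalForm s f hi hj) = RealHom.gen s f hi hj := by
  subst hi hj
  induction f using cohSimplex_induction with
  | id i =>
    rw [normalForm_nId]
    exact (RealHom.gen_id s i rfl).symm
  | comp g h hh ih =>
    rw [← normalForm_nComp _ g h rfl rfl rfl, ofNecklace_comp, ih, normalForm_bead _ h hh,
      ofNecklace_bead, Bead.toHom_mk]
    exact RealHom.gen_comp s g h rfl rfl rfl

/-- A one-sided inverse suffices: normal forms are faithful, so cancellation can be checked on
paths. -/
theorem RealHom.ofNecklace_necklace {x y : Vert X} (f : RealHom X n x y) :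
    RealHom.ofNecklace f.necklace = f := by
  induction f using RealHom.induction with
  | id x => rfl
  | comp f s g hi ih =>
    rw [necklace_comp, ofNecklace_comp, ih]
    refine congrArg _ ?_
    exact (congrArg RealHom.ofNecklace ((normalData X n).lift_gen s g hi rfl)).trans
      (ofNecklace_normalForm s g hi rfl)

/-- The non-identity arrows of the realisation given by beads. -/
def beadArrows (X : SSet.{u}) (n : SimplexCategoryᵒᵖ) : MorphismProperty (Level (realObj X) n) :=
  fun x y f => ¬ IsIdentity f ∧ ∃ b : Bead X n x.of y.of, b.toHom = f

theorem Bead.isIdentity_toHom {x y : Vert X} {b : Bead X n x y} (hb : b.IsOne) :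
    IsIdentity (C := Level (realObj X) n) (a := ⟨x⟩) (b := ⟨y⟩) b.toHom := by
  obtain ⟨rfl, hb⟩ := hb
  obtain rfl := eq_of_heq hb
  exact ⟨rfl, Bead.toHom_one x⟩

theorem necklace_of_isIdentity {x : Vert X} {f : RealHom X n x x}
    (hf : IsIdentity (C := Level (realObj X) n) (a := ⟨x⟩) (b := ⟨x⟩) f) :
    f.necklace = 𝟙 _ := by
  obtain ⟨_, rfl⟩ := hf
  rfl

/-- The last bead of an arrow is the last step of its normal form, so freeness of paths passes to
the realisation. -/
theorem beadArrows_necklace {x y z : Vert X} (g : RealHom X n x y) {b : Bead X n y z}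
    (hb : ¬ b.IsOne) : (g.comp b.toHom).necklace =
      Quiver.Path.cons (V := BeadQuiver X n) (b := ⟨y⟩) (c := ⟨z⟩) g.necklace ⟨b, hb⟩ := by
  rw [RealHom.necklace_comp, Bead.necklace_toHom, b.necklace_of_not_isOne hb]
  rfl

theorem beadArrows_isFreeOn (X : SSet.{u}) (n : SimplexCategoryᵒᵖ) :
    IsFreeOn (beadArrows X n) where
  not_isIdentity {a c b} g f hf := by
    obtain ⟨a⟩ := a
    obtain ⟨b⟩ := b
    obtain ⟨c⟩ := c
    obtain ⟨hf, β, rfl⟩ := hf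
    rintro ⟨h, hgf⟩
    obtain rfl : a = c := congrArg Level.of h
    have h₁ := beadArrows_necklace g (fun h => hf (Bead.isIdentity_toHom h))
    have h₂ := necklace_of_isIdentity (f := RealHom.comp g β.toHom) ⟨h, hgf⟩
    rw [h₁] at h₂
    cases h₂
  cancel {a b c c' g f g' f'} hf hf' h := by
    obtain ⟨a⟩ := a
    obtain ⟨b⟩ := b
    obtain ⟨c⟩ := c
    obtain ⟨c'⟩ := c'
    obtain ⟨hf, β, rfl⟩ := hf
    obtain ⟨hf', β', rfl⟩ := hf'
    have h₁ := beadArrows_necklace g (fun h => hf (Bead.isIdentity_toHom h))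
    have h₂ := beadArrows_necklace g' (fun h => hf' (Bead.isIdentity_toHom h))
    have h₃ : RealHom.comp g β.toHom = RealHom.comp g' β'.toHom := h
    rw [h₃, h₂] at h₁
    injection h₁ with hc _ hg hβ
    obtain rfl : c' = c := congrArg BeadQuiver.of hc
    obtain rfl : β' = β := congrArg Subtype.val (eq_of_heq hβ)
    refine ⟨rfl, ?_, HEq.rfl⟩
    have := congrArg RealHom.ofNecklace (eq_of_heq hg)
    exact heq_of_eq ((RealHom.ofNecklace_necklace g).symm.trans
      (this.symm.trans (RealHom.ofNecklace_necklace g')))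
  exists_length := by
    refine ⟨fun {a b} f => Quiver.Path.length (V := BeadQuiver X n) (a := ⟨a.of⟩) (b := ⟨b.of⟩)
      (RealHom.necklace f), fun {a b} f => ?_⟩
    obtain ⟨a⟩ := a
    obtain ⟨b⟩ := b
    -- With `f` written as the composite of a path, its last factor is the last bead of that path.
    obtain ⟨p, rfl⟩ : ∃ p : Quiver.Path (V := BeadQuiver X n) ⟨a⟩ ⟨b⟩,
        RealHom.ofNecklace p = f :=
      ⟨_, RealHom.ofNecklace_necklace f⟩
    cases p with
    | nil => exact Or.inl (isIdentity_id _)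
    | @cons c _ p β =>
      obtain ⟨c⟩ := c
      obtain ⟨β, hβ⟩ := β
      refine Or.inr ⟨⟨c⟩, RealHom.ofNecklace p, β.toHom, ⟨?_, β, rfl⟩, rfl, ?_⟩
      · rintro ⟨h, hh⟩
        obtain rfl : c = b := congrArg Level.of h
        -- An identity has the empty normal form, whereas a nontrivial bead has one of length one.
        have h₁ := necklace_of_isIdentity (f := β.toHom) ⟨h, hh⟩
        rw [β.necklace_toHom, β.necklace_of_not_isOne hβ] at h₁
        cases h₁
      · have h₁ := beadArrows_necklace (RealHom.ofNecklace p) hβ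
        change Quiver.Path.length (RealHom.ofNecklace p).necklace <
          Quiver.Path.length ((RealHom.ofNecklace p).comp β.toHom).necklace
        rw [h₁]
        exact Nat.lt_succ_self _

theorem isAtomicArrow_realObj_iff {x y : Vert X} (f : RealHom X n x y) :
    IsAtomicArrow (A := realObj X) (a := x) (b := y) f ↔
      ¬ IsIdArrow (A := realObj X) (a := x) (b := y) f ∧ ∃ b : Bead X n x y, b.toHom = f :=
  (beadArrows_isFreeOn X n).isAtomic_iff (a := ⟨x⟩) (b := ⟨y⟩) f

end Normal

/-! ### Degeneracies, and the realisation as a simplicial computad. -/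

theorem isIdArrow_map {A : Type u} [EnrichedCategory SSet.{u} A] {a b : A}
    {n m : SimplexCategoryᵒᵖ} (θ : n ⟶ m) (f : (a ⟶[SSet.{u}] b).obj n) (hf : IsIdArrow f) :
    IsIdArrow ((a ⟶[SSet.{u}] b).map θ f) := by
  obtain ⟨h, h'⟩ := hf
  obtain rfl : a = b := congrArg Level.of h
  obtain rfl : f = nId a n := h'
  rw [map_nId]
  exact isIdArrow_nId _ _

/-- Degeneracies reflect identities. -/
theorem isIdArrow_of_map_epi {A : Type u} [EnrichedCategory SSet.{u} A] {a b : A}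
    {n m : SimplexCategory} (σ : m ⟶ n) [Epi σ] (f : (a ⟶[SSet.{u}] b).obj (op n))
    (hf : IsIdArrow ((a ⟶[SSet.{u}] b).map σ.op f)) : IsIdArrow f := by
  -- Restriction along a section of `σ` undoes the degeneracy and preserves identities.
  have := isSplitEpi_of_epi σ
  have h := isIdArrow_map (section_ σ).op _ hf
  rwa [← Functor.map_comp_apply, ← op_comp, IsSplitEpi.id, op_id, Functor.map_id_apply] at h

/-- A degeneracy thus leaves the bottom set of a chain unchanged, and with it the property of being
a bead. -/
theorem toOrderHom_zero_of_epi {n m : SimplexCategory} (σ : m ⟶ n) [Epi σ] :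
    σ.toOrderHom 0 = 0 := by
  obtain ⟨v, hv⟩ := (SimplexCategory.epi_iff_surjective (f := σ)).1 inferInstance 0
  exact le_antisymm (hv ▸ σ.toOrderHom.monotone (Fin.zero_le v)) (Fin.zero_le _)

/-- The homotopy coherent realisation of a simplicial set is a simplicial computad. -/
theorem realObj_isSimplicialComputad (X : SSet.{u}) : IsSimplicialComputad (realObj X) where
  isComputad n := (beadArrows_isFreeOn X n).isComputad
  degenerate_atomic {n m} σ _ {x y} f hf := by
    obtain ⟨hf, b, rfl⟩ := (isAtomicArrow_realObj_iff (X := X) f).1 hf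
    refine (isAtomicArrow_realObj_iff (X := X) _).2
      ⟨fun h => hf (isIdArrow_of_map_epi σ _ h), ?_⟩
    obtain ⟨k, s, i, j, f, hf₀, hi, hj, rfl⟩ := b.exists_rep
    refine ⟨Bead.mk s ((i ⟶[SSet.{u}] j).map σ.op f) ?_ hi hj,
      (RealHom.operator_gen σ.op s f hi hj).symm⟩
    rw [pathSet_map, ← hf₀]
    exact congrArg (pathSet f) (toOrderHom_zero_of_epi σ)

end SimpCat

/-! ### Simplices of joins -/

namespace SimpCat

instance (n : SimplexCategoryᵒᵖ) : Subsingleton (pt.{u}.obj n) :=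
  ⟨fun _ _ => SSet.stdSimplex.objEquiv.injective (by ext; simp)⟩

theorem fin_two_of_ne_zero {e : Fin ((SimplexCategory.mk 1).len + 1)} (h : e ≠ 0) : e = 1 :=
  (by decide : ∀ e : Fin 2, e ≠ 0 → e = 1) e h

theorem fin_two_of_ne_one {e : Fin ((SimplexCategory.mk 1).len + 1)} (h : e ≠ 1) : e = 0 :=
  (by decide : ∀ e : Fin 2, e ≠ 1 → e = 0) e h

theorem eq_one_of_le {e e' : Fin ((SimplexCategory.mk 1).len + 1)} (h : e ≤ e') (he : e = 1) :
    e' = 1 :=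
  (by decide : ∀ e e' : Fin 2, e ≤ e' → e = 1 → e' = 1) e e' h he

theorem eq_zero_of_le {e e' : Fin ((SimplexCategory.mk 1).len + 1)} (h : e ≤ e') (he : e' = 0) :
    e = 0 :=
  (by decide : ∀ e e' : Fin 2, e ≤ e' → e' = 0 → e = 0) e e' h he

theorem zero_ne_one_fin_two : (0 : Fin ((SimplexCategory.mk 1).len + 1)) ≠ 1 :=
  Fin.zero_ne_one (n := 0)

section JoinSimplices

variable {X Y : SSet.{u}} {k l : SimplexCategory}

/-- The side of the join on which a vertex of a simplex lies. -/
def cutAt (s : (join X Y).obj (op k)) (v : Fin (k.len + 1)) :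
    Fin ((SimplexCategory.mk 1).len + 1) :=
  (cut s).toOrderHom v

theorem cutAt_mono (s : (join X Y).obj (op k)) {v w : Fin (k.len + 1)} (h : v ≤ w) :
    cutAt s v ≤ cutAt s w :=
  (cut s).toOrderHom.monotone h

theorem side_vertex_eq_iff {X' Y' : SSet.{u}} (s : (join X Y).obj (op k)) (i : CohSimplex.{u} k)
    (s' : (join X' Y').obj (op l)) (i' : CohSimplex.{u} l) :
    side (vertex s i) = side (vertex s' i') ↔ cutAt s i.as.down = cutAt s' i'.as.down :=
  ⟨congrArg ULift.down, congrArg ULift.up⟩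

theorem join_ext {s t : (join X Y).obj (op k)} (h : ∀ v, cutAt s v = cutAt t v)
    (hl : ∀ {m : SimplexCategory} (α : m ⟶ k) (h : InFibre (cut s) 0 α)
      (h' : InFibre (cut t) 0 α), JoinSimplex.left (X := X) (Y := Y) s α h =
        JoinSimplex.left (X := X) (Y := Y) t α h')
    (hr : ∀ {m : SimplexCategory} (α : m ⟶ k) (h : InFibre (cut s) 1 α)
      (h' : InFibre (cut t) 1 α), JoinSimplex.right (X := X) (Y := Y) s α h =
        JoinSimplex.right (X := X) (Y := Y) t α h') : s = t :=
  JoinSimplex.ext (SimplexCategory.Hom.ext _ _ (OrderHom.ext _ _ (funext h))) hl hr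

theorem left_congr (s : JoinSimplex X Y k) {m : SimplexCategory} {α β : m ⟶ k}
    (h : InFibre s.cut 0 α) (e : ∀ v, α.toOrderHom v = β.toOrderHom v) :
    s.left α h = s.left β (by
      obtain rfl : α = β := SimplexCategory.Hom.ext _ _ (OrderHom.ext _ _ (funext e))
      exact h) := by
  obtain rfl : α = β := SimplexCategory.Hom.ext _ _ (OrderHom.ext _ _ (funext e))
  rfl

theorem right_congr (s : JoinSimplex X Y k) {m : SimplexCategory} {α β : m ⟶ k}
    (h : InFibre s.cut 1 α) (e : ∀ v, α.toOrderHom v = β.toOrderHom v) :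
    s.right α h = s.right β (by
      obtain rfl : α = β := SimplexCategory.Hom.ext _ _ (OrderHom.ext _ _ (funext e))
      exact h) := by
  obtain rfl : α = β := SimplexCategory.Hom.ext _ _ (OrderHom.ext _ _ (funext e))
  rfl

/-- Restrictions of a simplex of `X ⋆ Δ⁰` along operators which agree on the side of `X`. -/
theorem map_congr_left (s : (join X pt).obj (op l)) {α β : k ⟶ l}
    (h : ∀ v, cutAt s (α.toOrderHom v) = cutAt s (β.toOrderHom v))
    (h' : ∀ v, cutAt s (α.toOrderHom v) = 0 → α.toOrderHom v = β.toOrderHom v) :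
    (join X pt).map α.op s = (join X pt).map β.op s := by
  refine join_ext h (fun γ hγ hγ' => ?_) (fun _ _ _ => Subsingleton.elim _ _)
  exact left_congr (X := X) (Y := pt) s (α := γ ≫ α) (β := γ ≫ β) hγ fun v => h' _ (hγ v)

/-- Restrictions of a simplex of `Δ⁰ ⋆ Y` along operators which agree on the side of `Y`. -/
theorem map_congr_right (s : (join pt Y).obj (op l)) {α β : k ⟶ l}
    (h : ∀ v, cutAt s (α.toOrderHom v) = cutAt s (β.toOrderHom v))
    (h' : ∀ v, cutAt s (α.toOrderHom v) = 1 → α.toOrderHom v = β.toOrderHom v) :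
    (join pt Y).map α.op s = (join pt Y).map β.op s := by
  refine join_ext h (fun _ _ _ => Subsingleton.elim _ _) (fun γ hγ hγ' => ?_)
  exact right_congr (X := pt) (Y := Y) s (α := γ ≫ α) (β := γ ≫ β) hγ fun v => h' _ (hγ v)

variable (X Y) in
/-- The map `X ⋆ !`. -/
abbrev collapseRight : join X Y ⟶ join X pt := joinMap (𝟙 X) (toPt Y)

variable (X Y) in
/-- The map `! ⋆ Y`. -/
abbrev collapseLeft : join X Y ⟶ join pt Y := joinMap (toPt X) (𝟙 Y)

theorem left_eq_of_eq {s t : JoinSimplex X Y k} (e : s = t) {m : SimplexCategory} (α : m ⟶ k)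
    (h : InFibre s.cut 0 α) (h' : InFibre t.cut 0 α) : s.left α h = t.left α h' := by
  subst e
  rfl

theorem right_eq_of_eq {s t : JoinSimplex X Y k} (e : s = t) {m : SimplexCategory} (α : m ⟶ k)
    (h : InFibre s.cut 1 α) (h' : InFibre t.cut 1 α) : s.right α h = t.right α h' := by
  subst e
  rfl

/-- A simplex of `X ⋆ Y` is determined by its images in `X ⋆ Δ⁰` and `Δ⁰ ⋆ Y`. -/
theorem join_ext_collapse {s t : (join X Y).obj (op k)}
    (h : (collapseRight X Y).app _ s = (collapseRight X Y).app _ t)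
    (h' : (collapseLeft X Y).app _ s = (collapseLeft X Y).app _ t) : s = t := by
  refine join_ext (fun v => congrArg (fun r : (join X pt).obj (op k) => cutAt r v) h) (fun α hα hα' => ?_)
    (fun α hα hα' => ?_)
  · exact left_eq_of_eq (X := X) (Y := pt) h α hα hα'
  · exact right_eq_of_eq (X := pt) (Y := Y) h' α hα hα'

/-- The simplex of `X ⋆ Y` with given images in `X ⋆ Δ⁰` and `Δ⁰ ⋆ Y`. -/
def combine (s : (join X pt).obj (op k)) (t : (join pt Y).obj (op k)) (h : cut s = cut t) :
    (join X Y).obj (op k) :=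
  show JoinSimplex X Y k from
  { cut := cut s
    left := fun α hα => JoinSimplex.left (X := X) (Y := pt) s α hα
    right := fun α hα => JoinSimplex.right (X := pt) (Y := Y) t α
      (fun i => (congrArg (fun c => (α ≫ c).toOrderHom i) h).symm.trans (hα i))
    left_map := fun β α hα => JoinSimplex.left_map (X := X) (Y := pt) s β α hα
    right_map := fun β α _ => JoinSimplex.right_map (X := pt) (Y := Y) t β α _ }

theorem collapseRight_combine (s : (join X pt).obj (op k)) (t : (join pt Y).obj (op k))
    (h : cut s = cut t) : (collapseRight X Y).app _ (combine s t h) = s :=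
  join_ext (fun _ => rfl) (fun _ _ _ => rfl) (fun _ _ _ => Subsingleton.elim _ _)

theorem collapseLeft_combine (s : (join X pt).obj (op k)) (t : (join pt Y).obj (op k))
    (h : cut s = cut t) : (collapseLeft X Y).app _ (combine s t h) = t :=
  join_ext (fun v => congrArg (fun c => c.toOrderHom v) h) (fun _ _ _ => Subsingleton.elim _ _)
    (fun _ _ _ => rfl)

theorem cut_eq_of_side_eq {X' Y' : SSet.{u}} {x : Vert (join X Y)} {y : Vert (join X' Y')}
    (h : side x = side y) : cut x = cut y := by
  refine SimplexCategory.Hom.ext _ _ (OrderHom.ext _ _ (funext fun v => ?_))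
  obtain rfl : v = 0 := Subsingleton.elim (α := Fin 1) _ _
  exact congrArg ULift.down h

/-- Vertices of `X ⋆ Y` are pairs of vertices of `X ⋆ Δ⁰` and `Δ⁰ ⋆ Y` on the same side. -/
theorem exists_vertex {x : Vert (join X pt)} {y : Vert (join pt Y)} (h : side x = side y) :
    ∃ v : Vert (join X Y),
      (collapseRight X Y).app _ v = x ∧ (collapseLeft X Y).app _ v = y :=
  ⟨combine x y (cut_eq_of_side_eq h), collapseRight_combine _ _ _, collapseLeft_combine _ _ _⟩

/-- Nothing maps into the empty fibre over `0`, so the component in `X` is vacuous, and the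
component in `Δ⁰` carries no information. -/
theorem vertex_right_unique {x y : Vert (join X pt)} (hx : side x = ⟨1⟩) (hy : side y = ⟨1⟩) :
    x = y := by
  have h := cut_eq_of_side_eq (hx.trans hy.symm)
  refine join_ext (fun v => congrArg (fun c => c.toOrderHom v) h) (fun α hα _ => ?_)
    (fun _ _ _ => Subsingleton.elim _ _)
  have h₁ : (cut x).toOrderHom (α.toOrderHom 0) = 0 := hα 0
  have h₂ : (cut x).toOrderHom 0 = 1 := congrArg ULift.down hx
  rw [Subsingleton.elim (α := Fin 1) (α.toOrderHom 0) 0, h₂] at h₁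
  exact absurd h₁.symm zero_ne_one_fin_two

theorem vertex_left_unique {x y : Vert (join pt Y)} (hx : side x = ⟨0⟩) (hy : side y = ⟨0⟩) :
    x = y := by
  have h := cut_eq_of_side_eq (hx.trans hy.symm)
  refine join_ext (fun v => congrArg (fun c => c.toOrderHom v) h)
    (fun _ _ _ => Subsingleton.elim _ _) (fun α hα _ => ?_)
  have h₁ : (cut x).toOrderHom (α.toOrderHom 0) = 1 := hα 0
  have h₂ : (cut x).toOrderHom 0 = 0 := congrArg ULift.down hx
  rw [Subsingleton.elim (α := Fin 1) (α.toOrderHom 0) 0, h₂] at h₁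
  exact absurd h₁ zero_ne_one_fin_two

end JoinSimplices

/-! ### Beads of joins -/

section Collapse

variable {X Y : SSet.{u}} {n : SimplexCategoryᵒᵖ} {k : SimplexCategory}

open Classical in
/-- The operator moving vertices on the right side of `s` at least to `j`. -/
noncomputable def pushRight (s : (join X Y).obj (op k)) (j : Fin (k.len + 1)) : k ⟶ k :=
  SimplexCategory.Hom.mk
    { toFun := fun v => if cutAt s v = 0 then v else max v j
      monotone' := fun v w h => by
        dsimp only
        split_ifs with h₁ h₂ h₂
        · exact h
        · exact h.trans (le_max_left _ _)
        · exact absurd (eq_zero_of_le (cutAt_mono s h) h₂) h₁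
        · exact max_le_max_right j h }

theorem pushRight_of_left (s : (join X Y).obj (op k)) (j v : Fin (k.len + 1))
    (h : cutAt s v = 0) : (pushRight s j).toOrderHom v = v := if_pos h

theorem pushRight_of_right (s : (join X Y).obj (op k)) {j v : Fin (k.len + 1)} (hv : v ≤ j)
    (h : cutAt s v = 1) : (pushRight s j).toOrderHom v = j :=
  (if_neg (fun h' => zero_ne_one_fin_two (h'.symm.trans h))).trans (max_eq_right hv)

/-- Right-hand vertices only move upwards, hence stay on the right, and a simplex of `X ⋆ Δ⁰` does
not distinguish between its right-hand vertices. -/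
theorem map_pushRight (s : (join X pt).obj (op k)) (j : Fin (k.len + 1)) :
    (join X pt).map (pushRight s j).op s = s := by
  have h := map_congr_left s (α := pushRight s j) (β := 𝟙 k) (fun v => ?_) (fun v hv => ?_)
  · rw [h]
    exact Functor.map_id_apply _ _ _
  · by_cases hv : cutAt s v = 0
    · rw [pushRight_of_left s j v hv]
      rfl
    · have h₁ := fin_two_of_ne_zero hv
      change _ = cutAt s v
      rw [h₁]
      refine eq_one_of_le (cutAt_mono s ?_) h₁
      exact (le_max_left v j).trans_eq (if_neg hv).symm
  · by_cases hv' : cutAt s v = 0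
    · exact pushRight_of_left s j v hv'
    · have h₁ : cutAt s v ≤ cutAt s ((pushRight s j).toOrderHom v) :=
        cutAt_mono s ((le_max_left v j).trans_eq (if_neg hv').symm)
      exact absurd (eq_zero_of_le h₁ hv) hv'

open Classical in
/-- The operator moving vertices on the left side of `s` at most to `i`. -/
noncomputable def pushLeft (s : (join X Y).obj (op k)) (i : Fin (k.len + 1)) : k ⟶ k :=
  SimplexCategory.Hom.mk
    { toFun := fun v => if cutAt s v = 1 then v else min v i
      monotone' := fun v w h => by
        dsimp only
        split_ifs with h₁ h₂ h₂
        · exact h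
        · exact absurd (eq_one_of_le (cutAt_mono s h) h₁) h₂
        · exact (min_le_left _ _).trans h
        · exact min_le_min_right i h }

theorem pushLeft_of_right (s : (join X Y).obj (op k)) (i v : Fin (k.len + 1))
    (h : cutAt s v = 1) : (pushLeft s i).toOrderHom v = v := if_pos h

theorem pushLeft_of_left (s : (join X Y).obj (op k)) {i v : Fin (k.len + 1)} (hv : i ≤ v)
    (h : cutAt s v = 0) : (pushLeft s i).toOrderHom v = i :=
  (if_neg (fun h' => zero_ne_one_fin_two (h.symm.trans h'))).trans (min_eq_right hv)

theorem map_pushLeft (s : (join pt Y).obj (op k)) (i : Fin (k.len + 1)) :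
    (join pt Y).map (pushLeft s i).op s = s := by
  have h := map_congr_right s (α := pushLeft s i) (β := 𝟙 k) (fun v => ?_) (fun v hv => ?_)
  · rw [h]
    exact Functor.map_id_apply _ _ _
  · by_cases hv : cutAt s v = 1
    · rw [pushLeft_of_right s i v hv]
      rfl
    · have h₁ := fin_two_of_ne_one hv
      change _ = cutAt s v
      rw [h₁]
      refine eq_zero_of_le (cutAt_mono s ?_) h₁
      exact (if_neg hv).trans_le (min_le_left v i)
  · by_cases hv' : cutAt s v = 1
    · exact pushLeft_of_right s i v hv'
    · have h₁ : cutAt s ((pushLeft s i).toOrderHom v) ≤ cutAt s v :=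
        cutAt_mono s ((if_neg hv').trans_le (min_le_left v i))
      exact absurd (eq_one_of_le h₁ hv) hv'

/-- Gluing along `pushRight` gives a representative in which the right-hand vertices up to `a` have
been merged into `a`. With `a` the target, the right half of a bead shrinks to one point. -/
theorem Bead.mk_pushRight {x y : Vert (join X pt)} (s : (join X pt).obj (op k))
    {i j : CohSimplex.{u} k} (f : (i ⟶[SSet.{u}] j).obj n)
    (hf : pathSet f 0 = {i.as.down, j.as.down}) (hi : vertex s i = x) (hj : vertex s j = y)
    (a : Fin (k.len + 1)) :
    ∃ (hi' : vertex s ((cohMap (pushRight s a)).obj i) = x)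
      (hj' : vertex s ((cohMap (pushRight s a)).obj j) = y),
      Bead.mk s f hf hi hj = Bead.mk s (nMap (cohMap (pushRight s a)) f)
        (pathSet_zero_cohMap _ hf) hi' hj' := by
  have h := map_pushRight s a
  refine ⟨?_, ?_, mk_eq_of_operator (pushRight s a) h fun r => (pathSet_cohMap _ f r).symm⟩
  · rw [← vertex_map, h, hi]
  · rw [← vertex_map, h, hj]

theorem Bead.mk_pushLeft {x y : Vert (join pt Y)} (s : (join pt Y).obj (op k))
    {i j : CohSimplex.{u} k} (f : (i ⟶[SSet.{u}] j).obj n)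
    (hf : pathSet f 0 = {i.as.down, j.as.down}) (hi : vertex s i = x) (hj : vertex s j = y)
    (a : Fin (k.len + 1)) :
    ∃ (hi' : vertex s ((cohMap (pushLeft s a)).obj i) = x)
      (hj' : vertex s ((cohMap (pushLeft s a)).obj j) = y),
      Bead.mk s f hf hi hj = Bead.mk s (nMap (cohMap (pushLeft s a)) f)
        (pathSet_zero_cohMap _ hf) hi' hj' := by
  have h := map_pushLeft s a
  refine ⟨?_, ?_, mk_eq_of_operator (pushLeft s a) h fun r => (pathSet_cohMap _ f r).symm⟩
  · rw [← vertex_map, h, hi]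
  · rw [← vertex_map, h, hj]

/-- Beads of `X ⋆ Δ⁰` starting at the vertex of `Δ⁰` are identities. -/
theorem Bead.isOne_of_side_right {x y : Vert (join X pt)} (b : Bead (join X pt) n x y)
    (hx : side x = ⟨1⟩) : b.IsOne := by
  obtain ⟨k, s, i, j, f, hf, rfl, rfl, rfl⟩ := b.exists_rep
  have hi : cutAt s i.as.down = 1 := congrArg ULift.down hx
  have hij := src_le_tgt f
  -- Source and target both lie on the right, so pushing to the target makes them equal.
  obtain ⟨hi', hj', h⟩ := Bead.mk_pushRight s f hf rfl rfl j.as.down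
  rw [h]
  refine isOne_mk _ _ _ _ _ (cohSimplex_ext ?_)
  exact (pushRight_of_right s hij hi).trans
    (pushRight_of_right s le_rfl (eq_one_of_le (cutAt_mono s hij) hi)).symm

/-- Beads of `Δ⁰ ⋆ Y` ending at the vertex of `Δ⁰` are identities. -/
theorem Bead.isOne_of_side_left {x y : Vert (join pt Y)} (b : Bead (join pt Y) n x y)
    (hy : side y = ⟨0⟩) : b.IsOne := by
  obtain ⟨k, s, i, j, f, hf, rfl, rfl, rfl⟩ := b.exists_rep
  have hj : cutAt s j.as.down = 0 := congrArg ULift.down hy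
  have hij := src_le_tgt f
  obtain ⟨hi', hj', h⟩ := Bead.mk_pushLeft s f hf rfl rfl i.as.down
  rw [h]
  refine isOne_mk _ _ _ _ _ (cohSimplex_ext ?_)
  exact (pushLeft_of_left s le_rfl (eq_zero_of_le (cutAt_mono s hij) hj)).trans
    (pushLeft_of_left s hij hj).symm

end Collapse

/-- The action of simplicial maps on beads. -/
def Bead.map {Z Z' : SSet.{u}} (φ : Z ⟶ Z') {n : SimplexCategoryᵒᵖ} {x y : Vert Z}
    (b : Bead Z n x y) : Bead Z' n (φ.app _ x) (φ.app _ y) :=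
  Quot.lift (fun p : PreBead Z n x y => Bead.mk (φ.app _ p.simplex) p.arrow p.pathSet_zero
      ((vertex_app φ p.simplex p.i).trans (congrArg _ p.src))
      ((vertex_app φ p.simplex p.j).trans (congrArg _ p.tgt)))
    (by
      rintro _ _ ⟨α, s, f, hf, hi, hj⟩
      exact mk_eq_of_operator α (NatTrans.naturality_apply φ α.op s).symm
        fun r => (pathSet_cohMap α f r).symm) b

theorem Bead.nMap_toHom {Z Z' : SSet.{u}} (φ : Z ⟶ Z') {n : SimplexCategoryᵒᵖ} {x y : Vert Z}
    (b : Bead Z n x y) :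
    nMap (realMap φ) (a := x) (b := y) b.toHom = (b.map φ).toHom := by
  obtain ⟨k, s, i, j, f, hf, hi, hj, rfl⟩ := b.exists_rep
  exact nMap_realMap_gen φ s f hi hj

/-- A pair of generators of the realisations of `X ⋆ Δ⁰` and `Δ⁰ ⋆ Y`, lying over a pair of
vertices of `X ⋆ Y`. -/
structure BeadPair (X Y : SSet.{u}) (n : SimplexCategoryᵒᵖ) (v w : Vert (join X Y)) where
  fst : PreBead (join X pt) n ((collapseRight X Y).app _ v) ((collapseRight X Y).app _ w)
  snd : PreBead (join pt Y) n ((collapseLeft X Y).app _ v) ((collapseLeft X Y).app _ w)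

/-! ### Assembling a bead of `X ⋆ Y` from its left and right halves. -/

namespace BeadPair

variable {X Y : SSet.{u}} {n : SimplexCategoryᵒᵖ} {v w : Vert (join X Y)}
  (P : BeadPair X Y n v w)

theorem cutAt_src :
    cutAt P.fst.simplex P.fst.i.as.down = cutAt P.snd.simplex P.snd.i.as.down :=
  (side_vertex_eq_iff _ _ _ _).1 ((congrArg side P.fst.src).trans (congrArg side P.snd.src).symm)

theorem cutAt_tgt :
    cutAt P.fst.simplex P.fst.j.as.down = cutAt P.snd.simplex P.snd.j.as.down :=
  (side_vertex_eq_iff _ _ _ _).1 ((congrArg side P.fst.tgt).trans (congrArg side P.snd.tgt).symm)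

/-- The vertices of the first generator on the left side. -/
def leftPart : Set (Fin (P.fst.dim.len + 1)) :=
  {a | a ∈ pathSet P.fst.arrow (Fin.last _) ∧ cutAt P.fst.simplex a = 0}

/-- The vertices of the second generator on the right side. -/
def rightPart : Set (Fin (P.snd.dim.len + 1)) :=
  {a | a ∈ pathSet P.snd.arrow (Fin.last _) ∧ cutAt P.snd.simplex a = 1}

/-- The vertices of the combined generator. -/
abbrev Index : Type := P.leftPart ⊕ₗ P.rightPart

theorem index_cases (z : P.Index) : (∃ a, z = Sum.inlₗ a) ∨ ∃ a, z = Sum.inrₗ a := by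
  cases z with
  | inl a => exact Or.inl ⟨a, rfl⟩
  | inr a => exact Or.inr ⟨a, rfl⟩

/-- The chain increases, so its last set contains every vertex that ever occurs; that set alone is
used to index the combined simplex. -/
theorem mem_leftPart {r : Fin (n.unop.len + 1)} {a : Fin (P.fst.dim.len + 1)}
    (h : a ∈ pathSet P.fst.arrow r) (h' : cutAt P.fst.simplex a = 0) : a ∈ P.leftPart :=
  ⟨pathSet_mono _ (Fin.le_last r) h, h'⟩

theorem mem_rightPart {r : Fin (n.unop.len + 1)} {a : Fin (P.snd.dim.len + 1)}
    (h : a ∈ pathSet P.snd.arrow r) (h' : cutAt P.snd.simplex a = 1) : a ∈ P.rightPart :=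
  ⟨pathSet_mono _ (Fin.le_last r) h, h'⟩

theorem cutAt_src_of_left (a : P.leftPart) : cutAt P.snd.simplex P.snd.i.as.down = 0 :=
  P.cutAt_src.symm.trans (eq_zero_of_le (cutAt_mono _ (le_of_mem_pathSet a.2.1)) a.2.2)

theorem cutAt_tgt_of_right (a : P.rightPart) : cutAt P.fst.simplex P.fst.j.as.down = 1 :=
  P.cutAt_tgt.trans (eq_one_of_le (cutAt_mono _ (mem_pathSet_le a.2.1)) a.2.2)

/-- The two source vertices lie on the same side, so exactly one of them survives into the combined
index set. The two implications record which one without a case distinction in the definition of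
`source`. -/
theorem exists_source : ∃ z : P.Index,
    (∀ h : P.fst.i.as.down ∈ P.leftPart, z = Sum.inlₗ ⟨P.fst.i.as.down, h⟩) ∧
    ∀ h : P.snd.i.as.down ∈ P.rightPart, z = Sum.inrₗ ⟨P.snd.i.as.down, h⟩ := by
  by_cases hi : cutAt P.fst.simplex P.fst.i.as.down = 0
  · refine ⟨Sum.inlₗ ⟨_, P.mem_leftPart (left_mem_pathSet _ 0) hi⟩, fun _ => rfl, fun h => ?_⟩
    exact absurd ((P.cutAt_src.symm.trans hi).symm.trans h.2) zero_ne_one_fin_two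
  · have hi' := P.cutAt_src.symm.trans (fin_two_of_ne_zero hi)
    exact ⟨Sum.inrₗ ⟨_, P.mem_rightPart (left_mem_pathSet _ 0) hi'⟩, fun h => absurd h.2 hi,
      fun _ => rfl⟩

theorem exists_target : ∃ z : P.Index,
    (∀ h : P.fst.j.as.down ∈ P.leftPart, z = Sum.inlₗ ⟨P.fst.j.as.down, h⟩) ∧
    ∀ h : P.snd.j.as.down ∈ P.rightPart, z = Sum.inrₗ ⟨P.snd.j.as.down, h⟩ := by
  by_cases hi : cutAt P.fst.simplex P.fst.j.as.down = 0
  · refine ⟨Sum.inlₗ ⟨_, P.mem_leftPart (right_mem_pathSet _ 0) hi⟩, fun _ => rfl, fun h => ?_⟩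
    exact absurd ((P.cutAt_tgt.symm.trans hi).symm.trans h.2) zero_ne_one_fin_two
  · have hi' := P.cutAt_tgt.symm.trans (fin_two_of_ne_zero hi)
    exact ⟨Sum.inrₗ ⟨_, P.mem_rightPart (right_mem_pathSet _ 0) hi'⟩, fun h => absurd h.2 hi,
      fun _ => rfl⟩

/-- The first vertex of the combined generator. -/
noncomputable def source : P.Index := P.exists_source.choose

/-- The last vertex of the combined generator. -/
noncomputable def target : P.Index := P.exists_target.choose

theorem source_cases :
    (∃ h, P.source = Sum.inlₗ ⟨P.fst.i.as.down, h⟩) ∨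
      ∃ h, P.source = Sum.inrₗ ⟨P.snd.i.as.down, h⟩ := by
  by_cases hi : cutAt P.fst.simplex P.fst.i.as.down = 0
  · exact Or.inl ⟨_, P.exists_source.choose_spec.1 (P.mem_leftPart (left_mem_pathSet _ 0) hi)⟩
  · exact Or.inr ⟨_, P.exists_source.choose_spec.2 (P.mem_rightPart (left_mem_pathSet _ 0)
      (P.cutAt_src.symm.trans (fin_two_of_ne_zero hi)))⟩

theorem target_cases :
    (∃ h, P.target = Sum.inlₗ ⟨P.fst.j.as.down, h⟩) ∨
      ∃ h, P.target = Sum.inrₗ ⟨P.snd.j.as.down, h⟩ := by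
  by_cases hi : cutAt P.fst.simplex P.fst.j.as.down = 0
  · exact Or.inl ⟨_, P.exists_target.choose_spec.1 (P.mem_leftPart (right_mem_pathSet _ 0) hi)⟩
  · exact Or.inr ⟨_, P.exists_target.choose_spec.2 (P.mem_rightPart (right_mem_pathSet _ 0)
      (P.cutAt_tgt.symm.trans (fin_two_of_ne_zero hi)))⟩

/-- The subsets underlying the combined generator. -/
def chain (r : Fin (n.unop.len + 1)) : Set P.Index :=
  {z | Sum.elim (fun a : P.leftPart => a.1 ∈ pathSet P.fst.arrow r)
    (fun a : P.rightPart => a.1 ∈ pathSet P.snd.arrow r) (ofLex z)}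

theorem chain_mono : Monotone P.chain := by
  intro r r' h z hz
  rcases P.index_cases z with ⟨a, rfl⟩ | ⟨a, rfl⟩
  · exact pathSet_mono _ h hz
  · exact pathSet_mono _ h hz

theorem source_mem_chain (r : Fin (n.unop.len + 1)) : P.source ∈ P.chain r := by
  rcases P.source_cases with ⟨h, e⟩ | ⟨h, e⟩ <;> rw [e]
  · exact left_mem_pathSet P.fst.arrow r
  · exact left_mem_pathSet P.snd.arrow r

theorem target_mem_chain (r : Fin (n.unop.len + 1)) : P.target ∈ P.chain r := by
  rcases P.target_cases with ⟨h, e⟩ | ⟨h, e⟩ <;> rw [e]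
  · exact right_mem_pathSet P.fst.arrow r
  · exact right_mem_pathSet P.snd.arrow r

theorem source_le (z : P.Index) : P.source ≤ z := by
  rcases P.source_cases with ⟨h, e⟩ | ⟨h, e⟩ <;> rw [e] <;>
    rcases P.index_cases z with ⟨a, rfl⟩ | ⟨a, rfl⟩
  · exact Sum.Lex.inl_le_inl_iff.2 (le_of_mem_pathSet (f := P.fst.arrow) a.2.1)
  · exact Sum.Lex.inl_le_inr _ _
  -- A vertex in the left part forces the source to lie on the left.
  · exact absurd ((P.cutAt_src_of_left a).symm.trans h.2) zero_ne_one_fin_two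
  · exact Sum.Lex.inr_le_inr_iff.2 (le_of_mem_pathSet (f := P.snd.arrow) a.2.1)

theorem le_target (z : P.Index) : z ≤ P.target := by
  rcases P.target_cases with ⟨h, e⟩ | ⟨h, e⟩ <;> rw [e] <;>
    rcases P.index_cases z with ⟨a, rfl⟩ | ⟨a, rfl⟩
  · exact Sum.Lex.inl_le_inl_iff.2 (mem_pathSet_le (f := P.fst.arrow) a.2.1)
  · exact absurd (h.2.symm.trans (P.cutAt_tgt_of_right a)) zero_ne_one_fin_two
  · exact Sum.Lex.inl_le_inr _ _
  · exact Sum.Lex.inr_le_inr_iff.2 (mem_pathSet_le (f := P.snd.arrow) a.2.1)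

/-- The bottom set keeps the left-hand endpoints of the first generator and the right-hand endpoints
of the second. A kept source is `source` and a kept target is `target`, so the combined arrow again
has only its endpoints at the bottom. -/
theorem chain_zero : P.chain 0 = {P.source, P.target} := by
  refine Set.Subset.antisymm (fun z hz => ?_)
    (Set.pair_subset (P.source_mem_chain 0) (P.target_mem_chain 0))
  rcases P.index_cases z with ⟨⟨a, ha⟩, rfl⟩ | ⟨⟨a, ha⟩, rfl⟩
  · have hz : a ∈ pathSet P.fst.arrow 0 := hz
    rw [P.fst.pathSet_zero] at hz
    rcases hz with rfl | rfl
    · exact Or.inl (P.exists_source.choose_spec.1 ha).symm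
    · exact Or.inr (P.exists_target.choose_spec.1 ha).symm
  · have hz : a ∈ pathSet P.snd.arrow 0 := hz
    rw [P.snd.pathSet_zero] at hz
    rcases hz with rfl | rfl
    · exact Or.inl (P.exists_source.choose_spec.2 ha).symm
    · exact Or.inr (P.exists_target.choose_spec.2 ha).symm

/-- The order preserving map from the vertices of the combined generator to those of the first. -/
def toFst : P.Index →o Fin (P.fst.dim.len + 1) where
  toFun z := Sum.elim (fun a : P.leftPart => a.1) (fun _ => P.fst.j.as.down) (ofLex z)
  monotone' z z' h := by
    rcases P.index_cases z with ⟨a, rfl⟩ | ⟨a, rfl⟩ <;>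
      rcases P.index_cases z' with ⟨a', rfl⟩ | ⟨a', rfl⟩
    · exact (Sum.Lex.inl_le_inl_iff.1 h : a ≤ a')
    · exact mem_pathSet_le (f := P.fst.arrow) a.2.1
    · exact absurd h Sum.Lex.not_inr_le_inl
    · exact le_rfl

/-- The order preserving map from the vertices of the combined generator to those of the second. -/
def toSnd : P.Index →o Fin (P.snd.dim.len + 1) where
  toFun z := Sum.elim (fun _ => P.snd.i.as.down) (fun a : P.rightPart => a.1) (ofLex z)
  monotone' z z' h := by
    rcases P.index_cases z with ⟨a, rfl⟩ | ⟨a, rfl⟩ <;>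
      rcases P.index_cases z' with ⟨a', rfl⟩ | ⟨a', rfl⟩
    · exact le_rfl
    · exact le_of_mem_pathSet (f := P.snd.arrow) a'.2.1
    · exact absurd h Sum.Lex.not_inr_le_inl
    · exact (Sum.Lex.inr_le_inr_iff.1 h : a ≤ a')

theorem cutAt_toFst_inl (a : P.leftPart) : cutAt P.fst.simplex (P.toFst (Sum.inlₗ a)) = 0 := a.2.2

theorem cutAt_toFst_inr (a : P.rightPart) : cutAt P.fst.simplex (P.toFst (Sum.inrₗ a)) = 1 :=
  P.cutAt_tgt_of_right a

theorem cutAt_toSnd_inl (a : P.leftPart) : cutAt P.snd.simplex (P.toSnd (Sum.inlₗ a)) = 0 :=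
  P.cutAt_src_of_left a

theorem cutAt_toSnd_inr (a : P.rightPart) : cutAt P.snd.simplex (P.toSnd (Sum.inrₗ a)) = 1 := a.2.2

/-- `toFst` sends the whole right part to the target of the first generator and `toSnd` sends the
whole left part to the source of the second. These lie on the correct sides, so the two restricted
simplices have the same cut and can be combined. -/
theorem cutAt_toFst (z : P.Index) :
    cutAt P.fst.simplex (P.toFst z) = cutAt P.snd.simplex (P.toSnd z) := by
  rcases P.index_cases z with ⟨a, rfl⟩ | ⟨a, rfl⟩
  · exact (P.cutAt_toFst_inl a).trans (P.cutAt_toSnd_inl a).symm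
  · exact (P.cutAt_toFst_inr a).trans (P.cutAt_toSnd_inr a).symm

noncomputable instance : Fintype P.Index :=
  have : Finite (P.leftPart ⊕ P.rightPart) := inferInstance
  have : Finite P.Index := this
  Fintype.ofFinite _

/-- The dimension of the combined generator. -/
noncomputable def dim : SimplexCategory := SimplexCategory.mk (Fintype.card P.Index - 1)

/-- The numbering of the vertices of the combined generator. -/
noncomputable def iso : Fin (P.dim.len + 1) ≃o P.Index :=
  Fintype.orderIsoFinOfCardEq P.Index
    -- The index set contains `source`, so the subtraction of `1` in `dim` is not truncated.
    (Nat.sub_add_cancel (Fintype.card_pos_iff.2 ⟨P.source⟩)).symm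

/-- The simplicial operator given by an order preserving map out of the vertices of the combined
generator. -/
noncomputable def operator {k : SimplexCategory} (h : P.Index →o Fin (k.len + 1)) : P.dim ⟶ k :=
  SimplexCategory.Hom.mk (h.comp P.iso.toOrderEmbedding.toOrderHom)

theorem operator_apply {k : SimplexCategory} (h : P.Index →o Fin (k.len + 1))
    (a : Fin (P.dim.len + 1)) : (P.operator h).toOrderHom a = h (P.iso a) := rfl

/-- The simplex of the combined generator. -/
noncomputable def simplex : (join X Y).obj (op P.dim) :=
  combine ((join X pt).map (P.operator P.toFst).op P.fst.simplex)
    ((join pt Y).map (P.operator P.toSnd).op P.snd.simplex)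
    (SimplexCategory.Hom.ext _ _ (OrderHom.ext _ _ (funext fun a => P.cutAt_toFst (P.iso a))))

theorem collapseRight_simplex : (collapseRight X Y).app _ P.simplex =
    (join X pt).map (P.operator P.toFst).op P.fst.simplex := collapseRight_combine _ _ _

theorem collapseLeft_simplex : (collapseLeft X Y).app _ P.simplex =
    (join pt Y).map (P.operator P.toSnd).op P.snd.simplex := collapseLeft_combine _ _ _

/-- The arrow of the combined generator. -/
noncomputable def arrow :
    ((⟨⟨P.iso.symm P.source⟩⟩ : CohSimplex.{u} P.dim) ⟶[SSet.{u}]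
      (⟨⟨P.iso.symm P.target⟩⟩ : CohSimplex.{u} P.dim)).obj n :=
  ofPathSet _ _ (fun r => P.iso ⁻¹' P.chain r) (fun _ _ h => Set.preimage_mono (P.chain_mono h))
    (fun r => (congrArg (· ∈ P.chain r) (P.iso.apply_symm_apply _)).mpr (P.source_mem_chain r))
    (fun r => (congrArg (· ∈ P.chain r) (P.iso.apply_symm_apply _)).mpr (P.target_mem_chain r))
    (fun _ _ _ => ⟨P.iso.symm_apply_le.2 (P.source_le _), P.iso.le_symm_apply.2 (P.le_target _)⟩)

theorem pathSet_arrow (r : Fin (n.unop.len + 1)) :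
    pathSet P.arrow r = P.iso ⁻¹' P.chain r := rfl

theorem pathSet_arrow_zero :
    pathSet P.arrow 0 = {P.iso.symm P.source, P.iso.symm P.target} := by
  rw [pathSet_arrow, chain_zero]
  ext a
  constructor
  · rintro (h | h)
    · exact Or.inl (P.iso.eq_symm_apply.2 h)
    · exact Or.inr (P.iso.eq_symm_apply.2 h)
  · rintro (h | h)
    · exact Or.inl (P.iso.eq_symm_apply.1 h)
    · exact Or.inr (P.iso.eq_symm_apply.1 h)

theorem image_pathSet_arrow {k : SimplexCategory} (h : P.Index →o Fin (k.len + 1))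
    (r : Fin (n.unop.len + 1)) :
    (P.operator h).toOrderHom '' pathSet P.arrow r = h '' P.chain r := by
  ext b
  constructor
  · rintro ⟨a, ha, rfl⟩
    exact ⟨P.iso a, ha, rfl⟩
  · rintro ⟨z, hz, rfl⟩
    obtain ⟨a, rfl⟩ := P.iso.surjective z
    exact ⟨a, hz, rfl⟩

theorem vertex_simplex (z : P.Index) {x : Vert (join X Y)}
    (h₁ : vertex P.fst.simplex ⟨⟨P.toFst z⟩⟩ = (collapseRight X Y).app _ x)
    (h₂ : vertex P.snd.simplex ⟨⟨P.toSnd z⟩⟩ = (collapseLeft X Y).app _ x) :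
    vertex P.simplex ⟨⟨P.iso.symm z⟩⟩ = x := by
  refine join_ext_collapse ?_ ?_
  · rw [← vertex_app, collapseRight_simplex, vertex_map, ← h₁]
    refine congrArg _ (cohSimplex_ext ?_)
    rw [cohMap_obj_down, operator_apply, OrderIso.apply_symm_apply]
  · rw [← vertex_app, collapseLeft_simplex, vertex_map, ← h₂]
    refine congrArg _ (cohSimplex_ext ?_)
    rw [cohMap_obj_down, operator_apply, OrderIso.apply_symm_apply]

theorem vertex_source : vertex P.simplex ⟨⟨P.iso.symm P.source⟩⟩ = v := by
  refine P.vertex_simplex _ ?_ ?_ <;> rcases P.source_cases with ⟨h, e⟩ | ⟨h, e⟩ <;> rw [e]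
  · exact P.fst.src
  -- Here the source lies on the right and `toFst` sends it to the target of the first generator; no
  -- harm is done, as `X ⋆ Δ⁰` has only one vertex over `1`.
  · refine vertex_right_unique ?_ ?_
    · exact congrArg ULift.up (P.cutAt_toFst_inr ⟨_, h⟩)
    · exact (congrArg side P.snd.src).symm.trans (congrArg ULift.up h.2)
  · exact P.snd.src
  · exact P.snd.src

theorem vertex_target : vertex P.simplex ⟨⟨P.iso.symm P.target⟩⟩ = w := by
  refine P.vertex_simplex _ ?_ ?_ <;> rcases P.target_cases with ⟨h, e⟩ | ⟨h, e⟩ <;> rw [e]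
  · exact P.fst.tgt
  · exact P.fst.tgt
  -- Here the target lies on the left and `toSnd` sends it to the source of the second generator;
  -- `Δ⁰ ⋆ Y` has only one vertex over `0`.
  · refine vertex_left_unique ?_ ?_
    · exact congrArg ULift.up (P.cutAt_toSnd_inl ⟨_, h⟩)
    · exact (congrArg side P.fst.tgt).symm.trans (congrArg ULift.up h.2)
  · exact P.snd.tgt

/-- The bead of `X ⋆ Y` with given images in `X ⋆ Δ⁰` and `Δ⁰ ⋆ Y`. -/
noncomputable def bead : Bead (join X Y) n v w :=
  Bead.mk P.simplex P.arrow P.pathSet_arrow_zero P.vertex_source P.vertex_target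

variable {P}

/-- The combined bead only depends on the beads of the given generators. -/
theorem bead_congr {P' : BeadPair X Y n v w} (α : P.fst.dim ⟶ P'.fst.dim)
    (β : P.snd.dim ⟶ P'.snd.dim)
    (hα : (join X pt).map α.op P'.fst.simplex = P.fst.simplex)
    (hβ : (join pt Y).map β.op P'.snd.simplex = P.snd.simplex)
    (hα' : ∀ r, α.toOrderHom '' pathSet P.fst.arrow r = pathSet P'.fst.arrow r)
    (hβ' : ∀ r, β.toOrderHom '' pathSet P.snd.arrow r = pathSet P'.snd.arrow r) :
    P.bead = P'.bead := by
  have hcα : ∀ a, cutAt P'.fst.simplex (α.toOrderHom a) = cutAt P.fst.simplex a :=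
    fun a => congrArg (fun s : (join X pt).obj (op P.fst.dim) => cutAt s a) hα
  have hcβ : ∀ a, cutAt P'.snd.simplex (β.toOrderHom a) = cutAt P.snd.simplex a :=
    fun a => congrArg (fun s : (join pt Y).obj (op P.snd.dim) => cutAt s a) hβ
  have hl : ∀ a : P.leftPart, α.toOrderHom a.1 ∈ P'.leftPart := fun a =>
    ⟨hα' _ ▸ Set.mem_image_of_mem _ a.2.1, (hcα a.1).trans a.2.2⟩
  have hr : ∀ a : P.rightPart, β.toOrderHom a.1 ∈ P'.rightPart := fun a =>
    ⟨hβ' _ ▸ Set.mem_image_of_mem _ a.2.1, (hcβ a.1).trans a.2.2⟩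
  -- `α` and `β` respect the sides, so together they map the combined vertices of `P` to those of
  -- `P'`; this operator glues the two combined generators.
  let γ : P.Index →o P'.Index :=
    { toFun := fun z => toLex (Sum.map (fun a : P.leftPart => (⟨_, hl a⟩ : P'.leftPart))
        (fun a : P.rightPart => (⟨_, hr a⟩ : P'.rightPart)) (ofLex z))
      monotone' := by
        intro z z' h
        rcases P.index_cases z with ⟨a, rfl⟩ | ⟨a, rfl⟩ <;>
          rcases P.index_cases z' with ⟨a', rfl⟩ | ⟨a', rfl⟩
        · exact Sum.Lex.inl_le_inl_iff.2
            (α.toOrderHom.monotone (Sum.Lex.inl_le_inl_iff.1 h : a ≤ a'))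
        · exact Sum.Lex.inl_le_inr _ _
        · exact absurd h Sum.Lex.not_inr_le_inl
        · exact Sum.Lex.inr_le_inr_iff.2
            (β.toOrderHom.monotone (Sum.Lex.inr_le_inr_iff.1 h : a ≤ a')) }
  have γl : ∀ a : P.leftPart, γ (Sum.inlₗ a) = Sum.inlₗ ⟨_, hl a⟩ := fun _ => rfl
  have γr : ∀ a : P.rightPart, γ (Sum.inrₗ a) = Sum.inrₗ ⟨_, hr a⟩ := fun _ => rfl
  let δ : P.dim ⟶ P'.dim := P.operator ((P'.iso.symm.toOrderEmbedding.toOrderHom).comp γ)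
  have hδ : ∀ a, P'.iso (δ.toOrderHom a) = γ (P.iso a) := fun a => P'.iso.apply_symm_apply _
  refine Bead.mk_eq_of_operator δ (join_ext_collapse ?_ ?_) fun r => ?_
  · rw [NatTrans.naturality_apply, collapseRight_simplex, collapseRight_simplex, ← hα,
      ← Functor.map_comp_apply, ← Functor.map_comp_apply, ← op_comp, ← op_comp]
    -- On the right part only the sides have to agree, by `map_congr_left`; that `α` matches the two
    -- targets is not needed.
    have key : ∀ z : P.Index,
        cutAt P'.fst.simplex (P'.toFst (γ z)) =
          cutAt P'.fst.simplex (α.toOrderHom (P.toFst z)) ∧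
        (cutAt P'.fst.simplex (P'.toFst (γ z)) = 0 →
          P'.toFst (γ z) = α.toOrderHom (P.toFst z)) := by
      intro z
      rcases P.index_cases z with ⟨a, rfl⟩ | ⟨a, rfl⟩
      · exact ⟨rfl, fun _ => rfl⟩
      · rw [hcα, cutAt_toFst_inr, γr, cutAt_toFst_inr]
        exact ⟨rfl, fun h => absurd h.symm zero_ne_one_fin_two⟩
    refine map_congr_left _ (fun a => ?_) fun a => ?_
    · exact (congrArg (fun z => cutAt P'.fst.simplex (P'.toFst z)) (hδ a)).trans
        (key (P.iso a)).1
    · intro h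
      refine (congrArg P'.toFst (hδ a)).trans ((key (P.iso a)).2 ?_)
      rw [← hδ]
      exact h
  · rw [NatTrans.naturality_apply, collapseLeft_simplex, collapseLeft_simplex, ← hβ,
      ← Functor.map_comp_apply, ← Functor.map_comp_apply, ← op_comp, ← op_comp]
    have key : ∀ z : P.Index,
        cutAt P'.snd.simplex (P'.toSnd (γ z)) =
          cutAt P'.snd.simplex (β.toOrderHom (P.toSnd z)) ∧
        (cutAt P'.snd.simplex (P'.toSnd (γ z)) = 1 →
          P'.toSnd (γ z) = β.toOrderHom (P.toSnd z)) := by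
      intro z
      rcases P.index_cases z with ⟨a, rfl⟩ | ⟨a, rfl⟩
      · rw [hcβ, cutAt_toSnd_inl, γl, cutAt_toSnd_inl]
        exact ⟨rfl, fun h => absurd h zero_ne_one_fin_two⟩
      · exact ⟨rfl, fun _ => rfl⟩
    refine map_congr_right _ (fun a => ?_) fun a => ?_
    · exact (congrArg (fun z => cutAt P'.snd.simplex (P'.toSnd z)) (hδ a)).trans
        (key (P.iso a)).1
    · intro h
      refine (congrArg P'.toSnd (hδ a)).trans ((key (P.iso a)).2 ?_)
      rw [← hδ]
      exact h
  · have key : γ '' P.chain r = P'.chain r := by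
      ext z
      constructor
      · rintro ⟨z, hz, rfl⟩
        rcases P.index_cases z with ⟨a, rfl⟩ | ⟨a, rfl⟩
        · exact (Set.ext_iff.1 (hα' r) _).1 (Set.mem_image_of_mem _ hz)
        · exact (Set.ext_iff.1 (hβ' r) _).1 (Set.mem_image_of_mem _ hz)
      · intro hz
        rcases P'.index_cases z with ⟨⟨b, hb⟩, rfl⟩ | ⟨⟨b, hb⟩, rfl⟩
        · have hz : b ∈ pathSet P'.fst.arrow r := hz
          rw [← hα'] at hz
          obtain ⟨a, ha, rfl⟩ := hz
          exact ⟨Sum.inlₗ ⟨a, P.mem_leftPart ha ((hcα a).symm.trans hb.2)⟩, ha, rfl⟩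
        · have hz : b ∈ pathSet P'.snd.arrow r := hz
          rw [← hβ'] at hz
          obtain ⟨a, ha, rfl⟩ := hz
          exact ⟨Sum.inrₗ ⟨a, P.mem_rightPart ha ((hcβ a).symm.trans hb.2)⟩, ha, rfl⟩
    rw [image_pathSet_arrow]
    refine (Set.image_comp P'.iso.symm γ (P.chain r)).trans ?_
    rw [key]
    exact P'.iso.symm.toEquiv.image_eq_preimage_symm _

variable (P)

/-- The image is the restriction of the first simplex along `toFst`, which keeps the left-hand
vertices and merges the right-hand ones into the target. `pushRight` does the same to the first
generator. -/
theorem bead_collapseRight : P.bead.map (collapseRight X Y) =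
    Bead.mk P.fst.simplex P.fst.arrow P.fst.pathSet_zero P.fst.src P.fst.tgt := by
  obtain ⟨hi', hj', h⟩ := Bead.mk_pushRight P.fst.simplex P.fst.arrow P.fst.pathSet_zero P.fst.src
    P.fst.tgt P.fst.j.as.down
  rw [h]
  refine Bead.mk_eq_of_operator (P.operator P.toFst) P.collapseRight_simplex.symm fun r => ?_
  rw [image_pathSet_arrow, pathSet_cohMap]
  ext b
  constructor
  · rintro ⟨z, hz, rfl⟩
    rcases P.index_cases z with ⟨a, rfl⟩ | ⟨a, rfl⟩
    · exact ⟨a.1, hz, pushRight_of_left _ _ _ a.2.2⟩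
    · exact ⟨P.fst.j.as.down, right_mem_pathSet _ _,
        pushRight_of_right _ le_rfl (P.cutAt_tgt_of_right a)⟩
  · rintro ⟨a, ha, rfl⟩
    by_cases hc : cutAt P.fst.simplex a = 0
    · rw [pushRight_of_left _ _ _ hc]
      exact ⟨Sum.inlₗ ⟨a, P.mem_leftPart ha hc⟩, ha, rfl⟩
    · have hc := fin_two_of_ne_zero hc
      rw [pushRight_of_right _ (mem_pathSet_le ha) hc]
      -- A right-hand vertex in the first chain puts both targets on the right. The target of the
      -- second generator belongs to each of its sets, so it is a witness at stage `r`.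
      have hj : cutAt P.snd.simplex P.snd.j.as.down = 1 :=
        P.cutAt_tgt.symm.trans (eq_one_of_le (cutAt_mono _ (mem_pathSet_le ha)) hc)
      exact ⟨Sum.inrₗ ⟨_, P.mem_rightPart (right_mem_pathSet _ r) hj⟩,
        right_mem_pathSet P.snd.arrow r, rfl⟩

theorem bead_collapseLeft : P.bead.map (collapseLeft X Y) =
    Bead.mk P.snd.simplex P.snd.arrow P.snd.pathSet_zero P.snd.src P.snd.tgt := by
  obtain ⟨hi', hj', h⟩ := Bead.mk_pushLeft P.snd.simplex P.snd.arrow P.snd.pathSet_zero P.snd.src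
    P.snd.tgt P.snd.i.as.down
  rw [h]
  refine Bead.mk_eq_of_operator (P.operator P.toSnd) P.collapseLeft_simplex.symm fun r => ?_
  rw [image_pathSet_arrow, pathSet_cohMap]
  ext b
  constructor
  · rintro ⟨z, hz, rfl⟩
    rcases P.index_cases z with ⟨a, rfl⟩ | ⟨a, rfl⟩
    · exact ⟨P.snd.i.as.down, left_mem_pathSet _ _,
        pushLeft_of_left _ le_rfl (P.cutAt_src_of_left a)⟩
    · exact ⟨a.1, hz, pushLeft_of_right _ _ _ a.2.2⟩
  · rintro ⟨a, ha, rfl⟩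
    by_cases hc : cutAt P.snd.simplex a = 1
    · rw [pushLeft_of_right _ _ _ hc]
      exact ⟨Sum.inrₗ ⟨a, P.mem_rightPart ha hc⟩, ha, rfl⟩
    · have hc := fin_two_of_ne_one hc
      rw [pushLeft_of_left _ (le_of_mem_pathSet ha) hc]
      have hi : cutAt P.fst.simplex P.fst.i.as.down = 0 :=
        P.cutAt_src.trans (eq_zero_of_le (cutAt_mono _ (le_of_mem_pathSet ha)) hc)
      exact ⟨Sum.inlₗ ⟨_, P.mem_leftPart (left_mem_pathSet _ r) hi⟩,
        left_mem_pathSet P.fst.arrow r, rfl⟩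

end BeadPair

/-! ### Combining beads is inverse to the two collapses. -/

section Combine

variable {X Y : SSet.{u}} {n : SimplexCategoryᵒᵖ} {v w : Vert (join X Y)}

/-- The bead of `X ⋆ Y` with given images in `X ⋆ Δ⁰` and `Δ⁰ ⋆ Y`. -/
noncomputable def Bead.combine
    (b : Bead (join X pt) n ((collapseRight X Y).app _ v) ((collapseRight X Y).app _ w))
    (b' : Bead (join pt Y) n ((collapseLeft X Y).app _ v) ((collapseLeft X Y).app _ w)) :
    Bead (join X Y) n v w :=
  Quot.lift₂ (fun p q => BeadPair.bead ⟨p, q⟩)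
    (by
      rintro p _ _ ⟨β, t, g, hg, hi, hj⟩
      refine BeadPair.bead_congr (𝟙 _) β (Functor.map_id_apply _ _ _) rfl (fun r => ?_)
        (fun r => (pathSet_cohMap β g r).symm)
      exact Set.image_id _)
    (by
      rintro _ _ q ⟨α, s, f, hf, hi, hj⟩
      refine BeadPair.bead_congr α (𝟙 _) rfl (Functor.map_id_apply _ _ _)
        (fun r => (pathSet_cohMap α f r).symm) (fun r => ?_)
      exact Set.image_id _) b b'

theorem Bead.combine_map_collapseRight
    (b : Bead (join X pt) n ((collapseRight X Y).app _ v) ((collapseRight X Y).app _ w))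
    (b' : Bead (join pt Y) n ((collapseLeft X Y).app _ v) ((collapseLeft X Y).app _ w)) :
    (Bead.combine b b').map (collapseRight X Y) = b := by
  obtain ⟨p⟩ := b
  obtain ⟨q⟩ := b'
  exact BeadPair.bead_collapseRight ⟨p, q⟩

theorem Bead.combine_map_collapseLeft
    (b : Bead (join X pt) n ((collapseRight X Y).app _ v) ((collapseRight X Y).app _ w))
    (b' : Bead (join pt Y) n ((collapseLeft X Y).app _ v) ((collapseLeft X Y).app _ w)) :
    (Bead.combine b b').map (collapseLeft X Y) = b' := by
  obtain ⟨p⟩ := b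
  obtain ⟨q⟩ := b'
  exact BeadPair.bead_collapseLeft ⟨p, q⟩

/-- The two collapses of a generator share its dimension and its arrow, so the combined index set is
just the set of vertices of its last subset. The combined generator is the restriction of the
original one along the inclusion `κ`, hence is glued to it. -/
theorem Bead.combine_map (b : Bead (join X Y) n v w) :
    Bead.combine (b.map (collapseRight X Y)) (b.map (collapseLeft X Y)) = b := by
  obtain ⟨k, s, i, j, f, hf, hi, hj, rfl⟩ := b.exists_rep
  let P : BeadPair X Y n v w :=
    ⟨⟨⟨k, (collapseRight X Y).app _ s, i, j, f, (vertex_app _ s i).trans (congrArg _ hi),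
        (vertex_app _ s j).trans (congrArg _ hj)⟩, hf⟩,
      ⟨⟨k, (collapseLeft X Y).app _ s, i, j, f, (vertex_app _ s i).trans (congrArg _ hi),
        (vertex_app _ s j).trans (congrArg _ hj)⟩, hf⟩⟩
  change P.bead = _
  -- The cut is monotone, so left-hand vertices precede right-hand ones; this makes `κ` monotone for
  -- the lexicographic order.
  have hlr : ∀ (a : P.leftPart) (a' : P.rightPart), a.1 ≤ a'.1 := by
    intro a a'
    by_contra! h
    have h₁ : cutAt s a.1 = 0 := a.2.2
    have h₂ : cutAt s a.1 = 1 := eq_one_of_le (cutAt_mono s h.le) a'.2.2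
    exact zero_ne_one_fin_two (h₁.symm.trans h₂)
  let κ : P.Index →o Fin (k.len + 1) :=
    { toFun := fun z => Sum.elim (fun a : P.leftPart => a.1) (fun a : P.rightPart => a.1) (ofLex z)
      monotone' := by
        intro z z' h
        rcases P.index_cases z with ⟨a, rfl⟩ | ⟨a, rfl⟩ <;>
          rcases P.index_cases z' with ⟨a', rfl⟩ | ⟨a', rfl⟩
        · exact (Sum.Lex.inl_le_inl_iff.1 h : a ≤ a')
        · exact hlr a a'
        · exact absurd h Sum.Lex.not_inr_le_inl
        · exact (Sum.Lex.inr_le_inr_iff.1 h : a ≤ a') }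
  refine Bead.mk_eq_of_operator (P.operator κ) (join_ext_collapse ?_ ?_) fun r => ?_
  · rw [NatTrans.naturality_apply, P.collapseRight_simplex]
    have key : ∀ z : P.Index, cutAt P.fst.simplex (κ z) = cutAt P.fst.simplex (P.toFst z) ∧
        (cutAt P.fst.simplex (κ z) = 0 → κ z = P.toFst z) := by
      intro z
      rcases P.index_cases z with ⟨a, rfl⟩ | ⟨a, rfl⟩
      · exact ⟨rfl, fun _ => rfl⟩
      · rw [P.cutAt_toFst_inr]
        have h : cutAt P.fst.simplex (κ (Sum.inrₗ a)) = 1 := a.2.2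
        exact ⟨h, fun h' => absurd (h'.symm.trans h) zero_ne_one_fin_two⟩
    exact map_congr_left P.fst.simplex (fun a => (key (P.iso a)).1) fun a => (key (P.iso a)).2
  · rw [NatTrans.naturality_apply, P.collapseLeft_simplex]
    have key : ∀ z : P.Index, cutAt P.snd.simplex (κ z) = cutAt P.snd.simplex (P.toSnd z) ∧
        (cutAt P.snd.simplex (κ z) = 1 → κ z = P.toSnd z) := by
      intro z
      rcases P.index_cases z with ⟨a, rfl⟩ | ⟨a, rfl⟩
      · rw [P.cutAt_toSnd_inl]
        have h : cutAt P.snd.simplex (κ (Sum.inlₗ a)) = 0 := a.2.2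
        exact ⟨h, fun h' => absurd (h.symm.trans h') zero_ne_one_fin_two⟩
      · exact ⟨rfl, fun _ => rfl⟩
    exact map_congr_right P.snd.simplex (fun a => (key (P.iso a)).1) fun a => (key (P.iso a)).2
  · rw [BeadPair.image_pathSet_arrow]
    ext b
    constructor
    · rintro ⟨z, hz, rfl⟩
      rcases P.index_cases z with ⟨a, rfl⟩ | ⟨a, rfl⟩
      · exact hz
      · exact hz
    · intro hb
      by_cases hc : cutAt s b = 0
      · exact ⟨Sum.inlₗ ⟨b, P.mem_leftPart hb hc⟩, hb, rfl⟩
      · exact ⟨Sum.inrₗ ⟨b, P.mem_rightPart hb (fin_two_of_ne_zero hc)⟩, hb, rfl⟩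

end Combine

end SimpCat

/-! ### The fibre product is freely generated by pairs of beads -/

namespace SimpCat

theorem side_cases {X Y : SSet.{u}} (x : Vert (join X Y)) : side x = ⟨0⟩ ∨ side x = ⟨1⟩ := by
  by_cases h : (cut x).toOrderHom 0 = 0
  · exact Or.inl (congrArg ULift.up h)
  · exact Or.inr (congrArg ULift.up (fin_two_of_ne_zero h))

theorem side_zero_ne_one {X Y : SSet.{u}} {x : Vert (join X Y)} (h : side x = ⟨0⟩)
    (h' : side x = ⟨1⟩) : False :=
  zero_ne_one_fin_two (congrArg ULift.down (h.symm.trans h'))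

theorem side_le_of_hom {X Y : SSet.{u}} {n : SimplexCategoryᵒᵖ} {x y : Vert (join X Y)}
    (f : RealHom (join X Y) n x y) : (cut x).toOrderHom 0 ≤ (cut y).toOrderHom 0 :=
  have h : (show ULift.{u} (Fin 2) from side x) ≤ side y :=
    leOfHom (show (show ULift.{u} (Fin 2) from side x) ⟶ side y from (projData X Y n).lift f)
  h

theorem side_one_of_hom {X Y : SSet.{u}} {n : SimplexCategoryᵒᵖ} {x y : Vert (join X Y)}
    (f : RealHom (join X Y) n x y) (h : side x = ⟨1⟩) : side y = ⟨1⟩ :=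
  congrArg ULift.up (eq_one_of_le (side_le_of_hom f) (congrArg ULift.down h))

theorem side_zero_of_hom {X Y : SSet.{u}} {n : SimplexCategoryᵒᵖ} {x y : Vert (join X Y)}
    (f : RealHom (join X Y) n x y) (h : side y = ⟨0⟩) : side x = ⟨0⟩ :=
  congrArg ULift.up (eq_zero_of_le (side_le_of_hom f) (congrArg ULift.down h))

/-- The arrows of the realisation given by beads, including identities. -/
def IsBeadArrow {Z : SSet.{u}} {n : SimplexCategoryᵒᵖ} {x y : Level (realObj Z) n} (f : x ⟶ y) :
    Prop :=
  ∃ b : Bead Z n x.of y.of, b.toHom = f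

section FibreProduct

variable {X Y : SSet.{u}} {n : SimplexCategoryᵒᵖ}

theorem IsBeadArrow.isIdentity_or {x y : Level (realObj X) n} {f : x ⟶ y} (hf : IsBeadArrow f) :
    IsIdentity f ∨ beadArrows X n f :=
  (em (IsIdentity f)).imp id fun h => ⟨h, hf⟩

theorem isBeadArrow_id (x : Level (realObj X) n) : IsBeadArrow (𝟙 x) :=
  ⟨Bead.one x.of, Bead.toHom_one x.of⟩

theorem IsBeadArrow.isIdentity_of_right {x y : Level (realObj (join X pt)) n} {f : x ⟶ y}
    (hf : IsBeadArrow f) (hx : side x.of = ⟨1⟩) : IsIdentity f := by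
  obtain ⟨b, rfl⟩ := hf
  exact Bead.isIdentity_toHom (b.isOne_of_side_right hx)

theorem IsBeadArrow.isIdentity_of_left {x y : Level (realObj (join pt Y)) n} {f : x ⟶ y}
    (hf : IsBeadArrow f) (hy : side y.of = ⟨0⟩) : IsIdentity f := by
  obtain ⟨b, rfl⟩ := hf
  exact Bead.isIdentity_toHom (b.isOne_of_side_left hy)

/-- An arrow starting over `1` stays over `1`, so its last bead would start at the vertex of `Δ⁰`
and be trivial. -/
theorem isIdentity_of_right {x y : Level (realObj (join X pt)) n} (f : x ⟶ y)
    (hx : side x.of = ⟨1⟩) : IsIdentity f := by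
  rcases (beadArrows_isFreeOn _ n).isIdentity_or f with h | ⟨c, g, h, hh, rfl⟩
  · exact h
  · exact absurd (IsBeadArrow.isIdentity_of_right hh.2 (side_one_of_hom g hx)) hh.1

theorem isIdentity_of_left {x y : Level (realObj (join pt Y)) n} (f : x ⟶ y)
    (hy : side y.of = ⟨0⟩) : IsIdentity f := by
  rcases (beadArrows_isFreeOn _ n).isIdentity_or f with h | ⟨c, g, h, hh, rfl⟩
  · exact h
  · exact absurd (IsBeadArrow.isIdentity_of_left hh.2 hy) hh.1

variable (X Y) in
/-- The fibre product in the comparison map. -/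
abbrev joinFibre : SCat.{u} := fibProd (proj X pt) (proj pt Y)

/-- The first component of an object of the fibre product. -/
abbrev objFst (p : Level (joinFibre X Y) n) : Level (realObj (join X pt)) n := ⟨p.of.1.1⟩

/-- The second component of an object of the fibre product. -/
abbrev objSnd (p : Level (joinFibre X Y) n) : Level (realObj (join pt Y)) n := ⟨p.of.1.2⟩

/-- The first component of an arrow of the fibre product. -/
abbrev homFst {p q : Level (joinFibre X Y) n} (f : p ⟶ q) : objFst p ⟶ objFst q :=
  (levelMap (fibFst (proj X pt) (proj pt Y)) n).map f

/-- The second component of an arrow of the fibre product. -/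
abbrev homSnd {p q : Level (joinFibre X Y) n} (f : p ⟶ q) : objSnd p ⟶ objSnd q :=
  (levelMap (fibSnd (proj X pt) (proj pt Y)) n).map f

/-- An arrow of the fibre product from its components. -/
def fibHomMk {p q : Level (joinFibre X Y) n} (f : objFst p ⟶ objFst q) (g : objSnd p ⟶ objSnd q) :
    p ⟶ q :=
  show { t : (p.of.1.1 ⟶[SSet.{u}] q.of.1.1).obj n × (p.of.1.2 ⟶[SSet.{u}] q.of.1.2).obj n //
    HEq (nMap (proj X pt) t.1) (nMap (proj pt Y) t.2) } from
  ⟨(f, g), arrowCat_heq p.of.2 q.of.2 _ _⟩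

theorem fibHom_ext {p q : Level (joinFibre X Y) n} {f g : p ⟶ q} (h : homFst f = homFst g)
    (h' : homSnd f = homSnd g) : f = g :=
  Subtype.ext (Prod.ext h h')

theorem fibObj_ext {p q : Level (joinFibre X Y) n} (h : objFst p = objFst q)
    (h' : objSnd p = objSnd q) : p = q := by
  obtain ⟨⟨⟨p₁, p₂⟩, hp⟩⟩ := p
  obtain ⟨⟨⟨q₁, q₂⟩, hq⟩⟩ := q
  obtain rfl : p₁ = q₁ := congrArg Level.of h
  obtain rfl : p₂ = q₂ := congrArg Level.of h'
  rfl

theorem side_objSnd (p : Level (joinFibre X Y) n) : side (objSnd p).of = side (objFst p).of :=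
  p.of.2.symm

theorem isIdentity_fib {p q : Level (joinFibre X Y) n} {f : p ⟶ q} (h : IsIdentity (homFst f))
    (h' : IsIdentity (homSnd f)) : IsIdentity f := by
  obtain rfl : p = q := fibObj_ext h.1 h'.1
  exact ⟨rfl, fibHom_ext h.2 h'.2⟩

theorem isIdentity_homFst {p q : Level (joinFibre X Y) n} {f : p ⟶ q} (h : IsIdentity f) :
    IsIdentity (homFst f) := by
  obtain ⟨rfl, rfl⟩ := h
  exact isIdentity_id _

theorem isIdentity_homSnd {p q : Level (joinFibre X Y) n} {f : p ⟶ q} (h : IsIdentity f) :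
    IsIdentity (homSnd f) := by
  obtain ⟨rfl, rfl⟩ := h
  exact isIdentity_id _

variable (X Y n) in
/-- The non-identity arrows of the fibre product whose components are given by beads. -/
def fibBeadArrows : MorphismProperty (Level (joinFibre X Y) n) := fun _ _ f =>
  ¬ IsIdentity f ∧ IsBeadArrow (homFst f) ∧ IsBeadArrow (homSnd f)

/-- Were the second component an identity, the source would also lie over `1`, and the first
component would start at the vertex of `Δ⁰` and be an identity as well. -/
theorem fibBeadArrows_snd {p q : Level (joinFibre X Y) n} {f : p ⟶ q} (hf : fibBeadArrows X Y n f)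
    (hq : side (objSnd q).of = ⟨1⟩) : ¬ IsIdentity (homSnd f) := by
  intro h
  have hp : side (objSnd p).of = ⟨1⟩ := by rw [h.1, hq]
  exact hf.1 (isIdentity_fib
    (hf.2.1.isIdentity_of_right ((side_objSnd p).symm.trans hp)) h)

/-- Over a target on the right, the second component decides through its source whether the first is
trivial. This lets cancellation in the second component be carried out first and then drive the
other. -/
theorem fibBeadArrows_fst_iff {p q : Level (joinFibre X Y) n} {f : p ⟶ q}
    (hf : fibBeadArrows X Y n f) (hq : side (objSnd q).of = ⟨1⟩) :
    IsIdentity (homFst f) ↔ side (objSnd p).of = ⟨1⟩ := by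
  constructor
  · intro h
    rw [side_objSnd, h.1, ← side_objSnd, hq]
  · intro hp
    exact hf.2.1.isIdentity_of_right ((side_objSnd p).symm.trans hp)

theorem fib_cancel {p q r r' : Level (joinFibre X Y) n} {g : p ⟶ r} {f : r ⟶ q} {g' : p ⟶ r'}
    {f' : r' ⟶ q}
    (h : objFst r = objFst r' ∧ HEq (homFst g) (homFst g') ∧ HEq (homFst f) (homFst f'))
    (h' : objSnd r = objSnd r' ∧ HEq (homSnd g) (homSnd g') ∧ HEq (homSnd f) (homSnd f')) :
    r = r' ∧ HEq g g' ∧ HEq f f' := by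
  obtain rfl := fibObj_ext h.1 h'.1
  exact ⟨rfl, heq_of_eq (fibHom_ext (eq_of_heq h.2.1) (eq_of_heq h'.2.1)),
    heq_of_eq (fibHom_ext (eq_of_heq h.2.2) (eq_of_heq h'.2.2))⟩

theorem fibBeadArrows_isFreeOn (X Y : SSet.{u}) (n : SimplexCategoryᵒᵖ) :
    IsFreeOn (fibBeadArrows X Y n) where
  not_isIdentity {p q r} g f hf h := by
    refine hf.1 (isIdentity_fib ?_ ?_)
    · exact ((beadArrows_isFreeOn _ n).isIdentity_of_comp (homFst g) (homFst f)
        (isIdentity_homFst h)).2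
    · exact ((beadArrows_isFreeOn _ n).isIdentity_of_comp (homSnd g) (homSnd f)
        (isIdentity_homSnd h)).2
  cancel {p q r r' g f g' f'} hf hf' e := by
    have e₁ : homFst g ≫ homFst f = homFst g' ≫ homFst f' := congrArg homFst e
    have e₂ : homSnd g ≫ homSnd f = homSnd g' ≫ homSnd f' := congrArg homSnd e
    -- In each component, cancellation awaits a proof `H` that the two last factors are identities
    -- simultaneously.
    have c₁ := fun H => (beadArrows_isFreeOn _ n).cancel_of_iff hf.2.1.isIdentity_or
      hf'.2.1.isIdentity_or H e₁
    have c₂ := fun H => (beadArrows_isFreeOn _ n).cancel_of_iff hf.2.2.isIdentity_or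
      hf'.2.2.isIdentity_or H e₂
    rcases side_cases (objSnd q).of with hq | hq
    · have i₂ := hf.2.2.isIdentity_of_left hq
      have i₂' := hf'.2.2.isIdentity_of_left hq
      exact fib_cancel (c₁ (iff_of_false (fun h => hf.1 (isIdentity_fib h i₂))
        (fun h => hf'.1 (isIdentity_fib h i₂')))) (c₂ (iff_of_true i₂ i₂'))
    · have d₂ := c₂ (iff_of_false (fibBeadArrows_snd hf hq) (fibBeadArrows_snd hf' hq))
      refine fib_cancel (c₁ ?_) d₂
      rw [fibBeadArrows_fst_iff hf hq, fibBeadArrows_fst_iff hf' hq, d₂.1]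
  exists_length := by
    obtain ⟨len₁, h₁⟩ := (beadArrows_isFreeOn (join X pt) n).exists_length
    obtain ⟨len₂, h₂⟩ := (beadArrows_isFreeOn (join pt Y) n).exists_length
    refine ⟨fun f => len₁ (homFst f) + len₂ (homSnd f), fun {p q} f => ?_⟩
    rcases side_cases (objSnd q).of with hq | hq
    -- Everything lies over `0`: the last bead of the first component is paired with an identity.
    · have i₂ := isIdentity_of_left (homSnd f) hq
      rcases h₁ (homFst f) with i₁ | ⟨c, g, h, hh, e, hl⟩
      · exact Or.inl (isIdentity_fib i₁ i₂)
      · have hc : side c.of = side (objSnd q).of := by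
          rw [hq]
          exact side_zero_of_hom h ((side_objSnd q).symm.trans hq)
        refine Or.inr ⟨⟨⟨(c.of, q.of.1.2), hc⟩⟩, fibHomMk g (homSnd (q := q) f), fibHomMk h (𝟙 _),
          ⟨fun i => hh.1 (isIdentity_homFst i), hh.2, isBeadArrow_id _⟩,
          fibHom_ext e (show homSnd f ≫ 𝟙 (objSnd q) = homSnd f from Category.comp_id _), ?_⟩
        exact Nat.add_lt_add_right hl _
    · rcases h₂ (homSnd f) with i₂ | ⟨c, g, h, hh, e, hl⟩
      · refine Or.inl (isIdentity_fib (isIdentity_of_right _ ?_) i₂)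
        rw [← side_objSnd, i₂.1, hq]
      · rcases side_cases c.of with hc | hc
        -- The last bead of the second component crosses from `0` to `1`. Then `f` crosses too, so
        -- its first component is not an identity, and the two last beads are paired.
        · have i₁ : ¬ IsIdentity (homFst f) := by
            intro i
            have hp : side (objSnd p).of = ⟨0⟩ := side_zero_of_hom g hc
            rw [side_objSnd, i.1, ← side_objSnd] at hp
            exact side_zero_ne_one hp hq
          obtain ⟨c₁, g₁, h₁, hh₁, e₁, hl₁⟩ := (h₁ (homFst f)).resolve_left i₁
          -- A bead starting over `1` would be trivial, so the last bead of the first component also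
          -- crosses and the two sources form an object of the fibre product.
          have hc₁ : side c₁.of = ⟨0⟩ := (side_cases c₁.of).resolve_right fun hc₁ =>
            hh₁.1 (IsBeadArrow.isIdentity_of_right hh₁.2 hc₁)
          refine Or.inr ⟨⟨⟨(c₁.of, c.of), hc₁.trans hc.symm⟩⟩, fibHomMk g₁ g, fibHomMk h₁ h,
            ⟨fun i => hh.1 (isIdentity_homSnd i), hh₁.2, hh.2⟩, fibHom_ext e₁ e, ?_⟩
          exact Nat.add_lt_add hl₁ hl
        -- The last bead of the second component lies over `1`, so it is paired with an identity.
        · have hc' : side q.of.1.1 = side c.of :=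
            (side_objSnd q).symm.trans (hq.trans hc.symm)
          refine Or.inr ⟨⟨⟨(q.of.1.1, c.of), hc'⟩⟩, fibHomMk (homFst (q := q) f) g, fibHomMk (𝟙 _) h,
            ⟨fun i => hh.1 (isIdentity_homSnd i), isBeadArrow_id _, hh.2⟩,
            fibHom_ext (show homFst f ≫ 𝟙 (objFst q) = homFst f from Category.comp_id _) e, ?_⟩
          exact Nat.add_lt_add_left hl _

end FibreProduct

/-! ### The comparison map is bijective -/

section Comparison

variable (X Y : SSet.{u}) (n : SimplexCategoryᵒᵖ)

theorem comparison_obj_bijective : Function.Bijective (comparison X Y).obj := by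
  constructor
  · intro v w h
    have h := congrArg Subtype.val h
    exact join_ext_collapse (congrArg Prod.fst h) (congrArg Prod.snd h)
  · rintro ⟨⟨x, y⟩, h⟩
    obtain ⟨v, rfl, rfl⟩ := exists_vertex (x := x) (y := y) h
    exact ⟨v, rfl⟩

/-- The comparison map on `n`-arrows. -/
abbrev levelComparison : Level (realObj (join X Y)) n ⥤ Level (joinFibre X Y) n :=
  levelMap (comparison X Y) n

theorem levelComparison_obj_bijective : Function.Bijective (levelComparison X Y n).obj := by
  constructor
  · rintro ⟨v⟩ ⟨w⟩ h
    exact congrArg Level.mk ((comparison_obj_bijective X Y).1 (congrArg Level.of h))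
  · rintro ⟨p⟩
    obtain ⟨v, rfl⟩ := (comparison_obj_bijective X Y).2 p
    exact ⟨⟨v⟩, rfl⟩

variable {X Y n}

theorem homFst_comparison {v w : Vert (join X Y)} (b : Bead (join X Y) n v w) :
    homFst ((levelComparison X Y n).map (X := ⟨v⟩) (Y := ⟨w⟩) b.toHom) =
      (b.map (collapseRight X Y)).toHom :=
  b.nMap_toHom (collapseRight X Y)

theorem homSnd_comparison {v w : Vert (join X Y)} (b : Bead (join X Y) n v w) :
    homSnd ((levelComparison X Y n).map (X := ⟨v⟩) (Y := ⟨w⟩) b.toHom) =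
      (b.map (collapseLeft X Y)).toHom :=
  b.nMap_toHom (collapseLeft X Y)

/-- The components of the image determine the two collapsed beads, since beads embed into arrows,
and `combine` recovers the bead from these. -/
theorem bead_eq_of_comparison {v w : Vert (join X Y)} {b b' : Bead (join X Y) n v w}
    (h : (levelComparison X Y n).map (X := ⟨v⟩) (Y := ⟨w⟩) b.toHom =
      (levelComparison X Y n).map (X := ⟨v⟩) (Y := ⟨w⟩) b'.toHom) : b = b' := by
  have h₁ : (b.map (collapseRight X Y)).toHom = (b'.map (collapseRight X Y)).toHom :=
    (homFst_comparison b).symm.trans ((congrArg homFst h).trans (homFst_comparison b'))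
  have h₂ : (b.map (collapseLeft X Y)).toHom = (b'.map (collapseLeft X Y)).toHom :=
    (homSnd_comparison b).symm.trans ((congrArg homSnd h).trans (homSnd_comparison b'))
  rw [← b.combine_map, ← b'.combine_map, Bead.toHom_injective h₁, Bead.toHom_injective h₂]

theorem exists_bead_of_fibBead {v w : Vert (join X Y)}
    {f : (levelComparison X Y n).obj ⟨v⟩ ⟶ (levelComparison X Y n).obj ⟨w⟩}
    (h : IsBeadArrow (homFst f)) (h' : IsBeadArrow (homSnd f)) :
    ∃ b : Bead (join X Y) n v w,
      (levelComparison X Y n).map (X := ⟨v⟩) (Y := ⟨w⟩) b.toHom = f := by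
  obtain ⟨b₁, hb₁⟩ := h
  obtain ⟨b₂, hb₂⟩ := h'
  refine ⟨Bead.combine b₁ b₂, fibHom_ext ?_ ?_⟩
  · exact (homFst_comparison _).trans
      ((congrArg Bead.toHom (Bead.combine_map_collapseRight b₁ b₂)).trans hb₁)
  · exact (homSnd_comparison _).trans
      ((congrArg Bead.toHom (Bead.combine_map_collapseLeft b₁ b₂)).trans hb₂)

/-- The identity is itself the arrow of a bead, so injectivity on beads applies. -/
theorem isIdentity_of_comparison {v w : Vert (join X Y)} {b : Bead (join X Y) n v w}
    (h : IsIdentity ((levelComparison X Y n).map (X := ⟨v⟩) (Y := ⟨w⟩) b.toHom)) :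
    IsIdentity (C := Level (realObj (join X Y)) n) (a := ⟨v⟩) (b := ⟨w⟩) b.toHom := by
  obtain rfl : v = w := (comparison_obj_bijective X Y).1 (congrArg Level.of h.1)
  have h₁ : b = Bead.one v := by
    refine bead_eq_of_comparison (h.2.trans ?_)
    rw [Bead.toHom_one]
    exact ((levelComparison X Y n).map_id ⟨v⟩).symm
  rw [h₁, Bead.toHom_one]
  exact isIdentity_id (C := Level (realObj (join X Y)) n) ⟨v⟩

theorem levelComparison_map_mem {v w : Level (realObj (join X Y)) n} (f : v ⟶ w)
    (hf : beadArrows (join X Y) n f) : fibBeadArrows X Y n ((levelComparison X Y n).map f) := by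
  obtain ⟨hf, b, rfl⟩ := hf
  exact ⟨fun h => hf (isIdentity_of_comparison h), ⟨_, (homFst_comparison b).symm⟩,
    ⟨_, (homSnd_comparison b).symm⟩⟩

theorem levelComparison_map_bijective (v w : Level (realObj (join X Y)) n) :
    Function.Bijective ((levelComparison X Y n).map : (v ⟶ w) → _) := by
  refine (beadArrows_isFreeOn _ n).map_bijective (fibBeadArrows_isFreeOn X Y n) _
    (levelComparison_obj_bijective X Y n) (fun _ _ f => levelComparison_map_mem f) ?_ ?_ v w
  · rintro v w _ _ ⟨-, b, rfl⟩ ⟨-, b', rfl⟩ h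
    rw [bead_eq_of_comparison h]
  · rintro v w f ⟨hf, h, h'⟩
    obtain ⟨b, rfl⟩ := exists_bead_of_fibBead h h'
    exact ⟨b.toHom, ⟨fun i => hf (isIdArrow_nMap (comparison X Y) _ i), b, rfl⟩, rfl⟩

end Comparison

end SimpCat

/-! ### Isomorphisms of simplicial computads -/

namespace SimpCat

section Inverse

variable {A B : SCat.{u}} {F : EnrichedFunctor SSet.{u} A B}

/-- A simplicial functor is bijective if it is bijective on objects and on `n`-arrows. -/
structure IsBijective (F : EnrichedFunctor SSet.{u} A B) : Prop where
  obj : Function.Bijective F.obj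
  map (a b : A) (n : SimplexCategoryᵒᵖ) :
    Function.Bijective (nMap F : (a ⟶[SSet.{u}] b).obj n → _)

namespace IsBijective

variable (hF : IsBijective F)
include hF

theorem heq_of_nMap_heq {a b a' b' : A} {n : SimplexCategoryᵒᵖ}
    {f : (a ⟶[SSet.{u}] b).obj n} {g : (a' ⟶[SSet.{u}] b').obj n} (ha : F.obj a = F.obj a')
    (hb : F.obj b = F.obj b') (h : HEq (nMap F f) (nMap F g)) : HEq f g := by
  obtain rfl := hF.obj.1 ha
  obtain rfl := hF.obj.1 hb
  exact heq_of_eq ((hF.map _ _ n).1 (eq_of_heq h))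

theorem exists_nMap_heq {b b' : B} {a a' : A} (ha : F.obj a = b) (ha' : F.obj a' = b')
    {n : SimplexCategoryᵒᵖ} (f : (b ⟶[SSet.{u}] b').obj n) :
    ∃ g : (a ⟶[SSet.{u}] a').obj n, HEq (nMap F g) f := by
  subst ha ha'
  obtain ⟨g, rfl⟩ := (hF.map _ _ n).2 f
  exact ⟨g, HEq.rfl⟩

/-- The action on objects of the inverse of a bijective simplicial functor. -/
noncomputable def invObj (b : B) : A := (hF.obj.2 b).choose

theorem obj_invObj (b : B) : F.obj (hF.invObj b) = b := (hF.obj.2 b).choose_spec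

/-- The action on arrows of the inverse of a bijective simplicial functor. -/
noncomputable def invMap {b b' : B} {n : SimplexCategoryᵒᵖ} (f : (b ⟶[SSet.{u}] b').obj n) :
    (hF.invObj b ⟶[SSet.{u}] hF.invObj b').obj n :=
  (hF.exists_nMap_heq (hF.obj_invObj b) (hF.obj_invObj b') f).choose

theorem nMap_invMap {b b' : B} {n : SimplexCategoryᵒᵖ} (f : (b ⟶[SSet.{u}] b').obj n) :
    HEq (nMap F (hF.invMap f)) f :=
  (hF.exists_nMap_heq (hF.obj_invObj b) (hF.obj_invObj b') f).choose_spec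

/-- The inverse of a bijective simplicial functor. -/
noncomputable def inverse : EnrichedFunctor SSet.{u} B A :=
  mkFunctor hF.invObj (fun f => hF.invMap f)
    (fun {b b' n m} θ f => by
      refine (hF.map _ _ m).1 (eq_of_heq ((hF.nMap_invMap _).trans ?_))
      rw [nMap_map]
      exact (map_heq θ (hF.obj_invObj b) (hF.obj_invObj b') (hF.nMap_invMap f)).symm)
    (fun b n => by
      refine (hF.map _ _ n).1 (eq_of_heq ((hF.nMap_invMap _).trans ?_))
      rw [nMap_nId]
      exact (nId_heq (hF.obj_invObj b)).symm)
    (fun {b b' b'' n} f g => by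
      refine (hF.map _ _ n).1 (eq_of_heq ((hF.nMap_invMap _).trans ?_))
      rw [nMap_nComp]
      exact (nComp_heq (hF.obj_invObj b) (hF.obj_invObj b') (hF.obj_invObj b'')
        (hF.nMap_invMap f) (hF.nMap_invMap g)).symm)

theorem inverse_comp : hF.inverse.comp SSet.{u} F = EnrichedFunctor.id SSet.{u} B :=
  functor_hext hF.obj_invObj fun _ _ _ f => hF.nMap_invMap f

theorem comp_inverse : F.comp SSet.{u} hF.inverse = EnrichedFunctor.id SSet.{u} A :=
  functor_hext (fun a => hF.obj.1 (hF.obj_invObj (F.obj a))) fun a b _ f =>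
    hF.heq_of_nMap_heq (hF.obj_invObj (F.obj a)) (hF.obj_invObj (F.obj b))
      (hF.nMap_invMap (nMap F f))

theorem isIdArrow_iff {a b : A} {n : SimplexCategoryᵒᵖ} (f : (a ⟶[SSet.{u}] b).obj n) :
    IsIdArrow (nMap F f) ↔ IsIdArrow f := by
  refine ⟨?_, isIdArrow_nMap F f⟩
  rintro ⟨h, h'⟩
  obtain rfl : a = b := hF.obj.1 (congrArg Level.of h)
  have h' : nMap F f = nId _ n := h'
  obtain rfl : f = nId a n := (hF.map _ _ n).1 (h'.trans (nMap_nId F a n).symm)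
  exact isIdArrow_nId a n

/-- A factorisation of `f` maps to one of its image, one factor of which is an identity; `F`
reflects identities. -/
theorem isAtomicArrow_of_nMap {a b : A} {n : SimplexCategoryᵒᵖ} (f : (a ⟶[SSet.{u}] b).obj n)
    (hf : IsAtomicArrow (nMap F f)) : IsAtomicArrow f := by
  refine ⟨fun h => hf.1 ((hF.isIdArrow_iff f).2 h), fun c g h e => ?_⟩
  have e' : nComp (nMap F (b := c.of) g) (nMap F (a := c.of) h) = nMap F f :=
    (nMap_nComp F (b := c.of) g h).symm.trans (congrArg (nMap F) e)
  exact (hf.2 (c := ⟨F.obj c.of⟩) _ _ e').imp (hF.isIdArrow_iff (b := c.of) g).1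
    (hF.isIdArrow_iff (a := c.of) h).1

theorem inverse_isComputadMorphism : IsComputadMorphism hF.inverse := by
  intro b b' n f hf
  obtain ⟨a, rfl⟩ := hF.obj.2 b
  obtain ⟨a', rfl⟩ := hF.obj.2 b'
  refine Or.inl (hF.isAtomicArrow_of_nMap _ ?_)
  -- The endpoints of `F` applied to the inverse image of `f` agree with those of `f` only
  -- propositionally, so atomicity is transported along these equalities.
  have key : ∀ {c c' : B} (_ : c = F.obj a) (_ : c' = F.obj a') (g : (c ⟶[SSet.{u}] c').obj n),
      HEq g f → IsAtomicArrow g := by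
    rintro _ _ rfl rfl g h
    obtain rfl := eq_of_heq h
    exact hf
  exact key (hF.obj_invObj _) (hF.obj_invObj _) _ (hF.nMap_invMap f)

end IsBijective

theorem IsBijective.isIso_homMk {F : A ⟶ B} (hF : IsBijective F)
    (hA : IsSimplicialComputad A) (hB : IsSimplicialComputad B) (hF' : IsComputadMorphism F) :
    IsIso (SCptd.homMk F hA hB hF') :=
  ⟨⟨⟨hF.inverse, hF.inverse_isComputadMorphism⟩, SCptd.Hom.ext hF.comp_inverse,
    SCptd.Hom.ext hF.inverse_comp⟩⟩

end Inverse

/-! ### The comparison map as an isomorphism of simplicial computads. -/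

section Comparison

variable (X Y : SSet.{u})

theorem comparison_isBijective : IsBijective (comparison X Y) where
  obj := comparison_obj_bijective X Y
  map v w _ := levelComparison_map_bijective ⟨v⟩ ⟨w⟩

theorem comparison_isAtomicArrow {v w : Vert (join X Y)} {n : SimplexCategoryᵒᵖ}
    (f : RealHom (join X Y) n v w)
    (hf : IsAtomicArrow (A := realObj (join X Y)) (a := v) (b := w) f) :
    IsAtomicArrow (nMap (comparison X Y) (a := v) (b := w) f) :=
  ((fibBeadArrows_isFreeOn X Y n).isAtomic_iff _).2 (levelComparison_map_mem _
    (((beadArrows_isFreeOn (join X Y) n).isAtomic_iff (a := ⟨v⟩) (b := ⟨w⟩) f).1 hf))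

/-- Freeness is already known at each level. Stability under degeneracies is transported from the
realisation of `X ⋆ Y` along the comparison map, which preserves and reflects atomic arrows. -/
theorem joinFibre_isSimplicialComputad : IsSimplicialComputad (joinFibre X Y) where
  isComputad n := (fibBeadArrows_isFreeOn X Y n).isComputad
  degenerate_atomic {n m} σ _ {p q} f hf := by
    obtain ⟨v, rfl⟩ := (comparison_obj_bijective X Y).2 p
    obtain ⟨w, rfl⟩ := (comparison_obj_bijective X Y).2 q
    obtain ⟨f, rfl⟩ := ((comparison_isBijective X Y).map v w _).2 f
    have h := (realObj_isSimplicialComputad (join X Y)).degenerate_atomic σ (a := v) (b := w) f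
      ((comparison_isBijective X Y).isAtomicArrow_of_nMap f hf)
    exact nMap_map (comparison X Y) σ.op f ▸ comparison_isAtomicArrow X Y _ h

end Comparison

end SimpCat

theorem mainTheorem8 (X Y : SSet.{u}) :
    ∃ (hA : SimpCat.IsSimplicialComputad (SimpCat.realisation.obj (SimpCat.join X Y)))
      (hB : SimpCat.IsSimplicialComputad
        (SimpCat.fibProd (SimpCat.proj X SimpCat.pt) (SimpCat.proj SimpCat.pt Y)))
      (hΦ : SimpCat.IsComputadMorphism (SimpCat.comparison X Y)),
      IsIso (SCptd.homMk (SimpCat.comparison X Y) hA hB hΦ) :=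
  ⟨SimpCat.realObj_isSimplicialComputad _, SimpCat.joinFibre_isSimplicialComputad X Y,
    fun _ _ _ f hf => Or.inl (SimpCat.comparison_isAtomicArrow X Y f hf),
    (SimpCat.comparison_isBijective X Y).isIso_homMk _ _ _⟩
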